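/- Let $d,l\ge 2$ be integers. For $m\ge 1$ with $d\mid lm$, let $\mathcal G_{m,d,l}$ be a uniformly random $(d,l)$-regular hypergraph with hyperedge set $\{1,\dots,m\}$: each hyperedge consists of $l$ labelled half-edges, and the set of all $lm$ half-edges is partitioned uniformly at random into blocks of size $d$, the vertices (two half-edges of the same hyperedge may lie in the same vertex). A set $M$ of hyperedges is a matching if no two distinct half-edges belonging to hyperedges of $M$ lie in the same vertex. Let $Z_{k}$ be the number of matchings on $\mathcal G_{m,d,l}$ with exactly $k$ hyperedges. Define $$\begin{aligned}\Psi_{d,l}(\beta,\rho,\theta)={}&-\rho\ln\rho-\theta\ln\tfrac{\theta}{l}+(l-1)(1-2\beta+\rho)\ln(1-2\beta+\rho)+\theta\ln(d-1)\\&+2(l-1)(\beta-\rho)\ln(\beta-\rho)-2l\left(\beta-\rho-\tfrac{\theta}{l}\right)\ln\left(\beta-\rho-\tfrac{\theta}{l}\right)\\&-\tfrac{l}{d}\left(1-2\beta d+\rho d+\tfrac{\theta}{l}d\right)\ln\left(1-2\beta d+\rho d+\tfrac{\theta}{l}d\right).\end{aligned}$$ Let $\beta\in(0,\tfrac1d)$,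 and assume that either $l=2$, or $l\ge 3$ and $\beta\le \frac{1}{dl-d-l+2}$. Assume furthermore that $\Psi_{d,l}(\beta,\beta^2,l(d-1)\beta^2)>0$. Then, as $m\to\infty$ along the integers $m$ such that $d\mid lm$ and $m\beta\in\mathbb Z$, $$\frac{\mathbb E\big[Z_{m\beta}^2\big]}{\big(\mathbb E Z_{m\beta}\big)^2}\longrightarrow\frac{1-\beta}{\sqrt{\beta^2(d+l-dl)-2\beta+1}}.$$ -/

import Mathlib

open Filter Topology

/-- A `(d, l)`-regular hypergraph with hyperedge set `Fin m`. The labelled half-edges are the pairs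
`(e, i)` with `e : Fin m`, `i : Fin l`; the half-edge `(e, i)` is part of the hyperedge `e`.
The hypergraph is a partition of the set of half-edges into blocks of size `d`, each block being
a vertex. Two half-edges may share both their vertex and their hyperedge. -/
abbrev RegHypergraph (d l m : ℕ) : Type :=
  {P : Finpartition (Finset.univ : Finset (Fin m × Fin l)) // ∀ B ∈ P.parts, B.card = d}

namespace RegHypergraph

variable {d l m : ℕ}

/-- The vertex (block of half-edges) to which a half-edge is incident. -/
def vertex (G : RegHypergraph d l m) (f : Fin m × Fin l) : Finset (Fin m × Fin l) :=
  G.1.part f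

/-- A set `M` of hyperedges is a matching if no two half-edges of the hyperedges in `M`
share a vertex. -/
def IsMatching (G : RegHypergraph d l m) (M : Finset (Fin m)) : Prop :=
  ∀ f g : Fin m × Fin l, f.1 ∈ M → g.1 ∈ M → f ≠ g → G.vertex f ≠ G.vertex g

instance (G : RegHypergraph d l m) : DecidablePred G.IsMatching := fun M => by
  unfold IsMatching; infer_instance

/-- The number `Z_k` of matchings consisting of exactly `k` hyperedges. -/
def numMatchings (G : RegHypergraph d l m) (k : ℕ) : ℕ :=
  (Finset.univ.filter fun M : Finset (Fin m) => M.card = k ∧ G.IsMatching M).card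

/-- Expectation of `X` over the uniformly random `(d, l)`-regular hypergraph with `m` hyperedges. -/
noncomputable def expectation (d l m : ℕ) (X : RegHypergraph d l m → ℝ) : ℝ :=
  (∑ G : RegHypergraph d l m, X G) / (Fintype.card (RegHypergraph d l m) : ℝ)

end RegHypergraph

/-- The second-moment rate function `Ψ_{d,l}(β, ρ, θ)`. -/
noncomputable def matchingPsi (d l : ℕ) (β ρ θ : ℝ) : ℝ :=
  - ρ * Real.log ρ - θ * Real.log (θ / l)
    + (l - 1) * (1 - 2 * β + ρ) * Real.log (1 - 2 * β + ρ)
    + θ * Real.log (d - 1)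
    + 2 * (l - 1) * (β - ρ) * Real.log (β - ρ)
    - 2 * l * (β - ρ - θ / l) * Real.log (β - ρ - θ / l)
    - l / d * (1 - 2 * β * d + ρ * d + θ / l * d) * Real.log (1 - 2 * β * d + ρ * d + θ / l * d)

/-- The filter `m → ∞` along those `m` for which the model makes sense: the number `l * m` of
half-edges is a multiple of `d`, and the number `m * β` of hyperedges of the matching is an
integer. -/
def admissibleAtTop (d l : ℕ) (β : ℝ) : Filter ℕ :=
  atTop ⊓ 𝓟 {m : ℕ | d ∣ l * m ∧ ∃ k : ℕ, (k : ℝ) = m * β}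

/-! ### The configuration model: hypergraphs as images of bijections onto slots. -/

namespace RegHypergraph

variable {d l m n : ℕ}

/-! The proof is an exact second-moment computation followed by a two-dimensional Laplace method.

With n = lm/d vertices of d slots each, every hypergraph arises from the same number of bijections
between half-edges and slots (`expectation_eq_sum_equiv`), so both moments become counts of
bijections. Pairs of matchings of size k are classified by the number r of common hyperedges and by
the number t of vertices shared by a half-edge of the first matching alone and one of the second
alone. This writes E[Z²]/(EZ)² as a finite sum of explicit weights (`second_moment_ratio_eq_sum`).

Put ρ = r/m and τ = t/(lm). Stirling's formula, kept as an exact identity, gives m · weight =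
prefactor · exp(m(Φ(ρ,τ) − Φ(β², (d−1)β²))) in `overlapWeight_eq`, where Φ is `overlapRate` and
equals Ψ(β, ρ, lτ) up to an additive constant. The point (β², (d−1)β²) is the overlap of two
independent matchings.

The main analytic point is that this centre is the only maximiser of Φ. On the boundary some x log x
term has infinite slope, and moving towards the centre increases Φ
(`overlapRate_not_max_of_boundary`). In the interior the critical equations reduce to two scalar
equations for a correlation ratio e, and `bethe_fixed_point_unique` forces e = 1, which is the
centre. Both alternatives for l enter only through β((d−1)(l−1)+1) ≤ 1.

The same inequality makes the Hessian at the centre nondegenerate. With compactness this gives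
quadratic decay of Φ, hence Gaussian domination of the weights (`overlapWeight_le_gaussian`). On the
scale √m each weight has a Gaussian limit (`tendsto_overlapWeight`), and dominated convergence turns
the sum into a Gaussian integral (`tendsto_lattice_sum`). Its value, computed from the Hessian
determinant, is the claimed constant (`integral_overlapHessian`). -/

/-- Two half-edges are related when `e` sends them to slots of the same vertex. -/
def slotSetoid (e : (Fin m × Fin l) ≃ (Fin n × Fin d)) : Setoid (Fin m × Fin l) :=
  Setoid.ker fun f => (e f).1

instance (e : (Fin m × Fin l) ≃ (Fin n × Fin d)) : DecidableRel (slotSetoid e).r :=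
  fun f g => inferInstanceAs (Decidable ((e f).1 = (e g).1))

/-- The hypergraph whose vertices are the fibres of `f ↦ (e f).1`. -/
def ofEquiv (e : (Fin m × Fin l) ≃ (Fin n × Fin d)) : RegHypergraph d l m :=
  ⟨Finpartition.ofSetoid (slotSetoid e), by
    intro B hB
    obtain ⟨f, hf⟩ := (Finpartition.ofSetoid (slotSetoid e)).nonempty_of_mem_parts hB
    have hB' := ((Finpartition.ofSetoid (slotSetoid e)).part_eq_iff_mem hB).2 hf
    have : B.map e.toEmbedding = ({(e f).1} : Finset (Fin n)) ×ˢ (Finset.univ : Finset (Fin d)) := by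
      ext x
      simp only [Finset.mem_map_equiv, Finset.mem_product, Finset.mem_singleton,
        Finset.mem_univ, and_true]
      rw [← hB', Finpartition.mem_part_ofSetoid_iff_rel, slotSetoid, Setoid.ker_def,
        Equiv.apply_symm_apply]
      exact eq_comm
    have h2 := congrArg Finset.card this
    simpa using h2⟩

theorem vertex_ofEquiv_eq_iff (e : (Fin m × Fin l) ≃ (Fin n × Fin d)) (f g : Fin m × Fin l) :
    (ofEquiv e).vertex f = (ofEquiv e).vertex g ↔ (e f).1 = (e g).1 := by
  unfold vertex
  rw [← Finpartition.mem_part_iff_part_eq_part _ (Finset.mem_univ _) (Finset.mem_univ _)]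
  unfold ofEquiv
  rw [Finpartition.mem_part_ofSetoid_iff_rel, slotSetoid, Setoid.ker_def]
  exact eq_comm

theorem ext_vertex {G G' : RegHypergraph d l m}
    (h : ∀ f g, G.vertex f = G.vertex g ↔ G'.vertex f = G'.vertex g) : G = G' := by
  have hp : ∀ f, G.1.part f = G'.1.part f := by
    intro f
    ext g
    rw [Finpartition.mem_part_iff_part_eq_part _ (Finset.mem_univ _) (Finset.mem_univ _),
      Finpartition.mem_part_iff_part_eq_part _ (Finset.mem_univ _) (Finset.mem_univ _)]
    exact h g f
  apply Subtype.ext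
  apply Finpartition.ext
  ext B
  constructor
  · intro hB
    obtain ⟨f, hf⟩ := G.1.nonempty_of_mem_parts hB
    rw [← (G.1.part_eq_iff_mem hB).2 hf, hp f]
    exact G'.1.part_mem.2 (Finset.mem_univ _)
  · intro hB
    obtain ⟨f, hf⟩ := G'.1.nonempty_of_mem_parts hB
    rw [← (G'.1.part_eq_iff_mem hB).2 hf, ← hp f]
    exact G.1.part_mem.2 (Finset.mem_univ _)

/-- Enumerate the blocks, then the half-edges inside each block. There are exactly n blocks because
each holds d of the ml half-edges. -/
theorem exists_ofEquiv_eq (hd : 0 < d) (hn : n * d = m * l) (G : RegHypergraph d l m) :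
    ∃ e : (Fin m × Fin l) ≃ (Fin n × Fin d), ofEquiv e = G := by
  classical
  obtain ⟨f, hf⟩ := G.1.exists_enumeration
  have hcard : Fintype.card G.1.parts = n := by
    have h1 := G.1.sum_card_parts
    rw [Finset.sum_congr rfl (fun B hB => G.2 B hB)] at h1
    simp only [Finset.sum_const, Finset.card_univ, Fintype.card_prod, Fintype.card_fin,
      smul_eq_mul] at h1
    rw [Fintype.card_coe]
    exact Nat.eq_of_mul_eq_mul_right hd (h1.trans hn.symm)
  let e1 : (Σ t : G.1.parts, Fin t.1.card) ≃ (Fin n × Fin d) :=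
    (Equiv.sigmaCongrRight fun t => finCongr (G.2 t.1 t.2)).trans
      ((Equiv.sigmaEquivProd _ _).trans
        (Equiv.prodCongr (Fintype.equivFinOfCardEq hcard) (Equiv.refl _)))
  let e : (Fin m × Fin l) ≃ (Fin n × Fin d) :=
    ((Equiv.subtypeUnivEquiv (fun x => Finset.mem_univ x)).symm.trans f).trans e1
  refine ⟨e, ext_vertex fun a b => ?_⟩
  rw [vertex_ofEquiv_eq_iff]
  have := hf ⟨a, Finset.mem_univ _⟩ ⟨b, Finset.mem_univ _⟩
  unfold vertex
  rw [this]
  simp [e, e1, Equiv.subtypeUnivEquiv]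

/-- Once one bijection `e0` over `G` is fixed, every other one differs from it by a slot permutation
respecting the vertex partition. The set of these permutations does not depend on `G`. -/
theorem card_ofEquiv_fiber_eq (hd : 0 < d) (hn : n * d = m * l) (G G' : RegHypergraph d l m) :
    Fintype.card {e : (Fin m × Fin l) ≃ (Fin n × Fin d) // ofEquiv e = G} =
      Fintype.card {e : (Fin m × Fin l) ≃ (Fin n × Fin d) // ofEquiv e = G'} := by
  suffices H : ∀ G : RegHypergraph d l m,
      Nonempty ({e : (Fin m × Fin l) ≃ (Fin n × Fin d) // ofEquiv e = G} ≃
        {π : Equiv.Perm (Fin n × Fin d) // ∀ s t, (π s).1 = (π t).1 ↔ s.1 = t.1}) by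
    exact Fintype.card_congr ((H G).some.trans (H G').some.symm)
  intro G
  obtain ⟨e0, rfl⟩ := exists_ofEquiv_eq hd hn G
  refine ⟨Equiv.subtypeEquiv (Equiv.equivCongr e0 (Equiv.refl _)) fun e => ?_⟩
  constructor
  · intro h s t
    have := vertex_ofEquiv_eq_iff e (e0.symm s) (e0.symm t)
    rw [h, vertex_ofEquiv_eq_iff] at this
    simpa [iff_comm] using this
  · intro h
    apply ext_vertex
    intro f g
    rw [vertex_ofEquiv_eq_iff, vertex_ofEquiv_eq_iff]
    simpa using h (e0 f) (e0 g)

/-- Averages over hypergraphs are averages over assignments of half-edges to slots. -/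
theorem expectation_eq_sum_equiv (hd : 0 < d) (hn : n * d = m * l) (X : RegHypergraph d l m → ℝ) :
    expectation d l m X =
      (∑ e : (Fin m × Fin l) ≃ (Fin n × Fin d), X (ofEquiv e)) / ((m * l).factorial : ℝ) := by
  classical
  have hcardS : Fintype.card (Fin m × Fin l) = Fintype.card (Fin n × Fin d) := by simp [hn]
  let e0 : (Fin m × Fin l) ≃ (Fin n × Fin d) := Fintype.equivOfCardEq hcardS
  set K : ℕ := Fintype.card {e : (Fin m × Fin l) ≃ (Fin n × Fin d) // ofEquiv e = ofEquiv e0}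
  have key : ∀ Y : RegHypergraph d l m → ℝ,
      ∑ e : (Fin m × Fin l) ≃ (Fin n × Fin d), Y (ofEquiv e) = K * ∑ G, Y G := by
    intro Y
    rw [← Finset.sum_fiberwise (Finset.univ) (fun e => ofEquiv e) (fun e => Y (ofEquiv e)),
      Finset.mul_sum]
    refine Finset.sum_congr rfl fun G _ => ?_
    rw [Finset.sum_congr rfl (g := fun _ => Y G)
      (fun e he => by rw [(Finset.mem_filter.1 he).2]), Finset.sum_const, nsmul_eq_mul]
    congr 2
    rw [← Fintype.card_subtype]
    exact card_ofEquiv_fiber_eq hd hn _ _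
  have hK : (0 : ℝ) < K := by
    have : Nonempty {e : (Fin m × Fin l) ≃ (Fin n × Fin d) // ofEquiv e = ofEquiv e0} :=
      ⟨⟨e0, rfl⟩⟩
    exact_mod_cast Fintype.card_pos
  have hone := key fun _ => 1
  simp only [Finset.sum_const, Finset.card_univ, nsmul_eq_mul, mul_one] at hone
  rw [Fintype.card_equiv e0] at hone
  simp only [Fintype.card_prod, Fintype.card_fin] at hone
  unfold expectation
  rw [hone, key X, mul_div_mul_left _ _ hK.ne']

theorem isMatching_ofEquiv_iff (e : (Fin m × Fin l) ≃ (Fin n × Fin d)) (M : Finset (Fin m)) :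
    (ofEquiv e).IsMatching M ↔
      Set.InjOn (fun f => (e f).1) {f : Fin m × Fin l | f.1 ∈ M} := by
  unfold IsMatching
  simp only [ne_eq, vertex_ofEquiv_eq_iff]
  constructor
  · intro h f hf g hg hfg
    by_contra hne
    exact h f g hf hg hne hfg
  · intro h f g hf hg hne hfg
    exact hne (h hf hg hfg)

end RegHypergraph

/-! ### Counting injections, extensions and intersecting pairs of sets. -/

section Counting

open Polynomial in
theorem coeff_one_add_C_mul_X_pow (c N j : ℕ) :
    ((1 + C c * X : ℕ[X]) ^ N).coeff j = N.choose j * c ^ j := by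
  have : (1 + C c * X : ℕ[X]) ^ N = ((1 + X : ℕ[X]) ^ N).comp (C c * X) := by simp
  rw [this, comp_C_mul_X_coeff, coeff_one_add_X_pow]
  simp

open Polynomial in
theorem coeff_prod_one_add_C_mul_X {ι : Type*} [DecidableEq ι] (s : Finset ι) (w : ι → ℕ) (b : ℕ) :
    (∏ i ∈ s, (1 + C (w i) * X : ℕ[X])).coeff b = ∑ U ∈ s.powersetCard b, ∏ i ∈ U, w i := by
  rw [Finset.prod_one_add, finsetSum_coeff, Finset.powersetCard_eq_filter, Finset.sum_filter]
  refine Finset.sum_congr rfl fun U _ => ?_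
  rw [Finset.prod_mul_distrib, Finset.prod_const, ← map_prod, coeff_C_mul, coeff_X_pow]
  simp [eq_comm]

theorem card_embedding_map_univ_eq {B X : Type*} [Fintype B] [DecidableEq B] [Fintype X]
    [DecidableEq X] (U : Finset X) (hU : U.card = Fintype.card B) :
    (Finset.univ.filter fun h : B ↪ X => Finset.univ.map h = U).card =
      (Fintype.card B).factorial := by
  have e0 : B ≃ U := Fintype.equivOfCardEq (by simp [hU])
  rw [← Fintype.card_equiv e0, ← Fintype.card_subtype]
  symm
  refine Fintype.card_congr (Equiv.ofBijective
    (fun e : B ≃ U => (⟨e.toEmbedding.trans (Function.Embedding.subtype _), ?_⟩ :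
      {h : B ↪ X // Finset.univ.map h = U})) ⟨?_, ?_⟩)
  · ext x
    simp only [Finset.mem_map, Finset.mem_univ, true_and, Function.Embedding.trans_apply,
      Equiv.coe_toEmbedding, Function.Embedding.subtype_apply]
    constructor
    · rintro ⟨y, rfl⟩
      exact (e y).2
    · intro hx
      exact ⟨e.symm ⟨x, hx⟩, by simp⟩
  · intro e e' h
    ext y
    have := DFunLike.congr_fun (congrArg Subtype.val h) y
    simpa using this
  · rintro ⟨h, hh⟩
    have hmem : ∀ y, h y ∈ U := fun y => by
      rw [← hh]; exact Finset.mem_map_of_mem _ (Finset.mem_univ _)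
    have hb : Function.Bijective (fun y => (⟨h y, hmem y⟩ : U)) := by
      rw [Fintype.bijective_iff_injective_and_card]
      refine ⟨fun y y' hy => h.injective (congrArg Subtype.val hy), by simp [hU]⟩
    refine ⟨Equiv.ofBijective _ hb, ?_⟩
    apply Subtype.ext
    ext y
    simp

/-- Grouping injections by their image gives b! times an elementary symmetric polynomial of the
weights, which is then read off as a coefficient of ∏(1 + wᵢX). -/
theorem sum_embedding_prod {B X : Type*} [Fintype B] [DecidableEq B] [Fintype X]
    [DecidableEq X] (w : X → ℕ) :
    ∑ h : B ↪ X, ∏ y, w (h y) =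
      (Fintype.card B).factorial *
        ∑ U ∈ (Finset.univ : Finset X).powersetCard (Fintype.card B), ∏ i ∈ U, w i := by
  have hmaps : ∀ h ∈ (Finset.univ : Finset (B ↪ X)), Finset.univ.map h ∈
      (Finset.univ : Finset X).powersetCard (Fintype.card B) := by
    intro h _
    simp [Finset.mem_powersetCard]
  rw [← Finset.sum_fiberwise_of_maps_to hmaps, Finset.mul_sum]
  refine Finset.sum_congr rfl fun U hU => ?_
  rw [Finset.sum_congr rfl (g := fun _ => ∏ i ∈ U, w i), Finset.sum_const,
    card_embedding_map_univ_eq U (Finset.mem_powersetCard.1 hU).2, smul_eq_mul]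
  intro h hh
  rw [← (Finset.mem_filter.1 hh).2, Finset.prod_map]

theorem card_fst_injective {A : Type*} [Fintype A] [DecidableEq A] (n d : ℕ) :
    (Finset.univ.filter fun f : A → Fin n × Fin d => Function.Injective fun x => (f x).1).card =
      n.descFactorial (Fintype.card A) * d ^ Fintype.card A := by
  have e : {f : A → Fin n × Fin d // Function.Injective fun x => (f x).1} ≃
      (A ↪ Fin n) × (A → Fin d) :=
    { toFun := fun f => (⟨fun x => (f.1 x).1, f.2⟩, fun x => (f.1 x).2)
      invFun := fun p => ⟨fun x => (p.1 x, p.2 x), p.1.injective⟩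
      left_inv := fun f => rfl
      right_inv := fun p => rfl }
  rw [← Fintype.card_subtype, Fintype.card_congr e]
  simp [Fintype.card_embedding_eq]

/-- The number of ways to choose `b` slots in distinct vertices, where `b` of the vertices have
`d - 1` free slots and `q` have `d` free slots. -/
def extensionCount (d b q : ℕ) : ℕ :=
  b.factorial * ∑ t ∈ Finset.range (b + 1),
    (b.choose t * (d - 1) ^ t) * (q.choose (b - t) * d ^ (b - t))

/-- Here `f` places the half-edges of the first matching, `C` is the part belonging to common
hyperedges, and `B` holds the half-edges of the second matching alone. A vertex offers 0 slots if it
meets `C`, d−1 if it meets the rest of `A`, and d otherwise. The count is therefore b! times the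
coefficient of X^b in (1+(d−1)X)^b (1+dX)^q. -/
theorem card_extension {A B : Type*} [Fintype A] [DecidableEq A] [Fintype B] [DecidableEq B]
    {n d : ℕ} (f : A → Fin n × Fin d) (hf : Function.Injective fun x => (f x).1) (C : Finset A)
    (hC : Cᶜ.card = Fintype.card B) :
    (Finset.univ.filter fun g : B → Fin n × Fin d => (Function.Injective fun y => (g y).1) ∧
      ∀ y, (∀ x, f x ≠ g y) ∧ ∀ c ∈ C, (f c).1 ≠ (g y).1).card =
      extensionCount d (Fintype.card B) (n - Fintype.card A) := by
  -- `J i` is the set of slots at vertex `i` still available to the second matching.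
  set J : Fin n → Finset (Fin d) := fun i =>
    Finset.univ.filter fun j => (∀ x, f x ≠ (i, j)) ∧ ∀ c ∈ C, (f c).1 ≠ i with hJ
  have e : {g : B → Fin n × Fin d // (Function.Injective fun y => (g y).1) ∧
      ∀ y, (∀ x, f x ≠ g y) ∧ ∀ c ∈ C, (f c).1 ≠ (g y).1} ≃
      Σ h : B ↪ Fin n, ∀ y, J (h y) :=
    { toFun := fun g => ⟨⟨fun y => (g.1 y).1, g.2.1⟩, fun y => ⟨(g.1 y).2, by
        simpa [hJ] using g.2.2 y⟩⟩
      invFun := fun p => ⟨fun y => (p.1 y, (p.2 y).1), p.1.injective, fun y => by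
        exact (Finset.mem_filter.1 (p.2 y).2).2⟩
      left_inv := fun g => rfl
      right_inv := fun p => rfl }
  rw [← Fintype.card_subtype, Fintype.card_congr e, Fintype.card_sigma]
  simp only [Fintype.card_pi, Fintype.card_coe]
  rw [sum_embedding_prod (fun i => (J i).card), ← coeff_prod_one_add_C_mul_X, extensionCount]
  congr 1
  have hw1 : ∀ c ∈ C, (J (f c).1).card = 0 := by
    intro c hc
    rw [Finset.card_eq_zero, hJ, Finset.filter_eq_empty_iff]
    intro j _ h
    exact h.2 c hc rfl
  have hw2 : ∀ a ∈ Cᶜ, (J (f a).1).card = d - 1 := by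
    intro a ha
    have : J (f a).1 = Finset.univ.erase (f a).2 := by
      ext j
      simp only [hJ, Finset.mem_filter, Finset.mem_univ, true_and, Finset.mem_erase, and_true]
      constructor
      · rintro ⟨h, -⟩ rfl
        exact h a rfl
      · intro h
        refine ⟨fun x hx => ?_, fun c hc hca => ?_⟩
        · have : x = a := hf (show (f x).1 = (f a).1 by rw [hx])
          subst this
          exact h (congrArg Prod.snd hx).symm
        · have : c = a := hf hca
          subst this
          exact Finset.mem_compl.1 ha hc
    rw [this, Finset.card_erase_of_mem (Finset.mem_univ _)]
    simp
  have hw3 : ∀ i ∈ ((Finset.univ : Finset A).map ⟨_, hf⟩)ᶜ, (J i).card = d := by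
    intro i hi
    have hi' : ∀ x, (f x).1 ≠ i := by simpa using hi
    have : J i = Finset.univ := by
      ext j
      simp only [hJ, Finset.mem_filter, Finset.mem_univ, true_and, iff_true]
      exact ⟨fun x hx => hi' x (by rw [hx]), fun c _ => hi' c⟩
    rw [this]; simp
  rw [← Finset.prod_mul_prod_compl ((Finset.univ : Finset A).map ⟨_, hf⟩), Finset.prod_map,
    ← Finset.prod_mul_prod_compl C]
  simp only [Function.Embedding.coeFn_mk]
  rw [Finset.prod_congr rfl (fun c hc => by rw [hw1 c hc]),
    Finset.prod_congr rfl (fun c hc => by rw [hw2 c hc]) (s₁ := Cᶜ),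
    Finset.prod_congr rfl (fun c hc => by rw [hw3 c hc]) (s₁ := (Finset.map _ _)ᶜ)]
  simp only [map_zero, zero_mul, add_zero, Finset.prod_const_one, one_mul, Finset.prod_const]
  rw [hC, Polynomial.coeff_mul, Finset.Nat.sum_antidiagonal_eq_sum_range_succ_mk]
  simp only [coeff_one_add_C_mul_X_pow]
  simp [Finset.card_compl]

/-- A property seen only through a subset `ι` of the domain is counted on injections of `ι`; each
such injection extends to a bijection in (N − |ι|)! ways. -/
theorem card_equiv_comp {α β ι : Type*} [Fintype α] [DecidableEq α] [Fintype β] [DecidableEq β]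
    [Fintype ι] [DecidableEq ι] (hαβ : Fintype.card α = Fintype.card β) (i : ι ↪ α)
    (P : (ι → β) → Prop) [DecidablePred P] :
    (Finset.univ.filter fun e : α ≃ β => P (fun x => e (i x))).card =
      (Finset.univ.filter fun f : ι → β => Function.Injective f ∧ P f).card *
        (Fintype.card β - Fintype.card ι).factorial := by
  have hmaps : ∀ e ∈ (Finset.univ.filter fun e : α ≃ β => P (fun x => e (i x))),
      (fun x => e (i x)) ∈ (Finset.univ.filter fun f : ι → β => Function.Injective f ∧ P f) := by
    intro e he
    simp only [Finset.mem_filter, Finset.mem_univ, true_and] at he ⊢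
    exact ⟨e.injective.comp i.injective, he⟩
  rw [Finset.card_eq_sum_card_fiberwise hmaps, Finset.sum_const_nat]
  intro f hf
  simp only [Finset.mem_filter, Finset.mem_univ, true_and] at hf
  obtain ⟨hinj, hP⟩ := hf
  rw [Finset.filter_filter]
  let e0 : Set.range i ≃ Set.range f :=
    (Equiv.ofInjective i i.injective).symm.trans (Equiv.ofInjective f hinj)
  have he0 : ∀ x, ((e0 ⟨i x, x, rfl⟩ : Set.range f) : β) = f x := by
    intro x
    have : (Equiv.ofInjective i i.injective).symm ⟨i x, x, rfl⟩ = x :=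
      Equiv.ofInjective_symm_apply i.injective x
    simp [e0]
  have hcard : Fintype.card ((Set.range i)ᶜ : Set α) = Fintype.card β - Fintype.card ι := by
    rw [Fintype.card_compl_set, ← hαβ, Set.card_range_of_injective i.injective]
  have hcard' : Fintype.card ((Set.range f)ᶜ : Set β) = Fintype.card β - Fintype.card ι := by
    rw [Fintype.card_compl_set, Set.card_range_of_injective hinj]
  have e1 : ((Set.range i)ᶜ : Set α) ≃ ((Set.range f)ᶜ : Set β) :=
    Fintype.equivOfCardEq (hcard.trans hcard'.symm)
  -- Bijections extending `e0` correspond to bijections between the complements of its domain and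
  -- range.
  rw [← hcard, ← Fintype.card_equiv e1, ← Fintype.card_congr (Equiv.Set.compl e0),
    ← Fintype.card_subtype]
  refine Fintype.card_congr (Equiv.subtypeEquivRight fun e => ?_)
  constructor
  · rintro ⟨-, h⟩ ⟨_, x, rfl⟩
    rw [he0, ← h]
  · intro h
    have h' : (fun x => e (i x)) = f := by
      funext x
      rw [← he0 x]
      exact h ⟨i x, x, rfl⟩
    exact ⟨h' ▸ hP, h'⟩

/-- A set `M'` is the disjoint union of its traces on `M` and on the complement, which can be chosen
independently. -/
theorem card_powersetCard_inter_eq {α : Type*} [Fintype α] [DecidableEq α] (M : Finset α) (k r : ℕ)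
    (hM : M.card = k) (hr : r ≤ k) :
    (((Finset.univ : Finset α).powersetCard k).filter fun M' => (M ∩ M').card = r).card =
      k.choose r * (Fintype.card α - k).choose (k - r) := by
  rw [← hM, ← Finset.card_compl, ← Finset.card_powersetCard r M,
    ← Finset.card_powersetCard (M.card - r) Mᶜ, ← Finset.card_product]
  refine Finset.card_bij' (fun M' _ => (M ∩ M', Mᶜ ∩ M')) (fun p _ => p.1 ∪ p.2) ?_ ?_ ?_ ?_
  · intro M' h
    simp only [Finset.mem_filter, Finset.mem_powersetCard, Finset.subset_univ, true_and,
      Finset.mem_product] at h ⊢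
    refine ⟨⟨Finset.inter_subset_left, h.2⟩, Finset.inter_subset_left, ?_⟩
    have h1 : (M ∩ M').card + (Mᶜ ∩ M').card = M'.card := by
      rw [← Finset.card_union_of_disjoint]
      · rw [← Finset.union_inter_distrib_right, Finset.union_compl, Finset.univ_inter]
      · exact Finset.disjoint_of_subset_left Finset.inter_subset_left
          (Finset.disjoint_of_subset_right Finset.inter_subset_left disjoint_compl_right)
    omega
  · rintro ⟨p, q⟩ h
    simp only [Finset.mem_filter, Finset.mem_powersetCard, Finset.subset_univ, true_and,
      Finset.mem_product] at h ⊢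
    have hd : Disjoint M q := Finset.disjoint_of_subset_right h.2.1 disjoint_compl_right
    constructor
    · rw [Finset.card_union_of_disjoint (Finset.disjoint_of_subset_left h.1.1 hd)]
      omega
    · rw [Finset.inter_union_distrib_left, Finset.disjoint_iff_inter_eq_empty.1 hd,
        Finset.union_empty, Finset.inter_eq_right.2 h.1.1, h.1.2]
  · intro M' _
    simp only
    rw [← Finset.union_inter_distrib_right, Finset.union_compl, Finset.univ_inter]
  · rintro ⟨p, q⟩ h
    simp only [Finset.mem_powersetCard, Finset.mem_product] at h
    have hd : Disjoint M q := Finset.disjoint_of_subset_right h.2.1 disjoint_compl_right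
    have hd' : Disjoint Mᶜ p := Finset.disjoint_of_subset_right h.1.1 disjoint_compl_left
    simp only [Prod.mk.injEq]
    constructor
    · rw [Finset.inter_union_distrib_left, Finset.disjoint_iff_inter_eq_empty.1 hd,
        Finset.union_empty, Finset.inter_eq_right.2 h.1.1]
    · rw [Finset.inter_union_distrib_left, Finset.disjoint_iff_inter_eq_empty.1 hd',
        Finset.empty_union, Finset.inter_eq_right.2 h.2.1]

end Counting

/-! ### Exact first and second moments. -/

namespace RegHypergraph

variable {d l m n : ℕ}

theorem card_isMatching_ofEquiv (hn : n * d = m * l) (M : Finset (Fin m)) :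
    (Finset.univ.filter fun e : (Fin m × Fin l) ≃ (Fin n × Fin d) =>
      (ofEquiv e).IsMatching M).card =
      n.descFactorial (M.card * l) * d ^ (M.card * l) * (m * l - M.card * l).factorial := by
  let i : M × Fin l ↪ Fin m × Fin l :=
    (Function.Embedding.subtype _).prodMap (Function.Embedding.refl _)
  have h := card_equiv_comp (α := Fin m × Fin l) (β := Fin n × Fin d) (by simp [hn]) i
    (fun f => Function.Injective fun x => (f x).1)
  have h2 := card_fst_injective (A := M × Fin l) n d
  have h3 : (Finset.univ.filter fun f : M × Fin l → Fin n × Fin d => Function.Injective f ∧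
      Function.Injective fun x => (f x).1) =
      (Finset.univ.filter fun f : M × Fin l → Fin n × Fin d =>
        Function.Injective fun x => (f x).1) := by
    refine Finset.filter_congr fun f _ => and_iff_right_of_imp fun hf => ?_
    exact Function.Injective.of_comp (f := Prod.fst) hf
  rw [h3, h2] at h
  simp only [Fintype.card_prod, Fintype.card_coe, Fintype.card_fin, hn] at h
  rw [← h]
  congr 1
  refine Finset.filter_congr fun e _ => ?_
  rw [isMatching_ofEquiv_iff]
  constructor
  · rintro hM ⟨x, j⟩ ⟨x', j'⟩ hx
    have := @hM (i (x, j)) x.2 (i (x', j')) x'.2 hx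
    exact i.injective this
  · rintro hM ⟨x, j⟩ hx ⟨x', j'⟩ hx' hxx
    have := @hM (⟨x, hx⟩, j) (⟨x', hx'⟩, j') hxx
    exact congrArg i this

/-- Place the half-edges of `M` at distinct vertices, then those of `M' \ M` by `card_extension`,
then all the others arbitrarily. -/
theorem card_isMatching_isMatching_ofEquiv (hn : n * d = m * l) {k r : ℕ} (M M' : Finset (Fin m))
    (hM : M.card = k) (hM' : M'.card = k) (hr : (M ∩ M').card = r) :
    (Finset.univ.filter fun e : (Fin m × Fin l) ≃ (Fin n × Fin d) =>
      (ofEquiv e).IsMatching M ∧ (ofEquiv e).IsMatching M').card =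
      n.descFactorial (k * l) * d ^ (k * l) * extensionCount d ((k - r) * l) (n - k * l) *
        (m * l - (k * l + (k - r) * l)).factorial := by
  have hsd : (M' \ M).card = k - r := by
    rw [Finset.card_sdiff, hM', hr]
  let A := M × Fin l
  let B := (M' \ M : Finset (Fin m)) × Fin l
  let i : A ⊕ B ↪ Fin m × Fin l :=
    ⟨Sum.elim (fun x => (x.1.1, x.2)) (fun y => (y.1.1, y.2)), by
      rintro (⟨x, j⟩ | ⟨y, j⟩) (⟨x', j'⟩ | ⟨y', j'⟩) h
      · simp only [Sum.elim_inl, Prod.mk.injEq] at h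
        rw [Subtype.ext h.1, h.2]
      · simp only [Sum.elim_inl, Sum.elim_inr, Prod.mk.injEq] at h
        exact absurd (h.1 ▸ x.2) (Finset.mem_sdiff.1 y'.2).2
      · simp only [Sum.elim_inl, Sum.elim_inr, Prod.mk.injEq] at h
        exact absurd (h.1 ▸ x'.2) (Finset.mem_sdiff.1 y.2).2
      · simp only [Sum.elim_inr, Prod.mk.injEq] at h
        rw [Subtype.ext h.1, h.2]⟩
  let C : Finset A := Finset.univ.filter fun x => x.1.1 ∈ M'
  have hA : Fintype.card A = k * l := by
    rw [Fintype.card_prod, Fintype.card_coe, Fintype.card_fin, hM]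
  have hB : Fintype.card B = (k - r) * l := by
    rw [Fintype.card_prod, Fintype.card_coe, Fintype.card_fin, hsd]
  have hC : Cᶜ.card = Fintype.card B := by
    have h1 : C = (Finset.univ.filter fun x : M => x.1 ∈ M') ×ˢ (Finset.univ : Finset (Fin l)) := by
      ext x
      rw [Finset.mem_product]
      simp only [C, Finset.mem_filter, Finset.mem_univ, true_and, and_true]
    have h2 : (Finset.univ.filter fun x : M => x.1 ∈ M').card = r := by
      rw [← hr, ← Finset.card_map (Function.Embedding.subtype _)]
      congr 1
      ext x
      simp [and_comm]
    rw [Finset.card_compl, hA, hB, h1, Finset.card_product, h2]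
    simp [Nat.sub_mul]
  -- Given distinct vertices within `A` and within `B`, injectivity of the whole placement only adds
  -- that `B` avoids the slots already used by `A`. This is the form `card_extension` counts.
  have hpair : ∀ f : A ⊕ B → Fin n × Fin d,
      (Function.Injective f ∧ ((Function.Injective fun x : A => (f (Sum.inl x)).1) ∧
        (Function.Injective fun y : B => (f (Sum.inr y)).1) ∧
        ∀ y, ∀ c ∈ C, (f (Sum.inl c)).1 ≠ (f (Sum.inr y)).1)) ↔
      (Function.Injective fun x : A => (f (Sum.inl x)).1) ∧
        ((Function.Injective fun y : B => (f (Sum.inr y)).1) ∧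
        ∀ y, (∀ x, f (Sum.inl x) ≠ f (Sum.inr y)) ∧
          ∀ c ∈ C, (f (Sum.inl c)).1 ≠ (f (Sum.inr y)).1) := by
    intro f
    constructor
    · rintro ⟨h1, h2, h3, h4⟩
      exact ⟨h2, h3, fun y => ⟨fun x hx => by simpa using h1 hx, h4 y⟩⟩
    · rintro ⟨h2, h3, h4⟩
      refine ⟨?_, h2, h3, fun y => (h4 y).2⟩
      rintro (x | y) (x' | y') h
      · exact congrArg Sum.inl (h2 (congrArg Prod.fst h))
      · exact absurd h ((h4 y').1 x)
      · exact absurd h.symm ((h4 y).1 x')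
      · exact congrArg Sum.inr (h3 (congrArg Prod.fst h))
  have hcount : (Finset.univ.filter fun f : A ⊕ B → Fin n × Fin d => Function.Injective f ∧
      ((Function.Injective fun x : A => (f (Sum.inl x)).1) ∧
        (Function.Injective fun y : B => (f (Sum.inr y)).1) ∧
        ∀ y, ∀ c ∈ C, (f (Sum.inl c)).1 ≠ (f (Sum.inr y)).1)).card =
      n.descFactorial (k * l) * d ^ (k * l) * extensionCount d ((k - r) * l) (n - k * l) := by
    rw [Finset.filter_congr fun f _ => hpair f, ← Fintype.card_subtype]
    have e : {f : A ⊕ B → Fin n × Fin d // (Function.Injective fun x : A => (f (Sum.inl x)).1) ∧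
        ((Function.Injective fun y : B => (f (Sum.inr y)).1) ∧
        ∀ y, (∀ x, f (Sum.inl x) ≠ f (Sum.inr y)) ∧
          ∀ c ∈ C, (f (Sum.inl c)).1 ≠ (f (Sum.inr y)).1)} ≃
        Σ f : {f : A → Fin n × Fin d // Function.Injective fun x => (f x).1},
          {g : B → Fin n × Fin d // (Function.Injective fun y => (g y).1) ∧
            ∀ y, (∀ x, f.1 x ≠ g y) ∧ ∀ c ∈ C, (f.1 c).1 ≠ (g y).1} :=
      { toFun := fun f => ⟨⟨fun x => f.1 (Sum.inl x), f.2.1⟩, ⟨fun y => f.1 (Sum.inr y), f.2.2⟩⟩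
        invFun := fun p => ⟨Sum.elim p.1.1 p.2.1, p.1.2, p.2.2⟩
        left_inv := fun f => by
          apply Subtype.ext
          funext x
          rcases x with x | x <;> rfl
        right_inv := fun p => rfl }
    rw [← Nat.card_eq_fintype_card, Nat.card_congr e, Nat.card_sigma]
    simp only [Nat.card_eq_fintype_card, Fintype.card_subtype]
    rw [Finset.sum_congr rfl fun f _ => card_extension f.1 f.2 C hC, Finset.sum_const,
      Finset.card_univ, Fintype.card_subtype, card_fst_injective, hA, hB, smul_eq_mul]
  have h := card_equiv_comp (α := Fin m × Fin l) (β := Fin n × Fin d) (by simp [hn]) i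
    (fun f => (Function.Injective fun x : A => (f (Sum.inl x)).1) ∧
        (Function.Injective fun y : B => (f (Sum.inr y)).1) ∧
        ∀ y, ∀ c ∈ C, (f (Sum.inl c)).1 ≠ (f (Sum.inr y)).1)
  rw [hcount, Fintype.card_sum, hA, hB] at h
  simp only [Fintype.card_prod, Fintype.card_fin, hn] at h
  rw [← h]
  congr 1
  refine Finset.filter_congr fun e _ => ?_
  rw [isMatching_ofEquiv_iff, isMatching_ofEquiv_iff]
  constructor
  · rintro ⟨h1, h2⟩
    refine ⟨fun x x' hx => ?_, fun y y' hy => ?_, fun y c hc hcy => ?_⟩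
    · have := @h1 (i (Sum.inl x)) x.1.2 (i (Sum.inl x')) x'.1.2 hx
      simpa using i.injective this
    · have := @h2 (i (Sum.inr y)) (Finset.mem_sdiff.1 y.1.2).1 (i (Sum.inr y'))
        (Finset.mem_sdiff.1 y'.1.2).1 hy
      simpa using i.injective this
    · have := @h2 (i (Sum.inl c)) (Finset.mem_filter.1 hc).2 (i (Sum.inr y))
        (Finset.mem_sdiff.1 y.1.2).1 hcy
      simpa using i.injective this
  · rintro ⟨h1, h2, h3⟩
    constructor
    · rintro ⟨x, j⟩ hx ⟨x', j'⟩ hx' hxx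
      have := @h1 (⟨x, hx⟩, j) (⟨x', hx'⟩, j') hxx
      exact congrArg (fun z => i (Sum.inl z)) this
    · have hcase : ∀ x : Fin m, x ∈ M' → ∀ j : Fin l,
          (∃ c ∈ C, i (Sum.inl c) = (x, j)) ∨ ∃ y, i (Sum.inr y) = (x, j) := by
        intro x hx j
        by_cases hxM : x ∈ M
        · exact Or.inl ⟨(⟨x, hxM⟩, j), by simp [C, hx], rfl⟩
        · exact Or.inr ⟨(⟨x, Finset.mem_sdiff.2 ⟨hx, hxM⟩⟩, j), rfl⟩
      rintro ⟨x, j⟩ hx ⟨x', j'⟩ hx' hxx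
      rcases hcase x hx j with ⟨c, hc, hcx⟩ | ⟨y, hy⟩ <;>
        rcases hcase x' hx' j' with ⟨c', hc', hcx'⟩ | ⟨y', hy'⟩
      · rw [← hcx, ← hcx'] at hxx ⊢
        exact congrArg (fun z => i (Sum.inl z)) (h1 hxx)
      · rw [← hcx, ← hy'] at hxx
        exact absurd hxx (h3 y' c hc)
      · rw [← hy, ← hcx'] at hxx
        exact absurd hxx.symm (h3 y c' hc')
      · rw [← hy, ← hy'] at hxx ⊢
        exact congrArg (fun z => i (Sum.inr z)) (h2 hxx)

theorem numMatchings_eq_sum (G : RegHypergraph d l m) (k : ℕ) :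
    (G.numMatchings k : ℝ) =
      ∑ M ∈ (Finset.univ : Finset (Fin m)).powersetCard k, if G.IsMatching M then (1 : ℝ) else 0 := by
  rw [Finset.sum_boole]
  unfold numMatchings
  congr 2
  ext M
  simp [Finset.mem_powersetCard]

/-- The first moment of the number of matchings of size `k`. -/
theorem expectation_numMatchings (hd : 0 < d) (hn : n * d = m * l) (k : ℕ) :
    expectation d l m (fun G => (G.numMatchings k : ℝ)) =
      (m.choose k * (n.descFactorial (k * l) * d ^ (k * l) * (m * l - k * l).factorial) : ℕ) /
        ((m * l).factorial : ℝ) := by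
  rw [expectation_eq_sum_equiv hd hn]
  congr 1
  simp only [numMatchings_eq_sum]
  rw [Finset.sum_comm]
  simp only [Finset.sum_boole]
  rw [Finset.sum_congr rfl fun M hM => by
    rw [card_isMatching_ofEquiv hn M, (Finset.mem_powersetCard.1 hM).2]]
  simp [Finset.card_powersetCard]

/-- The second moment of the number of matchings of size `k`. -/
theorem expectation_numMatchings_sq (hd : 0 < d) (hn : n * d = m * l) (k : ℕ) :
    expectation d l m (fun G => (G.numMatchings k : ℝ) ^ 2) =
      (∑ r ∈ Finset.range (k + 1), m.choose k * (k.choose r * (m - k).choose (k - r)) *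
        (n.descFactorial (k * l) * d ^ (k * l) * extensionCount d ((k - r) * l) (n - k * l) *
        (m * l - (k * l + (k - r) * l)).factorial) : ℕ) / ((m * l).factorial : ℝ) := by
  rw [expectation_eq_sum_equiv hd hn]
  congr 1
  simp only [numMatchings_eq_sum, sq, Finset.sum_mul_sum]
  rw [Finset.sum_comm]
  rw [Finset.sum_congr rfl fun M _ => Finset.sum_comm]
  simp only [← ite_and, mul_ite, mul_one, mul_zero]
  have h1 : ∀ M ∈ (Finset.univ : Finset (Fin m)).powersetCard k,
      ∑ M' ∈ (Finset.univ : Finset (Fin m)).powersetCard k,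
        ∑ e : (Fin m × Fin l) ≃ (Fin n × Fin d),
          (if (ofEquiv e).IsMatching M' ∧ (ofEquiv e).IsMatching M then (1 : ℝ) else 0) =
      ((∑ r ∈ Finset.range (k + 1), (k.choose r * (m - k).choose (k - r)) *
        (n.descFactorial (k * l) * d ^ (k * l) * extensionCount d ((k - r) * l) (n - k * l) *
        (m * l - (k * l + (k - r) * l)).factorial) : ℕ) : ℝ) := by
    intro M hM
    have hMk := (Finset.mem_powersetCard.1 hM).2
    have hmaps : ∀ M' ∈ (Finset.univ : Finset (Fin m)).powersetCard k,
        (M ∩ M').card ∈ Finset.range (k + 1) := by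
      intro M' _
      rw [Finset.mem_range, Nat.lt_succ_iff, ← hMk]
      exact Finset.card_le_card Finset.inter_subset_left
    simp only [Finset.sum_boole]
    rw [← Nat.cast_sum]
    congr 1
    rw [← Finset.sum_fiberwise_of_maps_to hmaps]
    refine Finset.sum_congr rfl fun r hr => ?_
    rw [Finset.sum_congr rfl fun M' hM' => ?_, Finset.sum_const,
      card_powersetCard_inter_eq M k r hMk (Nat.lt_succ_iff.1 (Finset.mem_range.1 hr)),
      Fintype.card_fin, smul_eq_mul]
    obtain ⟨hM'1, hM'2⟩ := Finset.mem_filter.1 hM'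
    rw [← card_isMatching_isMatching_ofEquiv hn M M' hMk (Finset.mem_powersetCard.1 hM'1).2 hM'2]
    simp only [and_comm]
  rw [Finset.sum_congr rfl h1, Finset.sum_const, Finset.card_powersetCard, Finset.card_univ,
    Fintype.card_fin, nsmul_eq_mul, ← Nat.cast_mul, Finset.mul_sum]
  simp only [mul_assoc]

end RegHypergraph

/-! ### Uniqueness of the critical point. -/

section BetheUniqueness

/-- By convexity the increment over [0, y] is at most y times the derivative at the right end. It
complements Bernoulli's inequality, which uses the left end. -/
theorem one_add_pow_le_one_add_mul (y : ℝ) (hy : 0 ≤ y) (n : ℕ) :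
    (1 + y) ^ (n + 1) ≤ 1 + (n + 1) * y * (1 + y) ^ n := by
  induction n with
  | zero => simp
  | succ n ih =>
    have h1 : 1 ≤ (1 + y) ^ (n + 1) := one_le_pow₀ (by linarith)
    have h2 := mul_le_mul_of_nonneg_left ih (by linarith : 0 ≤ 1 + y)
    have h3 : (1 + y) * (1 + y) ^ (n + 1) = (1 + y) ^ (n + 2) := by ring
    have h4 : (1 + y) * (1 + (n + 1) * y * (1 + y) ^ n) =
        1 + y + (n + 1) * y * (1 + y) ^ (n + 1) := by ring
    rw [h3, h4] at h2
    push_cast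
    nlinarith [mul_le_mul_of_nonneg_left h1 hy]

theorem one_add_pow_le_succ (y : ℝ) (hy : 0 ≤ y) (N : ℕ) (hN : y * N ≤ 1) (j : ℕ) (hj : j ≤ N) :
    (1 + y) ^ j ≤ j + 1 := by
  induction j with
  | zero => simp
  | succ j ih =>
    have h1 := ih (by omega)
    have h2 : y * (j + 1) ≤ 1 := by
      refine le_trans (mul_le_mul_of_nonneg_left ?_ hy) hN
      exact_mod_cast hj
    rw [pow_succ]
    push_cast
    nlinarith [mul_le_mul_of_nonneg_right h1 (by linarith : 0 ≤ 1 + y)]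

/-- The fixed-point equations of a pair of matchings have only the uncorrelated solution. -/
theorem bethe_fixed_point_unique (L : ℕ) (hL : 1 ≤ L) (D u u₀ e : ℝ) (hD : 1 ≤ D) (hu : 0 < u)
    (hu₀ : 0 < u₀) (hu₀D : D * (L - 1) ≤ u₀) (he0 : 0 < e)
    (h1 : (1 + D / (u + D) ^ 2 * (e - 1)) ^ L = e)
    (h2 : (e - 1) * u₀ = (u - u₀) * (u + (D + 1))) : e = 1 := by
  set W := u + D with hW
  have hW1 : 1 < W := by linarith
  have hWW : D < W ^ 2 := by nlinarith
  have hLr : (1 : ℝ) ≤ L := by exact_mod_cast hL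
  rcases lt_trichotomy e 1 with he | he | he
  · exfalso
    have hq1 : D / W ^ 2 < 1 := by rw [div_lt_one (by positivity)]; exact hWW
    have hq0 : 0 < D / W ^ 2 := by positivity
    have hb := one_add_mul_le_pow (a := D / W ^ 2 * (e - 1)) (by nlinarith) L
    rw [h1] at hb
    have hLq : 1 ≤ L * (D / W ^ 2) := by
      by_contra hlt
      push Not at hlt
      nlinarith
    have hLD : W ^ 2 ≤ L * D := by
      rw [← mul_div_assoc, le_div_iff₀ (by positivity)] at hLq
      linarith
    have h3 : u₀ * W < u * (W + 1) := by
      have : (u₀ - u) * (W + 1) = (1 - e) * u₀ := by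
        have : W + 1 = u + (D + 1) := by rw [hW]; ring
        rw [this]; linarith
      nlinarith
    have h4 : D * (L - 1) * W ≤ u₀ * W := mul_le_mul_of_nonneg_right hu₀D (by linarith)
    have hu' : u = W - D := by rw [hW]; ring
    rw [hu'] at h3
    have h5 : D * L * (W - 1) < W - D := by nlinarith
    have h6 : 1 * (W - 1) ≤ D * L * (W - 1) :=
      mul_le_mul_of_nonneg_right (by nlinarith) (by linarith)
    linarith
  · exact he
  · exfalso
    obtain ⟨N, rfl⟩ : ∃ N, L = N + 1 := ⟨L - 1, by omega⟩
    push_cast at hu₀D hLr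
    have hWe : W + 1 = u + (D + 1) := by rw [hW]; ring
    rw [← hWe] at h2
    have huu : u₀ < u := by
      by_contra hle
      push Not at hle
      nlinarith [mul_pos (sub_pos.2 he) hu₀]
    set y := D / W ^ 2 * (e - 1) with hy
    have hy0 : 0 < y := by
      have := sub_pos.2 he
      positivity
    have hyW : y * W ^ 2 = D * (e - 1) := by
      rw [hy]; field_simp
    -- For e > 1 the aim is W² ≤ D·L² against W > D·L, where L = N+1. The convexity bound gives W² ≤
    -- D·L·(1+y)^N, so it remains to bound the power by L.
    have hb := one_add_pow_le_one_add_mul y hy0.le N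
    rw [h1] at hb
    have hWb : W ^ 2 ≤ D * ((N + 1) * (1 + y) ^ N) := by
      have : y * W ^ 2 ≤ y * (D * ((N + 1) * (1 + y) ^ N)) := by
        rw [hyW]
        nlinarith
      exact le_of_mul_le_mul_left this hy0
    have hWL : D * (N + 1) < W := by rw [hW]; nlinarith
    -- Eliminating e − 1 with `h2` gives yN·u₀W² = DN·(u−u₀)(W+1), where DN ≤ u₀ and, for N ≥ 1,
    -- (u−u₀)(W+1) ≤ W².
    have hyN : y * N ≤ 1 := by
      rcases Nat.eq_zero_or_pos N with h0 | h0
      · simp [h0]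
      · have hN1 : (1 : ℝ) ≤ N := by exact_mod_cast h0
        have h3 : y * N * (u₀ * W ^ 2) ≤ 1 * (u₀ * W ^ 2) := by
          have e1 : y * N * (u₀ * W ^ 2) = (D * N) * ((u - u₀) * (W + 1)) := by
            rw [← h2]
            linear_combination (N * u₀) * hyW
          have e2 : 0 ≤ (u - u₀) * (W + 1) := by nlinarith
          rw [e1]
          have e3 : D * N ≤ u₀ := by linarith
          have e4 : (u - u₀) * (W + 1) ≤ W ^ 2 := by
            have : u - u₀ ≤ W - 2 := by nlinarith
            nlinarith
          nlinarith [mul_le_mul_of_nonneg_right e3 e2, mul_le_mul_of_nonneg_left e4 hu₀.le]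
        exact le_of_mul_le_mul_right h3 (by positivity)
    have hp := one_add_pow_le_succ y hy0.le N hyN N le_rfl
    have h7 : W ^ 2 ≤ D * ((N + 1) * (N + 1)) := by
      refine hWb.trans ?_
      refine mul_le_mul_of_nonneg_left (mul_le_mul_of_nonneg_left hp (by positivity)) (by linarith)
    have h8 : (D * (N + 1)) ^ 2 < W ^ 2 := by
      apply pow_lt_pow_left₀ hWL (by positivity) (by norm_num)
    have h9 : D * ((N + 1) * (N + 1)) ≤ (D * (N + 1)) ^ 2 := by
      have : (D * ((N : ℝ) + 1)) ^ 2 = D * (D * ((N + 1) * (N + 1))) := by ring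
      rw [this]
      have : 0 ≤ D * (((N : ℝ) + 1) * (N + 1)) := by positivity
      nlinarith
    linarith

/-- The critical point equations of the rate function in exponentiated form. -/
theorem critical_point_unique (L : ℕ) (hL : 1 ≤ L) (d β ρ τ : ℝ) (hd : 2 ≤ d)
    (hβd : β * d < 1) (hβL : β * ((d - 1) * L + 1) ≤ 1) (hρ : 0 < ρ) (hτ : 0 < τ)
    (hE : 0 < β - ρ - τ) (hF : 0 < 1 - 2 * d * β + d * ρ + d * τ)
    (h1 : τ * (1 - 2 * d * β + d * ρ + d * τ) = (d - 1) * (β - ρ - τ) ^ 2)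
    (h2 : (1 - 2 * β + ρ) ^ L * τ ^ (L + 1) = ρ * (d - 1) ^ (L + 1) * (β - ρ) ^ (2 * L)) :
    ρ = β ^ 2 ∧ τ = (d - 1) * β ^ 2 := by
  obtain ⟨E, hEdef⟩ : ∃ E, E = β - ρ - τ := ⟨_, rfl⟩
  obtain ⟨w, hwdef⟩ : ∃ w, w = 1 - 2 * d * β + d * ρ + d * τ := ⟨_, rfl⟩
  obtain ⟨D, hDdef⟩ : ∃ D, D = d - 1 := ⟨_, rfl⟩
  rw [← hEdef] at hE h1
  rw [← hwdef] at hF h1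
  rw [← hDdef] at h1 h2 hβL
  have hD : 1 ≤ D := by linarith
  have hβ : 0 < β := by linarith
  have hdD : d = D + 1 := by linarith
  -- These two identities express the remaining quantities through E, w and the defect ρw − E²,
  -- which vanishes exactly at the uncorrelated point.
  have hCw : (1 - 2 * β + ρ) * w = (w + D * E) ^ 2 + D * (ρ * w - E ^ 2) := by
    have : 1 - 2 * β + ρ = w + 2 * D * E + D * ρ + (D - 1) * τ := by
      rw [hwdef, hEdef, hdD]; ring
    rw [this]
    linear_combination (D - 1) * h1
  have hBw : (β - ρ) * w = E * (w + D * E) := by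
    have : β - ρ = E + τ := by rw [hEdef]; ring
    rw [this]
    linear_combination h1
  have hV : 0 < w + D * E := by positivity
  -- The substitution is u = w/E, u₀ = 1/β − d, e = ρw/E². The required bound D(L−1) ≤ u₀ is `hβL`
  -- rewritten; the first scalar equation comes from `h2`, the second from β = E + ρ + τ and `h1`.
  have he1 : ρ * w / E ^ 2 = 1 := by
    refine bethe_fixed_point_unique L hL D (w / E) (1 / β - d) (ρ * w / E ^ 2) hD (by positivity)
      ?_ ?_ (by positivity) ?_ ?_
    · rw [sub_pos, lt_div_iff₀ hβ]; linarith
    · rw [le_sub_iff_add_le, le_div_iff₀ hβ, hdD]; linarith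
    · have hb : 1 + D / (w / E + D) ^ 2 * (ρ * w / E ^ 2 - 1) =
          (1 - 2 * β + ρ) * w / (w + D * E) ^ 2 := by
        rw [hCw]
        field_simp
      rw [hb, div_pow, mul_pow, div_eq_div_iff (by positivity) (by positivity)]
      have hτw : τ = D * E ^ 2 / w := by field_simp; linarith
      have hBw' : β - ρ = E * (w + D * E) / w := by field_simp; linarith
      rw [hτw, hBw'] at h2
      have h3 : (1 - 2 * β + ρ) ^ L * (D * E ^ 2) ^ (L + 1) * w ^ (2 * L) =
          ρ * D ^ (L + 1) * (E * (w + D * E)) ^ (2 * L) * w ^ (L + 1) := by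
        rw [div_pow, div_pow] at h2
        field_simp at h2
        linear_combination h2
      have h4 : (D ^ (L + 1) * E ^ (2 * L) * w ^ L) *
            ((1 - 2 * β + ρ) ^ L * w ^ L * E ^ 2) =
          (D ^ (L + 1) * E ^ (2 * L) * w ^ L) * (ρ * w * ((w + D * E) ^ 2) ^ L) := by
        have e1 : (D * E ^ 2) ^ (L + 1) = D ^ (L + 1) * (E ^ (2 * L) * E ^ 2) := by
          rw [mul_pow]; ring
        have e2 : (E * (w + D * E)) ^ (2 * L) = E ^ (2 * L) * ((w + D * E) ^ 2) ^ L := by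
          rw [mul_pow, pow_mul (w + D * E)]
        have e3 : w ^ (2 * L) = w ^ L * w ^ L := by ring
        rw [e1, e2, e3, pow_succ w] at h3
        linear_combination h3
      exact mul_left_cancel₀ (by positivity) h4
    · have e1 : β * (1 / β - d) = w + d * E := by
        have : β * (1 / β - d) = 1 - d * β := by field_simp
        rw [this, hwdef, hEdef]; ring
      have e2 : β * (w / E - (1 / β - d)) = E * (ρ * w / E ^ 2 - 1) := by
        have : β * (w / E - (1 / β - d)) = β * w / E - β * (1 / β - d) := by ring
        rw [this, e1]
        have hβE : β = E + ρ + τ := by rw [hEdef]; ring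
        rw [hβE]
        field_simp
        rw [hdD]
        linear_combination h1
      have e3 : (w / E + (D + 1)) * E = w + d * E := by rw [hdD]; field_simp
      have : β * ((ρ * w / E ^ 2 - 1) * (1 / β - d)) =
          β * ((w / E - (1 / β - d)) * (w / E + (D + 1))) := by
        calc β * ((ρ * w / E ^ 2 - 1) * (1 / β - d))
            = (ρ * w / E ^ 2 - 1) * (β * (1 / β - d)) := by ring
          _ = (E * (ρ * w / E ^ 2 - 1)) * (w / E + (D + 1)) := by rw [e1, ← e3]; ring
          _ = _ := by rw [← e2]; ring
      exact mul_left_cancel₀ hβ.ne' this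
  have hρw : ρ * w = E ^ 2 := by
    rw [div_eq_one_iff_eq (by positivity)] at he1
    exact he1
  have hτρ : τ = D * ρ := by
    have : τ * w = (D * ρ) * w := by rw [h1, ← hρw]; ring
    exact mul_right_cancel₀ hF.ne' this
  -- With τ = Dρ, the equation ρw = E² loses its quadratic and mixed terms and leaves ρ = β².
  have hρβ : ρ = β ^ 2 := by
    rw [hwdef, hEdef, hτρ, hdD] at hρw
    linear_combination hρw
  exact ⟨hρβ, by rw [hτρ, hρβ, hDdef]⟩

end BetheUniqueness

/-! ### Global maximisation of the rate function. -/

section Rate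

/-- The exponential rate, up to a constant, of the contribution to the second moment of pairs of
matchings sharing a fraction `ρ` of all hyperedges, such that a fraction `τ` of all half-edges are
half-edges of the first matching alone sharing a vertex with the second matching alone. -/
noncomputable def overlapRate (d l β ρ τ : ℝ) : ℝ :=
  -(ρ * Real.log ρ) + 2 * (l - 1) * ((β - ρ) * Real.log (β - ρ))
    + (l - 1) * ((1 - 2 * β + ρ) * Real.log (1 - 2 * β + ρ)) - l * (τ * Real.log τ)
    - 2 * l * ((β - ρ - τ) * Real.log (β - ρ - τ))
    - l * ((1 / d - 2 * β + ρ + τ) * Real.log (1 / d - 2 * β + ρ + τ))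
    + l * τ * Real.log ((d - 1) / d) - l * ρ * Real.log d

/-- The possible overlap parameters of two matchings. -/
def overlapRegion (d β : ℝ) : Set (ℝ × ℝ) :=
  {p | 0 ≤ p.1 ∧ 0 ≤ p.2 ∧ 0 ≤ β - p.1 - p.2 ∧ 0 ≤ 1 / d - 2 * β + p.1 + p.2}

theorem isCompact_overlapRegion (d β : ℝ) : IsCompact (overlapRegion d β) := by
  refine IsCompact.of_isClosed_subset (isCompact_Icc (a := ((0 : ℝ), (0 : ℝ))) (b := (β, β))) ?_ ?_
  · have h1 : IsClosed {p : ℝ × ℝ | 0 ≤ p.1} := isClosed_le (by fun_prop) (by fun_prop)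
    have h2 : IsClosed {p : ℝ × ℝ | 0 ≤ p.2} := isClosed_le (by fun_prop) (by fun_prop)
    have h3 : IsClosed {p : ℝ × ℝ | 0 ≤ β - p.1 - p.2} := isClosed_le (by fun_prop) (by fun_prop)
    have h4 : IsClosed {p : ℝ × ℝ | 0 ≤ 1 / d - 2 * β + p.1 + p.2} :=
      isClosed_le (by fun_prop) (by fun_prop)
    exact h1.inter (h2.inter (h3.inter h4))
  · rintro ⟨x, y⟩ ⟨h1, h2, h3, h4⟩
    simp only [Set.mem_Icc, Prod.mk_le_mk]
    simp only at h1 h2 h3 h4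
    exact ⟨⟨h1, h2⟩, by linarith, by linarith⟩

theorem continuous_overlapRate (d l β : ℝ) :
    Continuous fun p : ℝ × ℝ => overlapRate d l β p.1 p.2 := by
  have h : ∀ f : ℝ × ℝ → ℝ, Continuous f → Continuous fun p => f p * Real.log (f p) :=
    fun f hf => Real.continuous_mul_log.comp hf
  unfold overlapRate
  have h1 := h (fun p => p.1) (by fun_prop)
  have h2 := h (fun p => β - p.1) (by fun_prop)
  have h3 := h (fun p => 1 - 2 * β + p.1) (by fun_prop)
  have h4 := h (fun p => p.2) (by fun_prop)
  have h5 := h (fun p => β - p.1 - p.2) (by fun_prop)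
  have h6 := h (fun p => 1 / d - 2 * β + p.1 + p.2) (by fun_prop)
  fun_prop

/-- A vanishing term x log x has difference quotient v log s + O(1); a positive one has a finite
derivative. Recording both in one form allows the logarithmic coefficients to be summed. -/
theorem tendsto_slope_mul_log (g v : ℝ) (hg : 0 ≤ g) (hgv : 0 < g + v) :
    ∃ c, Tendsto (fun s : ℝ => ((g + s * v) * Real.log (g + s * v) - g * Real.log g) / s
      - (if g = 0 then v else 0) * Real.log s) (𝓝[>] 0) (𝓝 c) := by
  rcases hg.eq_or_lt with h | h
  · subst h
    have hv : 0 < v := by linarith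
    refine ⟨v * Real.log v, tendsto_const_nhds.congr' ?_⟩
    filter_upwards [self_mem_nhdsWithin] with s hs
    have hs' : 0 < s := hs
    simp only [zero_add, if_true, zero_mul, sub_zero]
    rw [Real.log_mul hs'.ne' hv.ne']
    field_simp
    ring
  · refine ⟨(Real.log g + 1) * v, ?_⟩
    simp only [h.ne', if_false, zero_mul, sub_zero]
    have h1 : HasDerivAt (fun s : ℝ => g + s * v) v 0 := by
      simpa using ((hasDerivAt_id (0 : ℝ)).mul_const v).const_add g
    have h2 : HasDerivAt (fun s : ℝ => (g + s * v) * Real.log (g + s * v))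
        ((Real.log g + 1) * v) 0 := by
      have := (Real.hasDerivAt_mul_log (x := g + 0 * v) (by simpa using h.ne')).comp (0 : ℝ) h1
      simpa [Function.comp_def] using this
    have h3 := h2.tendsto_slope_zero_right
    refine h3.congr fun s => ?_
    simp [div_eq_inv_mul]

/-- Move from the boundary point towards the centre. The difference quotient of the rate is κ log s
+ O(1) as s → 0⁺, so κ < 0 makes it tend to +∞. -/
theorem overlapRate_not_max_of_boundary (d l β : ℝ) (hd : 2 ≤ d) (hl : 2 ≤ l) (hβ : 0 < β)
    (hβd : β * d < 1) (hβl : β * ((d - 1) * (l - 1) + 1) ≤ 1) (p : ℝ × ℝ)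
    (hp : p ∈ overlapRegion d β)
    (hb : p.1 = 0 ∨ p.2 = 0 ∨ β - p.1 - p.2 = 0 ∨ 1 / d - 2 * β + p.1 + p.2 = 0) :
    ∃ q ∈ overlapRegion d β, overlapRate d l β p.1 p.2 < overlapRate d l β q.1 q.2 := by
  obtain ⟨ρ, τ⟩ := p
  obtain ⟨hρ, hτ, hE, hF⟩ := hp
  simp only at hρ hτ hE hF hb ⊢
  have hβ1 : β < 1 / 2 := by nlinarith
  have hd0 : 0 < d := by linarith
  obtain ⟨v, hv⟩ : ∃ v, v = β ^ 2 - ρ := ⟨_, rfl⟩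
  obtain ⟨w, hw⟩ : ∃ w, w = (d - 1) * β ^ 2 - τ := ⟨_, rfl⟩
  have pρ : 0 < ρ + v := by rw [hv]; nlinarith
  have pB : 0 < (β - ρ) + -v := by rw [hv]; nlinarith
  have pC : 0 < (1 - 2 * β + ρ) + v := by rw [hv]; nlinarith [sq_nonneg (1 - β)]
  have pτ : 0 < τ + w := by
    rw [hw]
    have : 0 < (d - 1) * β ^ 2 := mul_pos (by linarith) (by positivity)
    linarith
  have eE : (β - ρ - τ) + (-v - w) = β * (1 - β * d) := by rw [hv, hw]; ring
  have pE : 0 < (β - ρ - τ) + (-v - w) := by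
    rw [eE]; exact mul_pos hβ (by linarith)
  have eF : (1 / d - 2 * β + ρ + τ) + (v + w) = (1 - β * d) ^ 2 / d := by
    rw [hv, hw]; field_simp; ring
  have pF : 0 < (1 / d - 2 * β + ρ + τ) + (v + w) := by
    rw [eF]; exact div_pos (pow_pos (by linarith) 2) hd0
  have hB : 0 ≤ β - ρ := by linarith
  have hC : 0 < 1 - 2 * β + ρ := by linarith
  obtain ⟨c1, h1⟩ := tendsto_slope_mul_log ρ v hρ pρ
  obtain ⟨c2, h2⟩ := tendsto_slope_mul_log (β - ρ) (-v) hB pB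
  obtain ⟨c3, h3⟩ := tendsto_slope_mul_log (1 - 2 * β + ρ) v hC.le pC
  obtain ⟨c4, h4⟩ := tendsto_slope_mul_log τ w hτ pτ
  obtain ⟨c5, h5⟩ := tendsto_slope_mul_log (β - ρ - τ) (-v - w) hE pE
  obtain ⟨c6, h6⟩ := tendsto_slope_mul_log (1 / d - 2 * β + ρ + τ) (v + w) hF pF
  rw [if_neg hC.ne'] at h3
  obtain ⟨κ, hκ⟩ : ∃ κ, κ = -(if ρ = 0 then v else 0) + 2 * (l - 1) * (if β - ρ = 0 then -v else 0)
      - l * (if τ = 0 then w else 0) - 2 * l * (if β - ρ - τ = 0 then -v - w else 0)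
      - l * (if 1 / d - 2 * β + ρ + τ = 0 then v + w else 0) := ⟨_, rfl⟩
  have hκ0 : κ < 0 := by
    have n1 : 0 ≤ if ρ = 0 then v else 0 := by split_ifs <;> linarith
    have n4 : 0 ≤ if τ = 0 then w else 0 := by split_ifs <;> linarith
    have n5 : 0 ≤ if β - ρ - τ = 0 then -v - w else 0 := by split_ifs <;> linarith
    have n6 : 0 ≤ if 1 / d - 2 * β + ρ + τ = 0 then v + w else 0 := by split_ifs <;> linarith
    have m4 := mul_nonneg (by linarith : 0 ≤ l) n4
    have m5 := mul_nonneg (by linarith : 0 ≤ l) n5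
    have m6 := mul_nonneg (by linarith : 0 ≤ l) n6
    -- Only the term in β − ρ contributes to κ with the unfavourable sign. It vanishes only at ρ =
    -- β, where τ and β − ρ − τ vanish too, and the condition on β makes the combined coefficient
    -- negative.
    by_cases hB0 : β - ρ = 0
    · have hτ0 : τ = 0 := by linarith
      have hE0 : β - ρ - τ = 0 := by linarith
      rw [hκ, if_pos hB0, if_pos hτ0, if_pos hE0]
      have e2 : -v = β * (1 - β) := by rw [hv]; linear_combination (-1 : ℝ) * hB0
      have e4 : w = (d - 1) * β ^ 2 := by rw [hw, hτ0]; ring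
      have e5 : -v - w = β * (1 - β * d) := by linarith
      rw [e4] at m6
      rw [e5, e2, e4]
      have key : 2 * (l - 1) * (β * (1 - β)) - l * ((d - 1) * β ^ 2)
          - 2 * l * (β * (1 - β * d)) =
          -(β * (2 - β * ((d - 1) * (l - 1) + 1) - β * d)) + 0 := by ring
      have : 0 < β * (2 - β * ((d - 1) * (l - 1) + 1) - β * d) := mul_pos hβ (by linarith)
      linarith
    · rw [if_neg hB0] at hκ
      have hl0 : 0 < l := by linarith
      rcases hb with h | h | h | h
      · rw [if_pos h] at hκ; linarith
      · rw [if_pos h] at hκ m4; nlinarith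
      · rw [if_pos h] at hκ m5; nlinarith
      · rw [if_pos h] at hκ m6; nlinarith
  have hT : Tendsto (fun s : ℝ =>
      (overlapRate d l β (ρ + s * v) (τ + s * w) - overlapRate d l β ρ τ) / s - κ * Real.log s)
      (𝓝[>] 0) (𝓝 (-c1 + 2 * (l - 1) * c2 + (l - 1) * c3 - l * c4 - 2 * l * c5 - l * c6
        + (l * w * Real.log ((d - 1) / d) - l * v * Real.log d))) := by
    have h := (((((h1.neg.add (h2.const_mul (2 * (l - 1)))).add (h3.const_mul (l - 1))).sub
      (h4.const_mul l)).sub (h5.const_mul (2 * l))).sub (h6.const_mul l)).add_const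
        (l * w * Real.log ((d - 1) / d) - l * v * Real.log d)
    refine h.congr' ?_
    filter_upwards [self_mem_nhdsWithin] with s hs
    have hs' : s ≠ 0 := (show (0 : ℝ) < s from hs).ne'
    have r2 : β - (ρ + s * v) = β - ρ + s * -v := by ring
    have r3 : 1 - 2 * β + (ρ + s * v) = 1 - 2 * β + ρ + s * v := by ring
    have r5 : β - (ρ + s * v) - (τ + s * w) = β - ρ - τ + s * (-v - w) := by ring
    have r6 : 1 / d - 2 * β + (ρ + s * v) + (τ + s * w) =
      1 / d - 2 * β + ρ + τ + s * (v + w) := by ring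
    unfold overlapRate
    rw [r5, r2, r3, r6, hκ]
    -- The remaining identity is linear in these logarithmic terms, which are treated as independent
    -- unknowns.
    generalize (if ρ = 0 then v else 0) = i1
    generalize (if β - ρ = 0 then -v else 0) = i2
    generalize (if τ = 0 then w else 0) = i4
    generalize (if β - ρ - τ = 0 then -v - w else 0) = i5
    generalize (if 1 / d - 2 * β + ρ + τ = 0 then v + w else 0) = i6
    generalize (ρ + s * v) * Real.log (ρ + s * v) = a1
    generalize (β - ρ + s * -v) * Real.log (β - ρ + s * -v) = a2
    generalize (1 - 2 * β + ρ + s * v) * Real.log (1 - 2 * β + ρ + s * v) = a3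
    generalize (τ + s * w) * Real.log (τ + s * w) = a4
    generalize (β - ρ - τ + s * (-v - w)) * Real.log (β - ρ - τ + s * (-v - w)) = a5
    generalize (1 / d - 2 * β + ρ + τ + s * (v + w)) *
      Real.log (1 / d - 2 * β + ρ + τ + s * (v + w)) = a6
    generalize ρ * Real.log ρ = b1
    generalize (β - ρ) * Real.log (β - ρ) = b2
    generalize (1 - 2 * β + ρ) * Real.log (1 - 2 * β + ρ) = b3
    generalize τ * Real.log τ = b4
    generalize (β - ρ - τ) * Real.log (β - ρ - τ) = b5
    generalize (1 / d - 2 * β + ρ + τ) * Real.log (1 / d - 2 * β + ρ + τ) = b6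
    generalize Real.log ((d - 1) / d) = k1
    generalize Real.log d = k2
    generalize Real.log s = ls
    field_simp
    ring
  have hlog : Tendsto (fun s : ℝ => κ * Real.log s) (𝓝[>] 0) atTop :=
    Real.tendsto_log_nhdsGT_zero.const_mul_atBot_of_neg hκ0
  have hsum := hT.add_atTop hlog
  have hev := hsum.eventually (eventually_gt_atTop 0)
  have h01 : ∀ᶠ s : ℝ in 𝓝[>] 0, s < 1 :=
    nhdsWithin_le_nhds (eventually_lt_nhds (by norm_num))
  obtain ⟨s, hs1, hs2, hs3⟩ := (hev.and (h01.and self_mem_nhdsWithin)).exists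
  have hs0 : 0 < s := hs3
  have hs' : 0 < 1 - s := by linarith
  refine ⟨(ρ + s * v, τ + s * w), ⟨?_, ?_, ?_, ?_⟩, ?_⟩
  · simp only
    have : ρ + s * v = (1 - s) * ρ + s * (ρ + v) := by ring
    rw [this]; positivity
  · simp only
    have : τ + s * w = (1 - s) * τ + s * (τ + w) := by ring
    rw [this]; positivity
  · simp only
    have : β - (ρ + s * v) - (τ + s * w) =
      (1 - s) * (β - ρ - τ) + s * ((β - ρ - τ) + (-v - w)) := by ring
    rw [this]
    exact add_nonneg (mul_nonneg hs'.le hE) (mul_nonneg hs0.le pE.le)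
  · simp only
    have : 1 / d - 2 * β + (ρ + s * v) + (τ + s * w) =
      (1 - s) * (1 / d - 2 * β + ρ + τ) + s * ((1 / d - 2 * β + ρ + τ) + (v + w)) := by ring
    rw [this]
    exact add_nonneg (mul_nonneg hs'.le hF) (mul_nonneg hs0.le pF.le)
  · simp only [sub_add_cancel] at hs1 ⊢
    have := (div_pos_iff_of_pos_right hs0).1 hs1
    linarith

theorem hasDerivAt_mul_log_line (g v : ℝ) (hg : 0 < g) :
    HasDerivAt (fun s : ℝ => (g + s * v) * Real.log (g + s * v)) ((Real.log g + 1) * v) 0 := by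
  have h1 : HasDerivAt (fun s : ℝ => g + s * v) v 0 := by
    simpa using ((hasDerivAt_id (0 : ℝ)).mul_const v).const_add g
  have := (Real.hasDerivAt_mul_log (x := g + 0 * v) (by simpa using hg.ne')).comp (0 : ℝ) h1
  simpa [Function.comp_def] using this

theorem hasDerivAt_overlapRate_line (d l β ρ τ v w : ℝ) (hρ : 0 < ρ) (hB : 0 < β - ρ)
    (hC : 0 < 1 - 2 * β + ρ) (hτ : 0 < τ) (hE : 0 < β - ρ - τ)
    (hF : 0 < 1 / d - 2 * β + ρ + τ) :
    HasDerivAt (fun s : ℝ => overlapRate d l β (ρ + s * v) (τ + s * w))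
      (-((Real.log ρ + 1) * v) + 2 * (l - 1) * ((Real.log (β - ρ) + 1) * -v)
        + (l - 1) * ((Real.log (1 - 2 * β + ρ) + 1) * v) - l * ((Real.log τ + 1) * w)
        - 2 * l * ((Real.log (β - ρ - τ) + 1) * (-v - w))
        - l * ((Real.log (1 / d - 2 * β + ρ + τ) + 1) * (v + w))
        + l * w * Real.log ((d - 1) / d) - l * v * Real.log d) 0 := by
  have hw : HasDerivAt (fun s : ℝ => l * (τ + s * w) * Real.log ((d - 1) / d))
      (l * w * Real.log ((d - 1) / d)) 0 := by
    simpa using ((((hasDerivAt_id (0 : ℝ)).mul_const w).const_add τ).const_mul l).mul_const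
      (Real.log ((d - 1) / d))
  have hv : HasDerivAt (fun s : ℝ => l * (ρ + s * v) * Real.log d) (l * v * Real.log d) 0 := by
    simpa using ((((hasDerivAt_id (0 : ℝ)).mul_const v).const_add ρ).const_mul l).mul_const
      (Real.log d)
  have h := (((((((hasDerivAt_mul_log_line ρ v hρ).neg.add
    ((hasDerivAt_mul_log_line (β - ρ) (-v) hB).const_mul (2 * (l - 1)))).add
    ((hasDerivAt_mul_log_line (1 - 2 * β + ρ) v hC).const_mul (l - 1))).sub
    ((hasDerivAt_mul_log_line τ w hτ).const_mul l)).sub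
    ((hasDerivAt_mul_log_line (β - ρ - τ) (-v - w) hE).const_mul (2 * l))).sub
    ((hasDerivAt_mul_log_line (1 / d - 2 * β + ρ + τ) (v + w) hF).const_mul l)).add hw).sub hv
  refine h.congr_of_eventuallyEq (Eventually.of_forall fun s => ?_)
  have r2 : β - (ρ + s * v) = β - ρ + s * -v := by ring
  have r3 : 1 - 2 * β + (ρ + s * v) = 1 - 2 * β + ρ + s * v := by ring
  have r5 : β - (ρ + s * v) - (τ + s * w) = β - ρ - τ + s * (-v - w) := by ring
  have r6 : 1 / d - 2 * β + (ρ + s * v) + (τ + s * w) =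
    1 / d - 2 * β + ρ + τ + s * (v + w) := by ring
  simp only [overlapRate, Pi.add_apply, Pi.sub_apply, Pi.neg_apply]
  rw [r5, r2, r3, r6]

/-- A maximiser is interior, so both partial derivatives vanish; exponentiating gives the polynomial
system solved by `critical_point_unique`. -/
theorem eq_center_of_isMax (L : ℕ) (hL : 1 ≤ L) (d β : ℝ) (hd : 2 ≤ d) (hβ : 0 < β)
    (hβd : β * d < 1) (hβl : β * ((d - 1) * L + 1) ≤ 1) (p : ℝ × ℝ)
    (hp : p ∈ overlapRegion d β)
    (hmax : ∀ q ∈ overlapRegion d β,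
      overlapRate d (L + 1) β q.1 q.2 ≤ overlapRate d (L + 1) β p.1 p.2) :
    p = (β ^ 2, (d - 1) * β ^ 2) := by
  have hLr : (1 : ℝ) ≤ L := by exact_mod_cast hL
  have hint : ¬ (p.1 = 0 ∨ p.2 = 0 ∨ β - p.1 - p.2 = 0 ∨ 1 / d - 2 * β + p.1 + p.2 = 0) := by
    intro hb
    obtain ⟨q, hq, hlt⟩ := overlapRate_not_max_of_boundary d (L + 1) β hd (by linarith) hβ hβd
      (by simpa using hβl) p hp hb
    exact absurd (hmax q hq) (not_le.2 hlt)
  obtain ⟨ρ, τ⟩ := p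
  push Not at hint
  obtain ⟨hρ, hτ, hE, hF⟩ := hp
  obtain ⟨iρ, iτ, iE, iF⟩ := hint
  simp only at hρ hτ hE hF iρ iτ iE iF
  replace hρ := lt_of_le_of_ne hρ iρ.symm
  replace hτ := lt_of_le_of_ne hτ iτ.symm
  replace hE := lt_of_le_of_ne hE iE.symm
  replace hF := lt_of_le_of_ne hF iF.symm
  have hβ1 : β < 1 / 2 := by nlinarith
  have hB : 0 < β - ρ := by linarith
  have hC : 0 < 1 - 2 * β + ρ := by linarith
  have hd0 : 0 < d := by linarith
  have hd1 : 0 < d - 1 := by linarith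
  have hderiv : ∀ v w : ℝ, _ := fun v w =>
    hasDerivAt_overlapRate_line d (L + 1) β ρ τ v w hρ hB hC hτ hE hF
  have hloc : ∀ v w : ℝ,
      IsLocalMax (fun s : ℝ => overlapRate d (L + 1) β (ρ + s * v) (τ + s * w)) 0 := by
    intro v w
    have t1 : Tendsto (fun s : ℝ => ρ + s * v) (𝓝 0) (𝓝 ρ) := by
      have : Continuous fun s : ℝ => ρ + s * v := by fun_prop
      simpa using this.tendsto 0
    have t2 : Tendsto (fun s : ℝ => τ + s * w) (𝓝 0) (𝓝 τ) := by
      have : Continuous fun s : ℝ => τ + s * w := by fun_prop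
      simpa using this.tendsto 0
    filter_upwards [t1.eventually_const_lt hρ, t2.eventually_const_lt hτ,
      ((t1.const_sub β).sub t2).eventually_const_lt hE,
      ((t1.const_add (1 / d - 2 * β)).add t2).eventually_const_lt hF] with s s1 s2 s3 s4
    have := hmax (ρ + s * v, τ + s * w) ⟨s1.le, s2.le, s3.le, s4.le⟩
    simpa using this
  have z1 := (hloc 0 1).hasDerivAt_eq_zero (hderiv 0 1)
  have z2 := (hloc 1 0).hasDerivAt_eq_zero (hderiv 1 0)
  rw [Real.log_div hd1.ne' hd0.ne'] at z1 z2
  have w1 : Real.log τ + Real.log (1 / d - 2 * β + ρ + τ) + Real.log d =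
      Real.log (d - 1) + 2 * Real.log (β - ρ - τ) := by
    have hL0 : (L : ℝ) + 1 ≠ 0 := by positivity
    refine mul_left_cancel₀ hL0 ?_
    linear_combination -z1
  -- The τ-equation, taken L+1 times, eliminates log(β − ρ − τ) and the last logarithm from the
  -- ρ-equation.
  have w2 : L * Real.log (1 - 2 * β + ρ) + (L + 1) * Real.log τ =
      Real.log ρ + (L + 1) * Real.log (d - 1) + 2 * L * Real.log (β - ρ) := by
    linear_combination z2 + (L + 1) * w1
  have hFd : d * (1 / d - 2 * β + ρ + τ) = 1 - 2 * d * β + d * ρ + d * τ := by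
    field_simp
  have e1 : τ * (1 - 2 * d * β + d * ρ + d * τ) = (d - 1) * (β - ρ - τ) ^ 2 := by
    rw [← hFd]
    refine Real.log_injOn_pos (Set.mem_Ioi.2 (by positivity)) (Set.mem_Ioi.2 (by positivity)) ?_
    rw [Real.log_mul hτ.ne' (by positivity), Real.log_mul hd0.ne' hF.ne',
      Real.log_mul hd1.ne' (by positivity), Real.log_pow]
    push_cast
    linear_combination w1
  have e2 : (1 - 2 * β + ρ) ^ L * τ ^ (L + 1) = ρ * (d - 1) ^ (L + 1) * (β - ρ) ^ (2 * L) := by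
    refine Real.log_injOn_pos (Set.mem_Ioi.2 (by positivity)) (Set.mem_Ioi.2 (by positivity)) ?_
    rw [Real.log_mul (by positivity) (by positivity), Real.log_mul (by positivity) (by positivity),
      Real.log_mul (by positivity) (by positivity), Real.log_pow, Real.log_pow, Real.log_pow,
      Real.log_pow]
    push_cast
    linear_combination w2
  have hF' : 0 < 1 - 2 * d * β + d * ρ + d * τ := by rw [← hFd]; positivity
  obtain ⟨r1, r2⟩ := critical_point_unique L hL d β ρ τ hd hβd hβl hρ hτ hE hF' e1 e2
  rw [r1, r2]

theorem center_mem_overlapRegion (d β : ℝ) (hd : 2 ≤ d) (hβ : 0 < β) (hβd : β * d < 1) :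
    (β ^ 2, (d - 1) * β ^ 2) ∈ overlapRegion d β := by
  have hd0 : 0 < d := by linarith
  refine ⟨by positivity, mul_nonneg (by linarith) (by positivity), ?_, ?_⟩
  · have : β - β ^ 2 - (d - 1) * β ^ 2 = β * (1 - β * d) := by ring
    simp only [this]
    exact mul_nonneg hβ.le (by linarith)
  · have : 1 / d - 2 * β + β ^ 2 + (d - 1) * β ^ 2 = (1 - β * d) ^ 2 / d := by field_simp; ring
    simp only [this]
    positivity

/-- A maximiser exists by compactness, and every maximiser is the centre; a point with an equal
value would be a second one. -/
theorem overlapRate_lt_center (L : ℕ) (hL : 1 ≤ L) (d β : ℝ) (hd : 2 ≤ d) (hβ : 0 < β)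
    (hβd : β * d < 1) (hβl : β * ((d - 1) * L + 1) ≤ 1) (p : ℝ × ℝ)
    (hp : p ∈ overlapRegion d β) (hne : p ≠ (β ^ 2, (d - 1) * β ^ 2)) :
    overlapRate d (L + 1) β p.1 p.2 < overlapRate d (L + 1) β (β ^ 2) ((d - 1) * β ^ 2) := by
  have hc := center_mem_overlapRegion d β hd hβ hβd
  obtain ⟨q, hq, hqmax⟩ := (isCompact_overlapRegion d β).exists_isMaxOn ⟨_, hc⟩
    (continuous_overlapRate d (L + 1) β).continuousOn
  have hq' := eq_center_of_isMax L hL d β hd hβ hβd hβl q hq fun r hr => hqmax hr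
  subst hq'
  by_contra hge
  push Not at hge
  exact hne (eq_center_of_isMax L hL d β hd hβ hβd hβl p hp fun r hr => (hqmax hr).trans hge)

end Rate

/-! ### Second-order expansion at the centre and quadratic decay. -/

section Quadratic

theorem abs_mul_log_taylor_le (g h : ℝ) (hg : 0 < g) (hh : |h| ≤ g / 2) :
    |(g + h) * Real.log (g + h) - g * Real.log g - (Real.log g + 1) * h - h ^ 2 / (2 * g)|
      ≤ 4 / g ^ 2 * |h| ^ 3 := by
  set x := -h / g with hx
  have habs : |x| = |h| / g := by rw [hx, abs_div, abs_neg, abs_of_pos hg]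
  have hx1 : |x| ≤ 1 / 2 := by rw [habs, div_le_iff₀ hg]; linarith
  -- Two terms of the series of log(1 − x) at x = −h/g. The condition |x| ≤ 1/2 bounds the tail by
  -- 2|x|³ and gives 7/2 in total, rounded up to 4.
  have h1 := Real.abs_log_sub_add_sum_range_le (x := x) (by linarith) 2
  have hsum : (∑ i ∈ Finset.range 2, x ^ (i + 1) / ((i : ℝ) + 1)) = x + x ^ 2 / 2 := by
    simp [Finset.sum_range_succ]; norm_num
  rw [hsum] at h1
  have hgh : g + h = g * (1 - x) := by rw [hx]; field_simp; ring
  have h1x : 0 < 1 - x := by linarith [le_abs_self x]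
  have hlog : Real.log (g + h) = Real.log g + Real.log (1 - x) := by
    rw [hgh, Real.log_mul hg.ne' h1x.ne']
  have key : (g + h) * Real.log (g + h) - g * Real.log g - (Real.log g + 1) * h - h ^ 2 / (2 * g)
      = (g + h) * (x + x ^ 2 / 2 + Real.log (1 - x)) - h ^ 3 / (2 * g ^ 2) := by
    rw [hlog, hx]; field_simp; ring
  rw [key]
  have h2 : |x| ^ (2 + 1) / (1 - |x|) ≤ 2 * |x| ^ 3 := by
    rw [div_le_iff₀ (by linarith)]
    have : 0 ≤ |x| ^ 3 := by positivity
    have e : |x| ^ (2 + 1) = |x| ^ 3 := rfl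
    rw [e]
    nlinarith [mul_nonneg this (by linarith : 0 ≤ 1 / 2 - |x|)]
  have h3 : |g + h| ≤ 3 / 2 * g := by
    rw [abs_le] at hh ⊢
    constructor <;> linarith [hh.1, hh.2]
  calc |(g + h) * (x + x ^ 2 / 2 + Real.log (1 - x)) - h ^ 3 / (2 * g ^ 2)|
      ≤ |g + h| * |x + x ^ 2 / 2 + Real.log (1 - x)| + |h ^ 3 / (2 * g ^ 2)| := by
        rw [← abs_mul]; exact abs_sub _ _
    _ ≤ (3 / 2 * g) * (2 * |x| ^ 3) + |h| ^ 3 / (2 * g ^ 2) := by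
        gcongr
        · exact h1.trans h2
        · rw [abs_div, abs_pow, abs_of_pos (by positivity : 0 < 2 * g ^ 2)]
    _ = 7 / 2 / g ^ 2 * |h| ^ 3 := by rw [habs]; field_simp; ring
    _ ≤ 4 / g ^ 2 * |h| ^ 3 := by gcongr; norm_num

/-- The Hessian of `-overlapRate` at the uncorrelated point. -/
noncomputable def overlapHessian (d l β x y : ℝ) : ℝ :=
  (1 / β ^ 2 - 2 * (l - 1) / (β * (1 - β)) - (l - 1) / (1 - β) ^ 2) * x ^ 2
    + l / ((d - 1) * β ^ 2) * y ^ 2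
    + (2 * l / (β * (1 - β * d)) + l * d / (1 - β * d) ^ 2) * (x + y) ^ 2

/-- All six arguments of x log x factor at the centre into powers of β, 1−β, 1−βd, d−1 and d, so the
linear terms cancel explicitly (`hlin`). The radius ε keeps each perturbation within half of its
central value. -/
theorem abs_overlapRate_sub_le (d l β : ℝ) (hd : 2 ≤ d) (hl : 1 ≤ l) (hβ : 0 < β)
    (hβd : β * d < 1) :
    ∃ K > 0, ∃ ε > 0, ∀ x y : ℝ, |x| + |y| ≤ ε →
      |overlapRate d l β (β ^ 2 + x) ((d - 1) * β ^ 2 + y)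
        - overlapRate d l β (β ^ 2) ((d - 1) * β ^ 2) + overlapHessian d l β x y / 2|
      ≤ K * (|x| + |y|) ^ 3 := by
  have hβ1 : β < 1 / 2 := by nlinarith
  have hd0 : 0 < d := by linarith
  have hd1 : 0 < d - 1 := by linarith
  have hβ1' : 0 < 1 - β := by linarith
  have hβd' : 0 < 1 - β * d := by linarith
  obtain ⟨g1, e1⟩ : ∃ g, g = β ^ 2 := ⟨_, rfl⟩
  obtain ⟨g2, e2⟩ : ∃ g, g = β * (1 - β) := ⟨_, rfl⟩
  obtain ⟨g3, e3⟩ : ∃ g, g = (1 - β) ^ 2 := ⟨_, rfl⟩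
  obtain ⟨g4, e4⟩ : ∃ g, g = (d - 1) * β ^ 2 := ⟨_, rfl⟩
  obtain ⟨g5, e5⟩ : ∃ g, g = β * (1 - β * d) := ⟨_, rfl⟩
  obtain ⟨g6, e6⟩ : ∃ g, g = (1 - β * d) ^ 2 / d := ⟨_, rfl⟩
  have p1 : 0 < g1 := by rw [e1]; positivity
  have p2 : 0 < g2 := by rw [e2]; positivity
  have p3 : 0 < g3 := by rw [e3]; positivity
  have p4 : 0 < g4 := by rw [e4]; positivity
  have p5 : 0 < g5 := by rw [e5]; positivity
  have p6 : 0 < g6 := by rw [e6]; positivity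
  refine ⟨4 / g1 ^ 2 + 2 * (l - 1) * (4 / g2 ^ 2) + (l - 1) * (4 / g3 ^ 2) + l * (4 / g4 ^ 2)
    + 2 * l * (4 / g5 ^ 2) + l * (4 / g6 ^ 2), ?_,
    min (min (g1 / 2) (min (g2 / 2) (g3 / 2))) (min (g4 / 2) (min (g5 / 2) (g6 / 2))), ?_, ?_⟩
  · have : 0 ≤ l - 1 := by linarith
    positivity
  · positivity
  intro x y hxy
  obtain ⟨δ, hδ⟩ : ∃ δ, δ = |x| + |y| := ⟨_, rfl⟩
  rw [← hδ] at hxy ⊢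
  simp only [le_min_iff] at hxy
  obtain ⟨⟨b1, b2, b3⟩, b4, b5, b6⟩ := hxy
  have a1 : |x| ≤ δ := by rw [hδ]; linarith [abs_nonneg y]
  have a2 : |-x| ≤ δ := by rwa [abs_neg]
  have a4 : |y| ≤ δ := by rw [hδ]; linarith [abs_nonneg x]
  have a6 : |x + y| ≤ δ := by rw [hδ]; exact abs_add_le x y
  have a5 : |-(x + y)| ≤ δ := by rwa [abs_neg]
  have hle : ∀ g h : ℝ, 0 < g → |h| ≤ δ → δ ≤ g / 2 →
      |(g + h) * Real.log (g + h) - g * Real.log g - (Real.log g + 1) * h - h ^ 2 / (2 * g)|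
        ≤ 4 / g ^ 2 * δ ^ 3 := by
    intro g h hg h1 h2
    refine (abs_mul_log_taylor_le g h hg (h1.trans h2)).trans ?_
    gcongr
  have t1 := hle g1 x p1 a1 b1
  have t2 := hle g2 (-x) p2 a2 b2
  have t3 := hle g3 x p3 a1 b3
  have t4 := hle g4 y p4 a4 b4
  have t5 := hle g5 (-(x + y)) p5 a5 b5
  have t6 := hle g6 (x + y) p6 a6 b6
  have l1 : Real.log g1 = 2 * Real.log β := by rw [e1, Real.log_pow]; push_cast; ring
  have l2 : Real.log g2 = Real.log β + Real.log (1 - β) := by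
    rw [e2, Real.log_mul hβ.ne' hβ1'.ne']
  have l3 : Real.log g3 = 2 * Real.log (1 - β) := by rw [e3, Real.log_pow]; push_cast; ring
  have l4 : Real.log g4 = Real.log (d - 1) + 2 * Real.log β := by
    rw [e4, Real.log_mul hd1.ne' (by positivity), Real.log_pow]; push_cast; ring
  have l5 : Real.log g5 = Real.log β + Real.log (1 - β * d) := by
    rw [e5, Real.log_mul hβ.ne' hβd'.ne']
  have l6 : Real.log g6 = 2 * Real.log (1 - β * d) - Real.log d := by
    rw [e6, Real.log_div (by positivity) hd0.ne', Real.log_pow]; push_cast; ring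
  have q2 : β - β ^ 2 = g2 := by rw [e2]; ring
  have q2' : β - (β ^ 2 + x) = g2 + -x := by rw [e2]; ring
  have q3 : 1 - 2 * β + β ^ 2 = g3 := by rw [e3]; ring
  have q3' : 1 - 2 * β + (β ^ 2 + x) = g3 + x := by rw [e3]; ring
  have q5 : β - β ^ 2 - (d - 1) * β ^ 2 = g5 := by rw [e5]; ring
  have q5' : β - (β ^ 2 + x) - ((d - 1) * β ^ 2 + y) = g5 + -(x + y) := by rw [e5]; ring
  have q6 : 1 / d - 2 * β + β ^ 2 + (d - 1) * β ^ 2 = g6 := by rw [e6]; field_simp; ring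
  have q6' : 1 / d - 2 * β + (β ^ 2 + x) + ((d - 1) * β ^ 2 + y) = g6 + (x + y) := by
    rw [e6]; field_simp; ring
  have hH : overlapHessian d l β x y / 2 = x ^ 2 / (2 * g1) - 2 * (l - 1) * ((-x) ^ 2 / (2 * g2))
      - (l - 1) * (x ^ 2 / (2 * g3)) + l * (y ^ 2 / (2 * g4))
      + 2 * l * ((-(x + y)) ^ 2 / (2 * g5)) + l * ((x + y) ^ 2 / (2 * g6)) := by
    unfold overlapHessian
    rw [e1, e2, e3, e4, e5, e6]
    field_simp
    ring
  have hlin : -((Real.log g1 + 1) * x) + 2 * (l - 1) * ((Real.log g2 + 1) * -x)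
      + (l - 1) * ((Real.log g3 + 1) * x) - l * ((Real.log g4 + 1) * y)
      - 2 * l * ((Real.log g5 + 1) * -(x + y)) - l * ((Real.log g6 + 1) * (x + y))
      + l * y * Real.log ((d - 1) / d) - l * x * Real.log d = 0 := by
    rw [Real.log_div hd1.ne' hd0.ne', l1, l2, l3, l4, l5, l6]
    ring
  unfold overlapRate
  rw [hH, q5, q5', q2, q2', q3, q3', q6, q6', ← e4, ← e1]
  obtain ⟨r1, hr1⟩ : ∃ r, r = (g1 + x) * Real.log (g1 + x) - g1 * Real.log g1
    - (Real.log g1 + 1) * x - x ^ 2 / (2 * g1) := ⟨_, rfl⟩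
  obtain ⟨r2, hr2⟩ : ∃ r, r = (g2 + -x) * Real.log (g2 + -x) - g2 * Real.log g2
    - (Real.log g2 + 1) * -x - (-x) ^ 2 / (2 * g2) := ⟨_, rfl⟩
  obtain ⟨r3, hr3⟩ : ∃ r, r = (g3 + x) * Real.log (g3 + x) - g3 * Real.log g3
    - (Real.log g3 + 1) * x - x ^ 2 / (2 * g3) := ⟨_, rfl⟩
  obtain ⟨r4, hr4⟩ : ∃ r, r = (g4 + y) * Real.log (g4 + y) - g4 * Real.log g4
    - (Real.log g4 + 1) * y - y ^ 2 / (2 * g4) := ⟨_, rfl⟩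
  obtain ⟨r5, hr5⟩ : ∃ r, r = (g5 + -(x + y)) * Real.log (g5 + -(x + y)) - g5 * Real.log g5
    - (Real.log g5 + 1) * -(x + y) - (-(x + y)) ^ 2 / (2 * g5) := ⟨_, rfl⟩
  obtain ⟨r6, hr6⟩ : ∃ r, r = (g6 + (x + y)) * Real.log (g6 + (x + y)) - g6 * Real.log g6
    - (Real.log g6 + 1) * (x + y) - (x + y) ^ 2 / (2 * g6) := ⟨_, rfl⟩
  rw [← hr1] at t1
  rw [← hr2] at t2
  rw [← hr3] at t3
  rw [← hr4] at t4
  rw [← hr5] at t5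
  rw [← hr6] at t6
  have hfin : ∀ S : ℝ, S = -r1 + 2 * (l - 1) * r2 + (l - 1) * r3 - l * r4 - 2 * l * r5 - l * r6 →
      |S| ≤ (4 / g1 ^ 2 + 2 * (l - 1) * (4 / g2 ^ 2) + (l - 1) * (4 / g3 ^ 2) + l * (4 / g4 ^ 2)
        + 2 * l * (4 / g5 ^ 2) + l * (4 / g6 ^ 2)) * δ ^ 3 := by
    rintro S rfl
    have hl1 : 0 ≤ l - 1 := by linarith
    have m2 : |2 * (l - 1) * r2| ≤ 2 * (l - 1) * (4 / g2 ^ 2 * δ ^ 3) := by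
      rw [abs_mul, abs_of_nonneg (by positivity : 0 ≤ 2 * (l - 1))]; gcongr
    have m3 : |(l - 1) * r3| ≤ (l - 1) * (4 / g3 ^ 2 * δ ^ 3) := by
      rw [abs_mul, abs_of_nonneg hl1]; gcongr
    have m4 : |l * r4| ≤ l * (4 / g4 ^ 2 * δ ^ 3) := by
      rw [abs_mul, abs_of_nonneg (by linarith : 0 ≤ l)]; gcongr
    have m5 : |2 * l * r5| ≤ 2 * l * (4 / g5 ^ 2 * δ ^ 3) := by
      rw [abs_mul, abs_of_nonneg (by linarith : 0 ≤ 2 * l)]; gcongr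
    have m6 : |l * r6| ≤ l * (4 / g6 ^ 2 * δ ^ 3) := by
      rw [abs_mul, abs_of_nonneg (by linarith : 0 ≤ l)]; gcongr
    rw [abs_le] at t1 m2 m3 m4 m5 m6 ⊢
    constructor <;> linarith [t1.1, t1.2, m2.1, m2.2, m3.1, m3.2, m4.1, m4.2, m5.1, m5.2, m6.1, m6.2]
  refine hfin _ ?_
  rw [hr1, hr2, hr3, hr4, hr5, hr6]
  linear_combination hlin

theorem overlapHessian_det (d l β : ℝ) (hd : 2 ≤ d) (hl : 1 ≤ l) (hβ : 0 < β)
    (hβd : β * d < 1) :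
    (1 / β ^ 2 - 2 * (l - 1) / (β * (1 - β)) - (l - 1) / (1 - β) ^ 2) * (l / ((d - 1) * β ^ 2)) +
      ((1 / β ^ 2 - 2 * (l - 1) / (β * (1 - β)) - (l - 1) / (1 - β) ^ 2) + l / ((d - 1) * β ^ 2)) *
        (2 * l / (β * (1 - β * d)) + l * d / (1 - β * d) ^ 2) =
      l * (β ^ 2 * (d + l - d * l) - 2 * β + 1) /
        (β ^ 4 * (1 - β * d) ^ 2 * (d - 1) * (1 - β) ^ 2) := by
  have hβ1 : β < 1 / 2 := by nlinarith
  have hd1 : 0 < d - 1 := by linarith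
  have hβ1' : 0 < 1 - β := by linarith
  have hβd' : 0 < 1 - β * d := by linarith
  field_simp
  ring

/-- The expression is (1−β)² − β·β(d−1)(l−1), and the hypothesis bounds β(d−1)(l−1) by 1−β; so it is
at least (1−β)(1−2β). -/
theorem variance_factor_pos (d l β : ℝ) (hd : 2 ≤ d) (hβ : 0 < β)
    (hβd : β * d < 1) (hβl : β * ((d - 1) * (l - 1) + 1) ≤ 1) :
    0 < β ^ 2 * (d + l - d * l) - 2 * β + 1 := by
  have hβ1 : β < 1 / 2 := by nlinarith
  have : β ^ 2 * (d + l - d * l) - 2 * β + 1 =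
    (1 - β) ^ 2 - β * (β * ((d - 1) * (l - 1))) := by ring
  rw [this]
  nlinarith

theorem overlapHessian_complete_square (d l β x y P R S D : ℝ)
    (hP : P = 1 / β ^ 2 - 2 * (l - 1) / (β * (1 - β)) - (l - 1) / (1 - β) ^ 2)
    (hR : R = l / ((d - 1) * β ^ 2))
    (hS : S = 2 * l / (β * (1 - β * d)) + l * d / (1 - β * d) ^ 2)
    (hD : D = P * R + (P + R) * S) (hRS : R + S ≠ 0) :
    overlapHessian d l β x y = D / (R + S) * x ^ 2 + (R + S) * (y + S / (R + S) * x) ^ 2 := by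
  unfold overlapHessian
  rw [← hP, ← hR, ← hS, hD]
  field_simp
  ring

theorem overlapHessian_lower (d l β : ℝ) (hd : 2 ≤ d) (hl : 1 ≤ l) (hβ : 0 < β)
    (hβd : β * d < 1) (hβl : β * ((d - 1) * (l - 1) + 1) ≤ 1) :
    ∃ c > 0, ∀ x y : ℝ, c * (x ^ 2 + y ^ 2) ≤ overlapHessian d l β x y := by
  have hd1 : 0 < d - 1 := by linarith
  have hβd' : 0 < 1 - β * d := by linarith
  have hβ1 : β < 1 / 2 := by nlinarith
  have hβ1' : 0 < 1 - β := by linarith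
  obtain ⟨P, hP⟩ : ∃ P, P = 1 / β ^ 2 - 2 * (l - 1) / (β * (1 - β)) - (l - 1) / (1 - β) ^ 2 :=
    ⟨_, rfl⟩
  obtain ⟨R, hR⟩ : ∃ R, R = l / ((d - 1) * β ^ 2) := ⟨_, rfl⟩
  obtain ⟨S, hS⟩ : ∃ S, S = 2 * l / (β * (1 - β * d)) + l * d / (1 - β * d) ^ 2 := ⟨_, rfl⟩
  obtain ⟨D, hD⟩ : ∃ D, D = P * R + (P + R) * S := ⟨_, rfl⟩
  have hR0 : 0 < R := by rw [hR]; positivity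
  have hS0 : 0 < S := by rw [hS]; positivity
  have hD0 : 0 < D := by
    have := overlapHessian_det d l β hd hl hβ hβd
    rw [← hP, ← hR, ← hS, ← hD] at this
    rw [this]
    have := variance_factor_pos d l β hd hβ hβd hβl
    positivity
  have hsq := fun x y => overlapHessian_complete_square d l β x y P R S D hP hR hS hD (by positivity)
  obtain ⟨k, hk⟩ : ∃ k, k = S / (R + S) := ⟨_, rfl⟩
  obtain ⟨A, hA⟩ : ∃ A, A = R + S := ⟨_, rfl⟩
  obtain ⟨B, hB⟩ : ∃ B, B = D / (R + S) := ⟨_, rfl⟩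
  have hA0 : 0 < A := by rw [hA]; positivity
  have hB0 : 0 < B := by rw [hB]; positivity
  -- The constant comes from y² ≤ 2(y + kx)² + 2k²x², applied to the form Bx² + A(y + kx)².
  refine ⟨1 / ((1 + 2 * k ^ 2) / B + 2 / A), by positivity, fun x y => ?_⟩
  rw [hsq, ← hk, ← hB, ← hA, one_div, inv_mul_le_iff₀ (by positivity)]
  have h1 : ((1 + 2 * k ^ 2) / B + 2 / A) * (B * x ^ 2 + A * (y + k * x) ^ 2) =
      (1 + 2 * k ^ 2) * x ^ 2 + 2 * (y + k * x) ^ 2 +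
      ((1 + 2 * k ^ 2) / B * (A * (y + k * x) ^ 2) + 2 / A * (B * x ^ 2)) := by
    field_simp
    ring
  rw [h1]
  have h2 : 0 ≤ (1 + 2 * k ^ 2) / B * (A * (y + k * x) ^ 2) + 2 / A * (B * x ^ 2) := by positivity
  nlinarith [sq_nonneg (y + 2 * k * x)]

/-- The rate decays at least quadratically away from the uncorrelated point. -/
theorem overlapRate_sub_le_quadratic (L : ℕ) (hL : 1 ≤ L) (d β : ℝ) (hd : 2 ≤ d) (hβ : 0 < β)
    (hβd : β * d < 1) (hβl : β * ((d - 1) * L + 1) ≤ 1) :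
    ∃ c > 0, ∀ p ∈ overlapRegion d β,
      overlapRate d (L + 1) β p.1 p.2 - overlapRate d (L + 1) β (β ^ 2) ((d - 1) * β ^ 2) ≤
        -(c * ((p.1 - β ^ 2) ^ 2 + (p.2 - (d - 1) * β ^ 2) ^ 2)) := by
  have hLr : (1 : ℝ) ≤ L := by exact_mod_cast hL
  obtain ⟨c, hc, hH⟩ := overlapHessian_lower d (L + 1) β hd (by linarith) hβ hβd (by simpa using hβl)
  obtain ⟨K, hK, ε, hε, hT⟩ := abs_overlapRate_sub_le d (L + 1) β hd (by linarith) hβ hβd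
  -- Within distance η the cubic error is at most half of the quadratic term c/2·(x² + y²), which
  -- leaves c/4.
  obtain ⟨η, hη⟩ : ∃ η, η = min ε (c / (8 * K)) := ⟨_, rfl⟩
  have hη0 : 0 < η := by rw [hη]; positivity
  have hηε : η ≤ ε := by rw [hη]; exact min_le_left _ _
  have hηc : η * (8 * K) ≤ c := by
    rw [← le_div_iff₀ (by positivity), hη]; exact min_le_right _ _
  set S : Set (ℝ × ℝ) := overlapRegion d β ∩
    {p | η ≤ |p.1 - β ^ 2| + |p.2 - (d - 1) * β ^ 2|} with hS
  have hScomp : IsCompact S := by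
    refine (isCompact_overlapRegion d β).inter_right ?_
    exact isClosed_le (by fun_prop) (by fun_prop)
  have hnear : ∀ p : ℝ × ℝ, |p.1 - β ^ 2| + |p.2 - (d - 1) * β ^ 2| ≤ η →
      overlapRate d (L + 1) β p.1 p.2 - overlapRate d (L + 1) β (β ^ 2) ((d - 1) * β ^ 2) ≤
        -(c / 4 * ((p.1 - β ^ 2) ^ 2 + (p.2 - (d - 1) * β ^ 2) ^ 2)) := by
    intro p hp
    have h1 := hT (p.1 - β ^ 2) (p.2 - (d - 1) * β ^ 2) (hp.trans hηε)
    have h2 := hH (p.1 - β ^ 2) (p.2 - (d - 1) * β ^ 2)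
    simp only [add_sub_cancel] at h1
    obtain ⟨x, hx⟩ : ∃ x, x = p.1 - β ^ 2 := ⟨_, rfl⟩
    obtain ⟨y, hy⟩ : ∃ y, y = p.2 - (d - 1) * β ^ 2 := ⟨_, rfl⟩
    rw [← hx, ← hy] at h1 h2 hp ⊢
    have h3 := (abs_le.1 h1).2
    obtain ⟨δ, hδ⟩ : ∃ δ, δ = |x| + |y| := ⟨_, rfl⟩
    rw [← hδ] at h3 hp
    have hδ0 : 0 ≤ δ := by rw [hδ]; positivity
    have hδ2 : δ ^ 2 ≤ 2 * (x ^ 2 + y ^ 2) := by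
      rw [hδ, ← sq_abs x, ← sq_abs y]; nlinarith [sq_nonneg (|x| - |y|)]
    have h4 : K * δ ^ 3 ≤ c / 4 * (x ^ 2 + y ^ 2) := by
      have e : K * δ ^ 3 = (δ * K) * δ ^ 2 := by ring
      have h5 : δ * K ≤ c / 8 := by nlinarith
      rw [e]
      calc δ * K * δ ^ 2 ≤ c / 8 * (2 * (x ^ 2 + y ^ 2)) := by gcongr
        _ = _ := by ring
    linarith
  rcases S.eq_empty_or_nonempty with hemp | hne
  · refine ⟨c / 4, by positivity, fun p hp => hnear p ?_⟩
    by_contra hlt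
    push Not at hlt
    have : p ∈ S := ⟨hp, hlt.le⟩
    rw [hemp] at this
    exact this
  · obtain ⟨q, hq, hqmax⟩ := hScomp.exists_isMaxOn hne
      (continuous_overlapRate d (L + 1) β).continuousOn
    have hqc : q ≠ (β ^ 2, (d - 1) * β ^ 2) := by
      rintro rfl
      have := hq.2
      simp at this
      linarith
    have hlt := overlapRate_lt_center L hL d β hd hβ hβd hβl q hq.1 hqc
    obtain ⟨κ, hκ⟩ : ∃ κ, κ = overlapRate d (L + 1) β (β ^ 2) ((d - 1) * β ^ 2)
      - overlapRate d (L + 1) β q.1 q.2 := ⟨_, rfl⟩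
    have hκ0 : 0 < κ := by rw [hκ]; linarith
    obtain ⟨M, hM⟩ := ((isCompact_overlapRegion d β).bddAbove_image
      (f := fun p : ℝ × ℝ => (p.1 - β ^ 2) ^ 2 + (p.2 - (d - 1) * β ^ 2) ^ 2) (by fun_prop))
    have hM' : ∀ p ∈ overlapRegion d β,
        (p.1 - β ^ 2) ^ 2 + (p.2 - (d - 1) * β ^ 2) ^ 2 ≤ max M 1 := fun p hp =>
      (hM (Set.mem_image_of_mem _ hp)).trans (le_max_left _ _)
    have hM0 : 0 < max M 1 := lt_max_of_lt_right one_pos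
    -- Away from the centre the rate has a gap κ, and squared distances are at most max(M, 1).
    refine ⟨min (c / 4) (κ / max M 1), by positivity, fun p hp => ?_⟩
    have hn : 0 ≤ (p.1 - β ^ 2) ^ 2 + (p.2 - (d - 1) * β ^ 2) ^ 2 := by positivity
    by_cases hpn : |p.1 - β ^ 2| + |p.2 - (d - 1) * β ^ 2| ≤ η
    · refine (hnear p hpn).trans (neg_le_neg ?_)
      gcongr
      exact min_le_left _ _
    · push Not at hpn
      have h1 : overlapRate d (L + 1) β p.1 p.2 ≤ overlapRate d (L + 1) β q.1 q.2 :=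
        hqmax (⟨hp, hpn.le⟩ : p ∈ S)
      have h2 : min (c / 4) (κ / max M 1) *
          ((p.1 - β ^ 2) ^ 2 + (p.2 - (d - 1) * β ^ 2) ^ 2) ≤ κ := by
        calc _ ≤ κ / max M 1 * max M 1 := by
              gcongr
              · exact min_le_right _ _
              · exact hM' p hp
          _ = κ := by field_simp
      linarith

end Quadratic

/-! ### Stirling's formula with uniform bounds. -/

section Stirling

/-- The ratio of `j!` and the exponential part of Stirling's formula. -/
noncomputable def stirlingRatio (j : ℕ) : ℝ :=
  (j.factorial : ℝ) / Real.exp (j * Real.log j - j)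

theorem stirlingRatio_pos (j : ℕ) : 0 < stirlingRatio j := by
  unfold stirlingRatio
  have := Nat.factorial_pos j
  positivity

theorem factorial_eq_stirlingRatio_mul (j : ℕ) :
    (j.factorial : ℝ) = stirlingRatio j * Real.exp (j * Real.log j - j) := by
  unfold stirlingRatio
  field_simp

theorem stirlingRatio_eq (j : ℕ) (hj : j ≠ 0) :
    stirlingRatio j = Stirling.stirlingSeq j * √(2 * j) := by
  have hj' : (0 : ℝ) < j := by exact_mod_cast Nat.pos_of_ne_zero hj
  have h1 : Real.exp (j * Real.log j - j) = (j / Real.exp 1) ^ j := by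
    rw [← Real.exp_log (by positivity : 0 < (j : ℝ) / Real.exp 1), ← Real.exp_nat_mul,
      Real.log_div hj'.ne' (Real.exp_pos 1).ne', Real.log_exp]
    congr 1
    ring
  unfold stirlingRatio Stirling.stirlingSeq
  rw [h1]
  field_simp

theorem sqrt_le_stirlingRatio (j : ℕ) : √(j : ℝ) ≤ stirlingRatio j := by
  rcases Nat.eq_zero_or_pos j with rfl | hj
  · simpa using (stirlingRatio_pos 0).le
  · rw [stirlingRatio_eq j hj.ne', Real.sqrt_mul (by norm_num)]
    have h1 := Stirling.sqrt_pi_le_stirlingSeq hj.ne'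
    have h2 : (1 : ℝ) ≤ √Real.pi := Real.one_le_sqrt.2 (by linarith [Real.pi_gt_three])
    have h3 : (1 : ℝ) ≤ √2 := Real.one_le_sqrt.2 (by norm_num)
    have h4 : 0 ≤ √(j : ℝ) := Real.sqrt_nonneg _
    calc √(j : ℝ) = 1 * (1 * √(j : ℝ)) := by ring
      _ ≤ _ := mul_le_mul (h2.trans h1) (by gcongr) (by positivity)
          (zero_le_one.trans (h2.trans h1))

/-- At j = 0 the convention 0·log 0 = 0 makes the ratio 1. This bound keeps the degenerate
factorials at the boundary under control. -/
theorem one_le_stirlingRatio (j : ℕ) : 1 ≤ stirlingRatio j := by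
  rcases Nat.eq_zero_or_pos j with rfl | hj
  · simp [stirlingRatio]
  · refine le_trans ?_ (sqrt_le_stirlingRatio j)
    exact Real.one_le_sqrt.2 (by exact_mod_cast hj)

theorem stirlingRatio_le (j : ℕ) (hj : j ≠ 0) : stirlingRatio j ≤ Real.exp 1 * √(j : ℝ) := by
  rw [stirlingRatio_eq j hj, Real.sqrt_mul (by norm_num)]
  have h1 : Stirling.stirlingSeq j ≤ Real.exp 1 / √2 := by
    rw [← Stirling.stirlingSeq_one]
    obtain ⟨i, rfl⟩ := Nat.exists_eq_succ_of_ne_zero hj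
    exact Stirling.stirlingSeq'_antitone (Nat.zero_le i)
  calc Stirling.stirlingSeq j * (√2 * √(j : ℝ)) ≤ Real.exp 1 / √2 * (√2 * √(j : ℝ)) := by gcongr
    _ = _ := by field_simp

/-- `stirlingRatio` on the scale of its values at integers of order `m`. -/
noncomputable def scaledStirling (m j : ℕ) : ℝ := stirlingRatio j / √(m : ℝ)

theorem scaledStirling_pos (m j : ℕ) (hm : 0 < m) : 0 < scaledStirling m j := by
  have : (0 : ℝ) < m := by exact_mod_cast hm
  exact div_pos (stirlingRatio_pos j) (Real.sqrt_pos.2 this)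

theorem scaledStirling_le (m j : ℕ) (hm : 0 < m) (a : ℝ) (ha : 1 ≤ a) (hj : (j : ℝ) ≤ a * m) :
    scaledStirling m j ≤ Real.exp 1 * √a := by
  have hm' : (1 : ℝ) ≤ m := by exact_mod_cast hm
  unfold scaledStirling
  rw [div_le_iff₀ (Real.sqrt_pos.2 (by linarith)), mul_assoc, ← Real.sqrt_mul (by linarith)]
  rcases Nat.eq_zero_or_pos j with rfl | h
  · have h1 : (1 : ℝ) ≤ √(a * m) := Real.one_le_sqrt.2 (by nlinarith)
    have h2 : (1 : ℝ) ≤ Real.exp 1 := Real.one_le_exp (by norm_num)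
    have : stirlingRatio 0 = 1 := by simp [stirlingRatio]
    rw [this]
    nlinarith
  · exact (stirlingRatio_le j h.ne').trans (by gcongr)

theorem sqrt_le_scaledStirling (m j : ℕ) (hm : 0 < m) (a : ℝ) (ha : 0 ≤ a)
    (hj : a * m ≤ (j : ℝ)) : √a ≤ scaledStirling m j := by
  have hm' : (0 : ℝ) < m := by exact_mod_cast hm
  unfold scaledStirling
  rw [le_div_iff₀ (Real.sqrt_pos.2 hm'), ← Real.sqrt_mul ha]
  exact (Real.sqrt_le_sqrt hj).trans (sqrt_le_stirlingRatio j)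

theorem one_div_sqrt_le_scaledStirling (m j : ℕ) : 1 / √(m : ℝ) ≤ scaledStirling m j := by
  unfold scaledStirling
  gcongr
  exact one_le_stirlingRatio j

theorem tendsto_scaledStirling {F : Filter ℕ} (hF : F ≤ atTop) (j : ℕ → ℕ) (a : ℝ) (ha : 0 < a)
    (hj : Tendsto (fun m => (j m : ℝ) / m) F (𝓝 a)) :
    Tendsto (fun m => scaledStirling m (j m)) F (𝓝 √(2 * Real.pi * a)) := by
  have hm : Tendsto (fun m : ℕ => (m : ℝ)) F atTop := tendsto_natCast_atTop_atTop.mono_left hF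
  have hm0 : ∀ᶠ m : ℕ in F, (0 : ℝ) < m := hm.eventually_gt_atTop 0
  have hjr : Tendsto (fun m => (j m : ℝ)) F atTop := by
    refine (hj.pos_mul_atTop ha hm).congr' ?_
    filter_upwards [hm0] with m h
    field_simp
  have hjn : Tendsto j F atTop := tendsto_natCast_atTop_iff.1 hjr
  have h1 := Stirling.tendsto_stirlingSeq_sqrt_pi.comp hjn
  have h2 : Tendsto (fun m => √(2 * ((j m : ℝ) / m))) F (𝓝 √(2 * a)) :=
    (Real.continuous_sqrt.tendsto _).comp (hj.const_mul 2)
  have h3 : √Real.pi * √(2 * a) = √(2 * Real.pi * a) := by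
    rw [← Real.sqrt_mul Real.pi_pos.le]; congr 1; ring
  rw [← h3]
  refine (h1.mul h2).congr' ?_
  filter_upwards [hm0, hjn.eventually_gt_atTop 0] with m h h'
  unfold scaledStirling
  rw [stirlingRatio_eq _ h'.ne', Function.comp_apply, ← mul_div_assoc 2, Real.sqrt_div (by positivity),
    mul_div_assoc]

end Stirling

/-! ### The ratio of moments as a sum of overlap weights. -/

section Weight

/-- The contribution to the ratio of the second moment and the squared first moment of the pairs
of matchings with `r` common hyperedges, such that `t` half-edges of the first matching alone share
a vertex with the second matching alone. -/
noncomputable def overlapWeight (d l m n k r t : ℕ) : ℝ :=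
  (k.factorial : ℝ) ^ 2 * ((m - k).factorial : ℝ) ^ 2 * ((n - k * l).factorial : ℝ) ^ 2 *
      ((m * l).factorial : ℝ) /
    ((m.factorial : ℝ) * (n.factorial : ℝ) * ((m * l - k * l).factorial : ℝ) ^ 2 *
      (d : ℝ) ^ (k * l)) *
  (((m * l - (k * l + (k - r) * l)).factorial : ℝ) * (((k - r) * l).factorial : ℝ) ^ 2 *
      (d : ℝ) ^ ((k - r) * l - t) * ((d : ℝ) - 1) ^ t /
    ((r.factorial : ℝ) * ((k - r).factorial : ℝ) ^ 2 * ((m - k - (k - r)).factorial : ℝ) *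
      (t.factorial : ℝ) * (((k - r) * l - t).factorial : ℝ) ^ 2 *
      ((n - k * l - ((k - r) * l - t)).factorial : ℝ)))

/-- The possible overlaps of two matchings. -/
def overlapIndex (l n k : ℕ) : Finset (ℕ × ℕ) :=
  (Finset.range (k + 1) ×ˢ Finset.range (k * l + 1)).filter fun p =>
    p.2 ≤ (k - p.1) * l ∧ (k - p.1) * l - p.2 ≤ n - k * l

theorem mem_overlapIndex {l n k : ℕ} {p : ℕ × ℕ} :
    p ∈ overlapIndex l n k ↔
      p.1 ≤ k ∧ p.2 ≤ (k - p.1) * l ∧ (k - p.1) * l - p.2 ≤ n - k * l := by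
  unfold overlapIndex
  rw [Finset.mem_filter, Finset.mem_product, Finset.mem_range, Finset.mem_range]
  constructor
  · rintro ⟨⟨h1, -⟩, h2, h3⟩
    exact ⟨by omega, h2, h3⟩
  · rintro ⟨h1, h2, h3⟩
    have : (k - p.1) * l ≤ k * l := Nat.mul_le_mul_right l (Nat.sub_le _ _)
    exact ⟨⟨by omega, by omega⟩, h2, h3⟩

open RegHypergraph in
theorem second_moment_ratio_eq_sum (d l m n k : ℕ) (hd : 0 < d) (hn : n * d = m * l)
    (hkn : k * l ≤ n) (hkm : 2 * k ≤ m) :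
    expectation d l m (fun G => (G.numMatchings k : ℝ) ^ 2) /
      (expectation d l m (fun G => (G.numMatchings k : ℝ))) ^ 2 =
    ∑ p ∈ overlapIndex l n k, overlapWeight d l m n k p.1 p.2 := by
  have hkl : k * l ≤ m * l := Nat.mul_le_mul_right l (by omega)
  rw [expectation_numMatchings_sq hd hn, expectation_numMatchings hd hn]
  unfold overlapIndex extensionCount
  rw [Finset.sum_filter, Finset.sum_product, Nat.cast_sum, Finset.sum_div, Finset.sum_div]
  refine Finset.sum_congr rfl fun r hr => ?_
  have hrk : r ≤ k := Nat.lt_succ_iff.1 (Finset.mem_range.1 hr)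
  have hbk : (k - r) * l ≤ k * l := Nat.mul_le_mul_right l (Nat.sub_le _ _)
  have hsub : Finset.range ((k - r) * l + 1) ⊆ Finset.range (k * l + 1) :=
    Finset.range_subset_range.2 (by omega)
  rw [← Finset.sum_subset hsub]
  · push_cast
    rw [Finset.mul_sum, Finset.mul_sum, Finset.sum_mul, Finset.mul_sum, Finset.sum_div,
      Finset.sum_div]
    refine Finset.sum_congr rfl fun t ht => ?_
    have htb : t ≤ (k - r) * l := Nat.lt_succ_iff.1 (Finset.mem_range.1 ht)
    have hdesc : (n.descFactorial (k * l) : ℝ) = n.factorial / (n - k * l).factorial := by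
      rw [eq_div_iff (by exact_mod_cast (Nat.factorial_pos _).ne'), mul_comm]
      exact_mod_cast Nat.factorial_mul_descFactorial hkn
    by_cases hval : (k - r) * l - t ≤ n - k * l
    · rw [if_pos ⟨htb, hval⟩, hdesc, Nat.cast_choose ℝ (by omega : k ≤ m), Nat.cast_choose ℝ hrk,
        Nat.cast_choose ℝ (by omega : k - r ≤ m - k), Nat.cast_choose ℝ htb,
        Nat.cast_choose ℝ hval, Nat.cast_sub (by omega : 1 ≤ d)]
      unfold overlapWeight
      have hf : ∀ j : ℕ, (j.factorial : ℝ) ≠ 0 := fun j => by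
        exact_mod_cast (Nat.factorial_pos j).ne'
      have hd0 : (d : ℝ) ≠ 0 := by exact_mod_cast hd.ne'
      have hdp := pow_ne_zero (k * l) hd0
      have f1 := hf k
      have f2 := hf (m - k)
      have f3 := hf (n - k * l)
      have f4 := hf (m * l)
      have f5 := hf m
      have f6 := hf n
      have f7 := hf (m * l - k * l)
      have f8 := hf r
      have f9 := hf (k - r)
      have f10 := hf (m - k - (k - r))
      have f11 := hf t
      have f12 := hf ((k - r) * l - t)
      have f13 := hf (n - k * l - ((k - r) * l - t))
      push_cast
      generalize (k.factorial : ℝ) = x1 at *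
      generalize ((m - k).factorial : ℝ) = x2 at *
      generalize ((n - k * l).factorial : ℝ) = x3 at *
      generalize ((m * l).factorial : ℝ) = x4 at *
      generalize (m.factorial : ℝ) = x5 at *
      generalize (n.factorial : ℝ) = x6 at *
      generalize ((m * l - k * l).factorial : ℝ) = x7 at *
      generalize (r.factorial : ℝ) = x8 at *
      generalize ((k - r).factorial : ℝ) = x9 at *
      generalize ((m - k - (k - r)).factorial : ℝ) = x10 at *
      generalize (t.factorial : ℝ) = x11 at *
      generalize (((k - r) * l - t).factorial : ℝ) = x12 at *
      generalize ((n - k * l - ((k - r) * l - t)).factorial : ℝ) = x13 at *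
      generalize (((k - r) * l).factorial : ℝ) = x14 at *
      generalize ((m * l - (k * l + (k - r) * l)).factorial : ℝ) = x15 at *
      generalize (d : ℝ) ^ (k * l) = y1 at *
      generalize (d : ℝ) ^ ((k - r) * l - t) = y2 at *
      generalize ((d : ℝ) - 1) ^ t = y3 at *
      field_simp
    -- Indices beyond the available free vertices carry a vanishing binomial coefficient.
    · rw [if_neg fun h => hval h.2, Nat.choose_eq_zero_of_lt (not_le.1 hval)]
      simp
  · intro t _ ht
    rw [if_neg]
    rintro ⟨h, -⟩
    replace h : t ≤ (k - r) * l := h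
    exact ht (Finset.mem_range.2 (by omega))

/-- The polynomial part of `overlapWeight`. -/
noncomputable def overlapPrefactor (l m n k r t : ℕ) : ℝ :=
  scaledStirling m k ^ 2 * scaledStirling m (m - k) ^ 2 * scaledStirling m (n - k * l) ^ 2 *
      scaledStirling m (m * l) /
    (scaledStirling m m * scaledStirling m n * scaledStirling m (m * l - k * l) ^ 2) *
  (scaledStirling m (m * l - (k * l + (k - r) * l)) * scaledStirling m ((k - r) * l) ^ 2 /
    (scaledStirling m r * scaledStirling m (k - r) ^ 2 * scaledStirling m (m - k - (k - r)) *
      scaledStirling m t * scaledStirling m ((k - r) * l - t) ^ 2 *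
      scaledStirling m (n - k * l - ((k - r) * l - t))))

/-- In this form the central value is, up to sign, the exponential rate of the factor of
`overlapWeight` independent of r and t. -/
theorem overlapRate_center (d l β : ℝ) (hd : 2 ≤ d) (hβ : 0 < β) (hβd : β * d < 1) :
    overlapRate d l β (β ^ 2) ((d - 1) * β ^ 2) =
      -2 * (β * Real.log β) + 2 * (l - 1) * ((1 - β) * Real.log (1 - β))
        - 2 * l * ((1 / d - β) * (Real.log (1 - β * d) - Real.log d)) - l / d * Real.log d := by
  have hβ1 : β < 1 / 2 := by nlinarith
  have hd0 : 0 < d := by linarith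
  have hd1 : 0 < d - 1 := by linarith
  have hβ1' : 0 < 1 - β := by linarith
  have hβd' : 0 < 1 - β * d := by linarith
  have q2 : β - β ^ 2 = β * (1 - β) := by ring
  have q3 : 1 - 2 * β + β ^ 2 = (1 - β) ^ 2 := by ring
  have q5 : β - β ^ 2 - (d - 1) * β ^ 2 = β * (1 - β * d) := by ring
  have q6 : 1 / d - 2 * β + β ^ 2 + (d - 1) * β ^ 2 = (1 - β * d) ^ 2 / d := by field_simp; ring
  unfold overlapRate
  rw [q5, q2, q3, q6, Real.log_mul hβ.ne' hβ1'.ne', Real.log_mul hβ.ne' hβd'.ne',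
    Real.log_mul hd1.ne' (by positivity), Real.log_div (by positivity) hd0.ne',
    Real.log_div hd1.ne' hd0.ne', Real.log_pow, Real.log_pow, Real.log_pow]
  push_cast
  field_simp
  ring

theorem mul_log_sub_of_eq_mul (j M x : ℝ) (hM : 0 < M) (hj : j = M * x) :
    j * Real.log j - j = M * (x * Real.log x) + M * x * (Real.log M - 1) := by
  rcases eq_or_ne x 0 with rfl | hx
  · simp [hj]
  · rw [hj, Real.log_mul hM.ne' hx]; ring

theorem mul_weight_eq_prefactor_mul
    {M s x1 x2 x3 x4 x5 x6 x7 x8 x9 x10 x11 x12 x13 x14 x15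
      y1 y2 y3 y4 y5 y6 y7 y8 y9 y10 y11 y12 y13 y14 y15 p q u : ℝ} (hM : M = s ^ 2) (hs : s ≠ 0) :
    M * ((x1 * y1) ^ 2 * (x2 * y2) ^ 2 * (x3 * y3) ^ 2 * (x4 * y4) /
        ((x5 * y5) * (x6 * y6) * (x7 * y7) ^ 2 * p) *
      ((x8 * y8) * (x9 * y9) ^ 2 * q * u /
        ((x10 * y10) * (x11 * y11) ^ 2 * (x12 * y12) * (x13 * y13) * (x14 * y14) ^ 2 *
          (x15 * y15)))) =
    ((x1 / s) ^ 2 * (x2 / s) ^ 2 * (x3 / s) ^ 2 * (x4 / s) /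
        ((x5 / s) * (x6 / s) * (x7 / s) ^ 2) *
      ((x8 / s) * (x9 / s) ^ 2 /
        ((x10 / s) * (x11 / s) ^ 2 * (x12 / s) * (x13 / s) * (x14 / s) ^ 2 * (x15 / s)))) *
    (y1 ^ 2 * y2 ^ 2 * y3 ^ 2 * y4 / (y5 * y6 * y7 ^ 2 * p) *
      (y8 * y9 ^ 2 * q * u / (y10 * y11 ^ 2 * y12 * y13 * y14 ^ 2 * y15))) := by
  obtain ⟨i, hi⟩ : ∃ i, i = s⁻¹ := ⟨_, rfl⟩
  -- There are ten factorials in the numerator and twelve in the denominator, counted with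
  -- multiplicity. Scaling each by s = √m therefore costs exactly the factor m.
  have h : i ^ 10 * s ^ 12 = s ^ 2 := by rw [hi]; field_simp
  have hsi : s = i⁻¹ := by rw [hi, inv_inv]
  have hx : ∀ x, x / s = x * i := fun x => by rw [hi, div_eq_mul_inv]
  rw [hM, ← h]
  simp only [hx, div_eq_mul_inv, mul_inv, mul_pow, ← inv_pow, ← hsi]
  ring

theorem overlapIndex_casts {d l m n k r t : ℕ} {β ρ τ : ℝ} (hd : 2 ≤ d) (hl : 1 ≤ l)
    (hm : 0 < m) (hβd : β * d < 1) (hn : n * d = m * l) (hk : (k : ℝ) = m * β)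
    (hp : (r, t) ∈ overlapIndex l n k) (hr : (r : ℝ) = m * ρ) (ht : (t : ℝ) = m * l * τ) :
    (n : ℝ) = m * l * (1 / d) ∧ 2 * k ≤ m ∧ k * l ≤ n ∧
    ((m - k : ℕ) : ℝ) = m * (1 - β) ∧
    ((n - k * l : ℕ) : ℝ) = m * l * (1 / d - β) ∧
    ((m * l : ℕ) : ℝ) = m * l * 1 ∧
    ((m * l - k * l : ℕ) : ℝ) = m * l * (1 - β) ∧
    ((k - r : ℕ) : ℝ) = m * (β - ρ) ∧
    (((k - r) * l : ℕ) : ℝ) = m * l * (β - ρ) ∧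
    ((m - k - (k - r) : ℕ) : ℝ) = m * (1 - 2 * β + ρ) ∧
    ((m * l - (k * l + (k - r) * l) : ℕ) : ℝ) = m * l * (1 - 2 * β + ρ) ∧
    (((k - r) * l - t : ℕ) : ℝ) = m * l * (β - ρ - τ) ∧
    ((n - k * l - ((k - r) * l - t) : ℕ) : ℝ) = m * l * (1 / d - 2 * β + ρ + τ) := by
  obtain ⟨hrk, htb, hval⟩ := mem_overlapIndex.1 hp
  simp only at hrk htb hval
  have hd' : (2 : ℝ) ≤ d := by exact_mod_cast hd
  have hm' : (0 : ℝ) < m := by exact_mod_cast hm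
  have hd0 : (0 : ℝ) < d := by linarith
  have hnr : (n : ℝ) = m * l * (1 / d) := by
    have : (n : ℝ) * d = m * l := by exact_mod_cast hn
    field_simp
    linarith
  have hkm : 2 * k ≤ m := by
    have : (2 : ℝ) * k ≤ m := by rw [hk]; nlinarith
    exact_mod_cast this
  have hkn : k * l ≤ n := by
    have : (k : ℝ) * l ≤ n := by
      rw [hk, hnr]
      have : β ≤ 1 / d := by rw [le_div_iff₀ hd0]; linarith
      calc (m : ℝ) * β * l = m * l * β := by ring
        _ ≤ _ := by gcongr
    exact_mod_cast this
  have hkl : k * l ≤ m * l := Nat.mul_le_mul_right l (by omega)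
  have c_mk : ((m - k : ℕ) : ℝ) = m * (1 - β) := by
    rw [Nat.cast_sub (by omega), hk]; ring
  have c_q : ((n - k * l : ℕ) : ℝ) = m * l * (1 / d - β) := by
    rw [Nat.cast_sub hkn, hnr]; push_cast; rw [hk]; ring
  have c_kr : ((k - r : ℕ) : ℝ) = m * (β - ρ) := by
    rw [Nat.cast_sub hrk, hk, hr]; ring
  have c_b : (((k - r) * l : ℕ) : ℝ) = m * l * (β - ρ) := by
    rw [Nat.cast_mul, c_kr]; ring
  have c_bt : (((k - r) * l - t : ℕ) : ℝ) = m * l * (β - ρ - τ) := by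
    rw [Nat.cast_sub htb, c_b, ht]; ring
  refine ⟨hnr, hkm, hkn, c_mk, c_q, by push_cast; ring, ?_, c_kr, c_b, ?_, ?_, c_bt, ?_⟩
  · rw [Nat.cast_sub hkl]; push_cast; rw [hk]; ring
  · rw [Nat.cast_sub (by omega), c_mk, c_kr]; ring
  · have : k * l + (k - r) * l ≤ m * l := by
      rw [← add_mul]; exact Nat.mul_le_mul_right l (by omega)
    rw [Nat.cast_sub this, Nat.cast_add, c_b]; push_cast; rw [hk]; ring
  · rw [Nat.cast_sub hval, c_q, c_bt]; ring

/-- An identity with no asymptotic error: every factorial is its Stirling ratio times an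
exponential, and the log m and log l terms cancel in the exponent. -/
theorem overlapWeight_eq (d l m n k r t : ℕ) (β : ℝ) (hd : 2 ≤ d) (hl : 1 ≤ l) (hm : 0 < m)
    (hβ : 0 < β) (hβd : β * d < 1) (hn : n * d = m * l) (hk : (k : ℝ) = m * β)
    (hp : (r, t) ∈ overlapIndex l n k) :
    m * overlapWeight d l m n k r t = overlapPrefactor l m n k r t *
      Real.exp (m * (overlapRate d l β (r / m) (t / (m * l)) -
        overlapRate d l β (β ^ 2) ((d - 1) * β ^ 2))) := by
  have hd' : (2 : ℝ) ≤ d := by exact_mod_cast hd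
  have hl' : (0 : ℝ) < l := by exact_mod_cast hl
  have hm' : (0 : ℝ) < m := by exact_mod_cast hm
  have hd0 : (0 : ℝ) < d := by linarith
  have hd1 : (0 : ℝ) < (d : ℝ) - 1 := by linarith
  have hβd' : 0 < 1 - β * d := by linarith
  obtain ⟨ρ, hρ⟩ : ∃ ρ : ℝ, ρ = r / m := ⟨_, rfl⟩
  obtain ⟨τ, hτ⟩ : ∃ τ : ℝ, τ = t / (m * l) := ⟨_, rfl⟩
  have hr : (r : ℝ) = m * ρ := by rw [hρ]; field_simp
  have ht : (t : ℝ) = m * l * τ := by rw [hτ]; field_simp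
  obtain ⟨hnr, -, -, c_mk, c_q, c_N, c_Nk, c_kr, c_b, c_mv, c_Nv, c_bt, c_nv⟩ :=
    overlapIndex_casts hd hl hm hβd hn hk hp hr ht
  have hml : (0 : ℝ) < m * l := by positivity
  have h_k := mul_log_sub_of_eq_mul _ _ _ hm' hk
  have h_mk := mul_log_sub_of_eq_mul _ _ _ hm' c_mk
  have h_q := mul_log_sub_of_eq_mul _ _ _ hml c_q
  have h_N := mul_log_sub_of_eq_mul _ _ _ hml c_N
  have h_m := mul_log_sub_of_eq_mul (m : ℝ) _ 1 hm' (by ring)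
  have h_n := mul_log_sub_of_eq_mul _ _ _ hml hnr
  have h_Nk := mul_log_sub_of_eq_mul _ _ _ hml c_Nk
  have h_kr := mul_log_sub_of_eq_mul _ _ _ hm' c_kr
  have h_b := mul_log_sub_of_eq_mul _ _ _ hml c_b
  have h_mv := mul_log_sub_of_eq_mul _ _ _ hm' c_mv
  have h_Nv := mul_log_sub_of_eq_mul _ _ _ hml c_Nv
  have h_bt := mul_log_sub_of_eq_mul _ _ _ hml c_bt
  have h_nv := mul_log_sub_of_eq_mul _ _ _ hml c_nv
  have h_r := mul_log_sub_of_eq_mul _ _ _ hm' hr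
  have h_t := mul_log_sub_of_eq_mul _ _ _ hml ht
  have hlogml : Real.log (m * l : ℝ) = Real.log m + Real.log l := Real.log_mul hm'.ne' hl'.ne'
  have hlogq : Real.log (1 / d - β) = Real.log (1 - β * d) - Real.log d := by
    rw [← Real.log_div hβd'.ne' hd0.ne']; congr 1; field_simp
  rw [hlogml] at h_q h_N h_n h_Nk h_b h_Nv h_bt h_nv h_t
  rw [hlogq] at h_q
  rw [one_div, Real.log_inv, ← one_div] at h_n
  rw [Real.log_one] at h_N h_m
  have hexp : ∀ (a : ℝ) (j : ℕ), 0 < a → a ^ j = Real.exp (j * Real.log a) := fun a j ha => by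
    rw [Real.exp_nat_mul, Real.exp_log ha]
  rw [← hρ, ← hτ]
  have hE : ∀ e_k e_mk e_q e_N e_m e_n e_Nk e_kr e_b e_mv e_Nv e_bt e_nv e_r e_t p_k p_b p_t : ℝ,
      2 * e_k + 2 * e_mk + 2 * e_q + e_N - e_m - e_n - 2 * e_Nk - p_k + e_Nv + 2 * e_b + p_b + p_t
        - e_r - 2 * e_kr - e_mv - e_t - 2 * e_bt - e_nv =
        m * (overlapRate d l β ρ τ - overlapRate d l β (β ^ 2) ((d - 1) * β ^ 2)) →
      Real.exp (m * (overlapRate d l β ρ τ - overlapRate d l β (β ^ 2) ((d - 1) * β ^ 2))) =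
      Real.exp e_k ^ 2 * Real.exp e_mk ^ 2 * Real.exp e_q ^ 2 * Real.exp e_N /
        (Real.exp e_m * Real.exp e_n * Real.exp e_Nk ^ 2 * Real.exp p_k) *
      (Real.exp e_Nv * Real.exp e_b ^ 2 * Real.exp p_b * Real.exp p_t /
        (Real.exp e_r * Real.exp e_kr ^ 2 * Real.exp e_mv * Real.exp e_t * Real.exp e_bt ^ 2 *
          Real.exp e_nv)) := by
    intro e_k e_mk e_q e_N e_m e_n e_Nk e_kr e_b e_mv e_Nv e_bt e_nv e_r e_t p_k p_b p_t h
    rw [← h]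
    simp only [← Real.exp_nat_mul, ← Real.exp_add, ← Real.exp_sub]
    congr 1
    push_cast
    ring
  rw [hE _ _ _ _ _ _ _ _ _ _ _ _ _ _ _ (((k * l : ℕ) : ℝ) * Real.log d)
    ((((k - r) * l - t : ℕ) : ℝ) * Real.log d) ((t : ℝ) * Real.log ((d : ℝ) - 1))
    (?_ : 2 * ((k : ℝ) * Real.log k - k) +
      2 * (((m - k : ℕ) : ℝ) * Real.log ((m - k : ℕ) : ℝ) - ((m - k : ℕ) : ℝ)) +
      2 * (((n - k * l : ℕ) : ℝ) * Real.log ((n - k * l : ℕ) : ℝ) - ((n - k * l : ℕ) : ℝ)) +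
      (((m * l : ℕ) : ℝ) * Real.log ((m * l : ℕ) : ℝ) - ((m * l : ℕ) : ℝ)) -
      ((m : ℝ) * Real.log m - m) - ((n : ℝ) * Real.log n - n) -
      2 * (((m * l - k * l : ℕ) : ℝ) * Real.log ((m * l - k * l : ℕ) : ℝ) -
        ((m * l - k * l : ℕ) : ℝ)) - _ +
      (((m * l - (k * l + (k - r) * l) : ℕ) : ℝ) *
        Real.log ((m * l - (k * l + (k - r) * l) : ℕ) : ℝ) -
        ((m * l - (k * l + (k - r) * l) : ℕ) : ℝ)) +
      2 * ((((k - r) * l : ℕ) : ℝ) * Real.log (((k - r) * l : ℕ) : ℝ) - (((k - r) * l : ℕ) : ℝ)) +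
      _ + _ - ((r : ℝ) * Real.log r - r) -
      2 * (((k - r : ℕ) : ℝ) * Real.log ((k - r : ℕ) : ℝ) - ((k - r : ℕ) : ℝ)) -
      (((m - k - (k - r) : ℕ) : ℝ) * Real.log ((m - k - (k - r) : ℕ) : ℝ) -
        ((m - k - (k - r) : ℕ) : ℝ)) - ((t : ℝ) * Real.log t - t) -
      2 * ((((k - r) * l - t : ℕ) : ℝ) * Real.log (((k - r) * l - t : ℕ) : ℝ) -
        (((k - r) * l - t : ℕ) : ℝ)) -
      (((n - k * l - ((k - r) * l - t) : ℕ) : ℝ) *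
        Real.log ((n - k * l - ((k - r) * l - t) : ℕ) : ℝ) -
        ((n - k * l - ((k - r) * l - t) : ℕ) : ℝ)) = _)]
  · unfold overlapWeight overlapPrefactor
    simp only [factorial_eq_stirlingRatio_mul]
    rw [hexp d (k * l) hd0, hexp d ((k - r) * l - t) hd0, hexp ((d : ℝ) - 1) t hd1]
    unfold scaledStirling
    exact mul_weight_eq_prefactor_mul (Real.sq_sqrt hm'.le).symm (Real.sqrt_pos.2 hm').ne'
  · rw [h_k, h_mk, h_q, h_N, h_m, h_n, h_Nk, h_kr, h_b, h_mv, h_Nv, h_bt, h_nv, h_r, h_t,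
      overlapRate_center d l β hd' hβ hβd, c_bt, ht, Nat.cast_mul, hk]
    unfold overlapRate
    rw [Real.log_div hd1.ne' hd0.ne']
    field_simp
    ring

end Weight

/-! ### Uniform bounds and Gaussian domination. -/

section WeightBounds

theorem overlapPrefactor_le_of_bounds (l m n k r t : ℕ) (hm : 0 < m) (M κ κ' : ℝ) (hκ : 0 < κ)
    (hκ' : 0 < κ')
    (u1 : scaledStirling m k ≤ M) (u2 : scaledStirling m (m - k) ≤ M)
    (u3 : scaledStirling m (n - k * l) ≤ M) (u4 : scaledStirling m (m * l) ≤ M)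
    (u5 : scaledStirling m (m * l - (k * l + (k - r) * l)) ≤ M)
    (u6 : scaledStirling m ((k - r) * l) ≤ M)
    (v1 : κ ≤ scaledStirling m m) (v2 : κ ≤ scaledStirling m n)
    (v3 : κ ≤ scaledStirling m (m * l - k * l))
    (w1 : κ' ≤ scaledStirling m r) (w2 : κ' ≤ scaledStirling m (k - r))
    (w3 : κ' ≤ scaledStirling m (m - k - (k - r))) (w4 : κ' ≤ scaledStirling m t)
    (w5 : κ' ≤ scaledStirling m ((k - r) * l - t))
    (w6 : κ' ≤ scaledStirling m (n - k * l - ((k - r) * l - t))) :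
    overlapPrefactor l m n k r t ≤ M ^ 10 / κ ^ 4 * (1 / κ' ^ 8) := by
  have hp := fun j => (scaledStirling_pos m j hm).le
  have hM : 0 ≤ M := (hp k).trans u1
  have e : M ^ 10 / κ ^ 4 * (1 / κ' ^ 8) = M ^ 2 * M ^ 2 * M ^ 2 * M / (κ * κ * κ ^ 2) *
      (M * M ^ 2 / (κ' * κ' ^ 2 * κ' * κ' * κ' ^ 2 * κ')) := by
    field_simp
  rw [e]
  unfold overlapPrefactor
  have p1 := hp k
  have p2 := hp (m - k)
  have p3 := hp (n - k * l)
  have p4 := hp (m * l)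
  have p5 := hp (m * l - (k * l + (k - r) * l))
  have p6 := hp ((k - r) * l)
  generalize scaledStirling m k = x1 at *
  generalize scaledStirling m (m - k) = x2 at *
  generalize scaledStirling m (n - k * l) = x3 at *
  generalize scaledStirling m (m * l) = x4 at *
  generalize scaledStirling m (m * l - (k * l + (k - r) * l)) = x5 at *
  generalize scaledStirling m ((k - r) * l) = x6 at *
  generalize scaledStirling m m = y1 at *
  generalize scaledStirling m n = y2 at *
  generalize scaledStirling m (m * l - k * l) = y3 at *
  generalize scaledStirling m r = z1 at *
  generalize scaledStirling m (k - r) = z2 at *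
  generalize scaledStirling m (m - k - (k - r)) = z3 at *
  generalize scaledStirling m t = z4 at *
  generalize scaledStirling m ((k - r) * l - t) = z5 at *
  generalize scaledStirling m (n - k * l - ((k - r) * l - t)) = z6 at *
  have q1 : 0 < y1 := by linarith
  have q2 : 0 < y2 := by linarith
  have q3 : 0 < y3 := by linarith
  have q4 : 0 < z1 := by linarith
  have q5 : 0 < z2 := by linarith
  have q6 : 0 < z3 := by linarith
  have q7 : 0 < z4 := by linarith
  have q8 : 0 < z5 := by linarith
  have q9 : 0 < z6 := by linarith
  gcongr

theorem mem_overlapRegion_of_mem_overlapIndex {d l m n k r t : ℕ} {β ρ τ : ℝ} (hd : 2 ≤ d)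
    (hl : 1 ≤ l) (hm : 0 < m) (hβd : β * d < 1) (hn : n * d = m * l)
    (hk : (k : ℝ) = m * β) (hp : (r, t) ∈ overlapIndex l n k) (hr : (r : ℝ) = m * ρ)
    (ht : (t : ℝ) = m * l * τ) : (ρ, τ) ∈ overlapRegion d β := by
  obtain ⟨-, -, -, -, -, -, -, -, -, -, -, c_bt, c_nv⟩ :=
    overlapIndex_casts hd hl hm hβd hn hk hp hr ht
  have hm' : (0 : ℝ) < m := by exact_mod_cast hm
  have hl' : (0 : ℝ) < l := by exact_mod_cast hl
  refine ⟨?_, ?_, ?_, ?_⟩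
  · exact (mul_nonneg_iff_of_pos_left hm').1 (hr ▸ Nat.cast_nonneg r)
  · exact (mul_nonneg_iff_of_pos_left (mul_pos hm' hl')).1 (ht ▸ Nat.cast_nonneg t)
  · exact (mul_nonneg_iff_of_pos_left (mul_pos hm' hl')).1 (c_bt ▸ Nat.cast_nonneg _)
  · exact (mul_nonneg_iff_of_pos_left (mul_pos hm' hl')).1 (c_nv ▸ Nat.cast_nonneg _)

theorem overlapPrefactor_bounds (d l : ℕ) (β : ℝ) (hd : 2 ≤ d) (hl : 1 ≤ l) (hβ : 0 < β)
    (hβd : β * d < 1) :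
    ∃ C > 0, ∃ ε > 0, ∀ m n k r t : ℕ, 0 < m → n * d = m * l → (k : ℝ) = m * β →
      (r, t) ∈ overlapIndex l n k → overlapPrefactor l m n k r t ≤ C * (m : ℝ) ^ 4 ∧
      (|(r : ℝ) / m - β ^ 2| ≤ ε → |(t : ℝ) / (m * l) - (d - 1) * β ^ 2| ≤ ε →
        overlapPrefactor l m n k r t ≤ C) := by
  have hd' : (2 : ℝ) ≤ d := by exact_mod_cast hd
  have hl1 : (1 : ℝ) ≤ l := by exact_mod_cast hl
  have hl' : (0 : ℝ) < l := by linarith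
  have hd0 : (0 : ℝ) < d := by linarith
  have hd1 : (0 : ℝ) < (d : ℝ) - 1 := by linarith
  have hβd' : 0 < 1 - β * d := by linarith
  have hβ1 : β < 1 / 2 := by nlinarith
  have hβ1' : 0 < 1 - β := by linarith
  obtain ⟨M, hM⟩ : ∃ M, M = Real.exp 1 * √(l : ℝ) := ⟨_, rfl⟩
  obtain ⟨η, hη⟩ : ∃ η, η = min (min 1 (min (l * (1 / (d : ℝ))) (l * (1 - β)))) (min (min (β ^ 2)
    (min (β * (1 - β)) ((1 - β) ^ 2))) (min ((d - 1) * β ^ 2) (min (β * (1 - β * d))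
      ((1 - β * d) ^ 2 / d)))) := ⟨_, rfl⟩
  have hη0 : 0 < η := by rw [hη]; positivity
  have hηle := hη.le
  simp only [le_min_iff] at hηle
  obtain ⟨⟨a1, a2, a3⟩, ⟨b1, b2, b3⟩, b4, b5, b6⟩ := hηle
  obtain ⟨κ, hκ⟩ : ∃ κ, κ = √(η / 2) := ⟨_, rfl⟩
  have hκ0 : 0 < κ := by rw [hκ]; exact Real.sqrt_pos.2 (by linarith)
  have hM0 : 0 < M := by
    rw [hM]; have := Real.sqrt_pos.2 hl'; positivity
  refine ⟨M ^ 10 / κ ^ 4 * (1 + 1 / κ ^ 8), by positivity, η / 4, by positivity, ?_⟩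
  intro m n k r t hm hn hk hp
  have hm' : (0 : ℝ) < m := by exact_mod_cast hm
  have hm1 : (1 : ℝ) ≤ m := by exact_mod_cast hm
  obtain ⟨ρ, hρ⟩ : ∃ ρ : ℝ, ρ = r / m := ⟨_, rfl⟩
  obtain ⟨τ, hτ⟩ : ∃ τ : ℝ, τ = t / (m * l) := ⟨_, rfl⟩
  have hr : (r : ℝ) = m * ρ := by rw [hρ]; field_simp
  have ht : (t : ℝ) = m * l * τ := by rw [hτ]; field_simp
  obtain ⟨hnr, hkm, hkn, c_mk, c_q, c_N, c_Nk, c_kr, c_b, c_mv, c_Nv, c_bt, c_nv⟩ :=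
    overlapIndex_casts hd hl hm hβd hn hk hp hr ht
  have hml : m ≤ m * l := Nat.le_mul_of_pos_right m hl
  have hnm : n ≤ m * l := by rw [← hn]; exact Nat.le_mul_of_pos_right n (by omega)
  have hkl : k * l ≤ m * l := Nat.mul_le_mul_right l (by omega)
  have hbl : (k - r) * l ≤ k * l := Nat.mul_le_mul_right l (by omega)
  have hup : ∀ j : ℕ, j ≤ m * l → scaledStirling m j ≤ M := by
    intro j hj
    rw [hM]
    refine scaledStirling_le m j hm l hl1 ?_
    rw [mul_comm]
    exact_mod_cast hj
  have hlow : ∀ (j : ℕ) (x : ℝ), (j : ℝ) = m * x → η / 2 ≤ x → κ ≤ scaledStirling m j := by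
    intro j x hj hx
    rw [hκ]
    refine sqrt_le_scaledStirling m j hm (η / 2) (by linarith) ?_
    rw [hj, mul_comm]
    gcongr
  have hlow' : ∀ (j : ℕ) (x : ℝ), (j : ℝ) = m * l * x → η / 2 ≤ x → κ ≤ scaledStirling m j := by
    intro j x hj hx
    exact hlow j (l * x) (by rw [hj]; ring)
      (hx.trans (le_mul_of_one_le_left (by linarith) hl1))
  -- Only the denominators depending on r and t can degenerate. Their lower bound `κ'` is left open:
  -- 1/√m always, κ near the centre.
  have hgen := fun κ' hκ' w1 w2 w3 w4 w5 w6 => overlapPrefactor_le_of_bounds l m n k r t hm M κ κ'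
    hκ0 hκ' (hup k (by omega)) (hup (m - k) (by omega)) (hup (n - k * l) (by omega))
    (hup (m * l) le_rfl) (hup (m * l - (k * l + (k - r) * l)) (by omega))
    (hup ((k - r) * l) (by omega)) (hlow m 1 (by ring) (by linarith))
    (hlow n (l * (1 / d)) (by rw [hnr]; ring) (by linarith))
    (hlow (m * l - k * l) (l * (1 - β)) (by rw [c_Nk]; ring) (by linarith)) w1 w2 w3 w4 w5 w6
  have hs := Real.sqrt_pos.2 hm'
  constructor
  · refine (hgen (1 / √(m : ℝ)) (by positivity) (one_div_sqrt_le_scaledStirling m _)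
      (one_div_sqrt_le_scaledStirling m _) (one_div_sqrt_le_scaledStirling m _)
      (one_div_sqrt_le_scaledStirling m _) (one_div_sqrt_le_scaledStirling m _)
      (one_div_sqrt_le_scaledStirling m _)).trans ?_
    -- Eight such factors, counted with multiplicity, cost at most m⁴.
    have e : 1 / (1 / √(m : ℝ)) ^ 8 = (m : ℝ) ^ 4 := by
      have : √(m : ℝ) ^ 8 = (√(m : ℝ) ^ 2) ^ 4 := by ring
      rw [one_div_pow, one_div_one_div, this, Real.sq_sqrt hm'.le]
    rw [e]
    gcongr
    have : 0 ≤ M ^ 10 / κ ^ 4 * (1 / κ ^ 8) := by positivity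
    linarith
  · intro hx hy
    rw [← hρ] at hx
    rw [← hτ] at hy
    rw [abs_le] at hx hy
    have eB : β - ρ = β * (1 - β) - (ρ - β ^ 2) := by ring
    have eC : 1 - 2 * β + ρ = (1 - β) ^ 2 + (ρ - β ^ 2) := by ring
    have eE : β - ρ - τ = β * (1 - β * d) - (ρ - β ^ 2) - (τ - (d - 1) * β ^ 2) := by ring
    have eF : 1 / d - 2 * β + ρ + τ =
        (1 - β * d) ^ 2 / d + (ρ - β ^ 2) + (τ - (d - 1) * β ^ 2) := by field_simp; ring
    refine (hgen κ hκ0 (hlow r ρ hr (by linarith [hx.1]))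
      (hlow (k - r) _ c_kr (by rw [eB]; linarith [hx.2]))
      (hlow _ _ c_mv (by rw [eC]; linarith [hx.1]))
      (hlow' t τ ht (by linarith [hy.1]))
      (hlow' _ _ c_bt (by rw [eE]; linarith [hx.2, hy.2]))
      (hlow' _ _ c_nv (by rw [eF]; linarith [hx.1, hy.1]))).trans ?_
    gcongr
    linarith

theorem pow_four_mul_exp_neg_le (a x : ℝ) (ha : 0 < a) (hx : 0 ≤ x) :
    x ^ 4 * Real.exp (-(a * x)) ≤ 24 / a ^ 4 := by
  have h := Real.pow_div_factorial_le_exp (a * x) (by positivity) 4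
  rw [Real.exp_neg, ← div_eq_mul_inv, div_le_div_iff₀ (Real.exp_pos _) (by positivity)]
  have h4 : ((Nat.factorial 4 : ℕ) : ℝ) = 24 := by norm_num [Nat.factorial]
  rw [h4, div_le_iff₀ (by norm_num), mul_pow] at h
  linarith

/-- Gaussian domination of the overlap weights. -/
theorem overlapWeight_le_gaussian (d L : ℕ) (β : ℝ) (hd : 2 ≤ d) (hL : 1 ≤ L) (hβ : 0 < β)
    (hβd : β * d < 1) (hβL : β * (((d : ℝ) - 1) * L + 1) ≤ 1) :
    ∃ C c : ℝ, 0 < C ∧ 0 < c ∧ ∀ m n k r t : ℕ, 0 < m → n * d = m * (L + 1) → (k : ℝ) = m * β →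
      (r, t) ∈ overlapIndex (L + 1) n k →
      |m * overlapWeight d (L + 1) m n k r t| ≤ C * Real.exp (-(c * m *
        (((r : ℝ) / m - β ^ 2) ^ 2 + ((t : ℝ) / (m * (L + 1)) - (d - 1) * β ^ 2) ^ 2))) := by
  have hd' : (2 : ℝ) ≤ d := by exact_mod_cast hd
  obtain ⟨c, hc, hrate⟩ := overlapRate_sub_le_quadratic L hL d β hd' hβ hβd hβL
  obtain ⟨C, hC, ε, hε, hpre⟩ := overlapPrefactor_bounds d (L + 1) β hd (by omega) hβ hβd
  refine ⟨C * (1 + 24 / (c * ε ^ 2 / 2) ^ 4), c / 2, by positivity, by positivity, ?_⟩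
  intro m n k r t hm hn hk hp
  have hm' : (0 : ℝ) < m := by exact_mod_cast hm
  have heq := overlapWeight_eq d (L + 1) m n k r t β hd (by omega) hm hβ hβd hn hk hp
  obtain ⟨hfar, hnear⟩ := hpre m n k r t hm hn hk hp
  push_cast at heq hnear
  obtain ⟨ρ, hρ⟩ : ∃ ρ : ℝ, ρ = r / m := ⟨_, rfl⟩
  obtain ⟨τ, hτ⟩ : ∃ τ : ℝ, τ = t / (m * (L + 1)) := ⟨_, rfl⟩
  have hr : (r : ℝ) = m * ρ := by rw [hρ]; field_simp
  have ht : (t : ℝ) = m * ((L + 1 : ℕ) : ℝ) * τ := by rw [hτ]; push_cast; field_simp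
  have hmem := mem_overlapRegion_of_mem_overlapIndex hd (by omega) hm hβd hn hk hp hr ht
  have hR := hrate _ hmem
  simp only at hR
  rw [← hρ, ← hτ] at heq hnear ⊢
  obtain ⟨Q, hQ⟩ : ∃ Q, Q = (ρ - β ^ 2) ^ 2 + (τ - (d - 1) * β ^ 2) ^ 2 := ⟨_, rfl⟩
  rw [← hQ] at hR ⊢
  have hQ0 : 0 ≤ Q := by rw [hQ]; positivity
  have hpos : 0 < overlapPrefactor (L + 1) m n k r t := by
    unfold overlapPrefactor
    have := fun j => scaledStirling_pos m j hm
    have h1 := this k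
    have h2 := this (m - k)
    have h3 := this (n - k * (L + 1))
    have h4 := this (m * (L + 1))
    have h5 := this m
    have h6 := this n
    have h7 := this (m * (L + 1) - k * (L + 1))
    have h8 := this (m * (L + 1) - (k * (L + 1) + (k - r) * (L + 1)))
    have h9 := this ((k - r) * (L + 1))
    have h10 := this r
    have h11 := this (k - r)
    have h12 := this (m - k - (k - r))
    have h13 := this t
    have h14 := this ((k - r) * (L + 1) - t)
    have h15 := this (n - k * (L + 1) - ((k - r) * (L + 1) - t))
    positivity
  rw [heq, abs_of_pos (mul_pos hpos (Real.exp_pos _))]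
  have hexp : Real.exp (m * (overlapRate d (L + 1) β ρ τ -
      overlapRate d (L + 1) β (β ^ 2) ((d - 1) * β ^ 2))) ≤ Real.exp (-(c * m * Q)) := by
    apply Real.exp_le_exp.2
    have := mul_le_mul_of_nonneg_left hR hm'.le
    linarith
  have hhalf : Real.exp (-(c * m * Q)) ≤ Real.exp (-(c / 2 * m * Q)) := by
    apply Real.exp_le_exp.2
    have : 0 ≤ c * m * Q := by positivity
    linarith
  by_cases hQε : Q ≤ ε ^ 2
  · have hx : |ρ - β ^ 2| ≤ ε := by
      apply abs_le_of_sq_le_sq _ hε.le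
      nlinarith [sq_nonneg (τ - (d - 1) * β ^ 2)]
    have hy : |τ - (d - 1) * β ^ 2| ≤ ε := by
      apply abs_le_of_sq_le_sq _ hε.le
      nlinarith [sq_nonneg (ρ - β ^ 2)]
    have h1 := hnear hx hy
    calc _ ≤ C * Real.exp (-(c / 2 * m * Q)) :=
          mul_le_mul h1 (hexp.trans hhalf) (Real.exp_pos _).le hC.le
      _ ≤ _ := by
          have : 0 ≤ C * (24 / (c * ε ^ 2 / 2) ^ 4) := by positivity
          gcongr
          linarith
  · push Not at hQε
    -- Far from the centre half of the exponent absorbs the factor m⁴, and the other half remains as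
    -- the Gaussian bound.
    have h1 := pow_four_mul_exp_neg_le (c * ε ^ 2 / 2) m (by positivity) hm'.le
    have h2 : Real.exp (-(c * m * Q)) ≤
        Real.exp (-(c * ε ^ 2 / 2 * m)) * Real.exp (-(c / 2 * m * Q)) := by
      rw [← Real.exp_add]
      apply Real.exp_le_exp.2
      have : c / 2 * m * ε ^ 2 ≤ c / 2 * m * Q := by gcongr
      linarith
    calc _ ≤ (C * (m : ℝ) ^ 4) * (Real.exp (-(c * ε ^ 2 / 2 * m)) *
            Real.exp (-(c / 2 * m * Q))) :=
          mul_le_mul hfar (hexp.trans h2) (Real.exp_pos _).le (by positivity)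
      _ = C * ((m : ℝ) ^ 4 * Real.exp (-(c * ε ^ 2 / 2 * m))) * Real.exp (-(c / 2 * m * Q)) := by
          ring
      _ ≤ C * (24 / (c * ε ^ 2 / 2) ^ 4) * Real.exp (-(c / 2 * m * Q)) := by gcongr
      _ ≤ _ := by
          gcongr
          linarith

end WeightBounds

/-! ### Gaussian limit of a single weight on the scale √m. -/

section LocalLimit

theorem prefactor_limit_eq (d l β : ℝ) (hd : 2 ≤ d) (hl : 1 ≤ l) (hβ : 0 < β)
    (hβd : β * d < 1) :
    √(2 * Real.pi * β) ^ 2 * √(2 * Real.pi * (1 - β)) ^ 2 *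
        √(2 * Real.pi * (l * (1 / d - β))) ^ 2 * √(2 * Real.pi * l) /
      (√(2 * Real.pi * 1) * √(2 * Real.pi * (l * (1 / d))) *
        √(2 * Real.pi * (l * (1 - β))) ^ 2) *
    (√(2 * Real.pi * (l * (1 - β) ^ 2)) * √(2 * Real.pi * (l * (β * (1 - β)))) ^ 2 /
      (√(2 * Real.pi * β ^ 2) * √(2 * Real.pi * (β * (1 - β))) ^ 2 *
        √(2 * Real.pi * (1 - β) ^ 2) * √(2 * Real.pi * (l * ((d - 1) * β ^ 2))) *
        √(2 * Real.pi * (l * (β * (1 - β * d)))) ^ 2 *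
        √(2 * Real.pi * (l * ((1 - β * d) ^ 2 / d))))) =
    1 / (2 * Real.pi * β ^ 2 * (1 - β * d) * √(l * (d - 1))) := by
  have hβ1 : β < 1 / 2 := by nlinarith
  have hd0 : 0 < d := by linarith
  have hl0 : 0 < l := by linarith
  have hd1 : 0 < d - 1 := by linarith
  have hβ1' : 0 < 1 - β := by linarith
  have hβd' : 0 < 1 - β * d := by linarith
  have hq : 0 < 1 / d - β := by rw [sub_pos, lt_div_iff₀ hd0]; linarith
  have hπ := Real.pi_pos
  -- Naming the square roots of 2π, l, d and d−1 makes both sides rational expressions.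
  obtain ⟨p, hp⟩ : ∃ p, p = √(2 * Real.pi) := ⟨_, rfl⟩
  obtain ⟨a, ha⟩ : ∃ a, a = √l := ⟨_, rfl⟩
  obtain ⟨b, hb⟩ : ∃ b, b = √d := ⟨_, rfl⟩
  obtain ⟨c, hc⟩ : ∃ c, c = √(d - 1) := ⟨_, rfl⟩
  have hp0 : 0 < p := by rw [hp]; positivity
  have ha0 : 0 < a := by rw [ha]; positivity
  have hb0 : 0 < b := by rw [hb]; positivity
  have hc0 : 0 < c := by rw [hc]; positivity
  have hp2 : 2 * Real.pi = p ^ 2 := by rw [hp, Real.sq_sqrt (by positivity)]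
  have ha2 : l = a ^ 2 := by rw [ha, Real.sq_sqrt hl0.le]
  have hb2 : d = b ^ 2 := by rw [hb, Real.sq_sqrt hd0.le]
  have hc2 : d - 1 = c ^ 2 := by rw [hc, Real.sq_sqrt hd1.le]
  rw [Real.sq_sqrt (by positivity), Real.sq_sqrt (by positivity), Real.sq_sqrt (by positivity),
    Real.sq_sqrt (by positivity), Real.sq_sqrt (by positivity), Real.sq_sqrt (by positivity),
    Real.sq_sqrt (by positivity)]
  have e1 : √(2 * Real.pi * l) = p * a := by
    rw [hp2, ha2, ← mul_pow]; exact Real.sqrt_sq (by positivity)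
  have e2 : √(2 * Real.pi * 1) = p := by
    rw [hp2, mul_one]; exact Real.sqrt_sq (by positivity)
  have e3 : √(2 * Real.pi * (l * (1 / d))) = p * a / b := by
    rw [hp2, ha2, hb2]
    have : p ^ 2 * (a ^ 2 * (1 / b ^ 2)) = (p * a / b) ^ 2 := by field_simp
    rw [this]; exact Real.sqrt_sq (by positivity)
  have e4 : √(2 * Real.pi * (l * (1 - β) ^ 2)) = p * a * (1 - β) := by
    rw [hp2, ha2]
    have : p ^ 2 * (a ^ 2 * (1 - β) ^ 2) = (p * a * (1 - β)) ^ 2 := by ring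
    rw [this]; exact Real.sqrt_sq (by positivity)
  have e5 : √(2 * Real.pi * β ^ 2) = p * β := by
    rw [hp2, ← mul_pow]; exact Real.sqrt_sq (by positivity)
  have e6 : √(2 * Real.pi * (1 - β) ^ 2) = p * (1 - β) := by
    rw [hp2, ← mul_pow]; exact Real.sqrt_sq (by positivity)
  have e7 : √(2 * Real.pi * (l * ((d - 1) * β ^ 2))) = p * a * c * β := by
    rw [hp2, ha2, hc2]
    have : p ^ 2 * (a ^ 2 * (c ^ 2 * β ^ 2)) = (p * a * c * β) ^ 2 := by ring
    rw [this]; exact Real.sqrt_sq (by positivity)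
  have e8 : √(2 * Real.pi * (l * ((1 - β * d) ^ 2 / d))) = p * a * (1 - β * d) / b := by
    have : 2 * Real.pi * (l * ((1 - β * d) ^ 2 / d)) = (p * a * (1 - β * d) / b) ^ 2 := by
      rw [div_pow, mul_pow, mul_pow, ← hp2, ← ha2, ← hb2]; ring
    rw [this]; exact Real.sqrt_sq (by positivity)
  have e9 : √(l * (d - 1)) = a * c := by
    rw [ha2, hc2, ← mul_pow]; exact Real.sqrt_sq (by positivity)
  have e10 : 1 / d - β = (1 - β * d) / d := by field_simp
  rw [e1, e2, e3, e4, e5, e6, e7, e8, e9, e10, hp2, ha2]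
  obtain ⟨w, hw⟩ : ∃ w, w = 1 - β * d := ⟨_, rfl⟩
  rw [← hw] at hβd' ⊢
  rw [hb2]
  field_simp

theorem tendsto_overlapWeight (d l : ℕ) (β : ℝ) (hd : 2 ≤ d) (hl : 1 ≤ l) (hβ : 0 < β)
    (hβd : β * d < 1) {F : Filter ℕ} (hF : F ≤ atTop) (n k r t : ℕ → ℕ)
    (hev : ∀ᶠ m in F, n m * d = m * l ∧ (k m : ℝ) = m * β ∧ (r m, t m) ∈ overlapIndex l (n m) (k m))
    (z₁ z₂ : ℝ) (h₁ : Tendsto (fun m : ℕ => ((r m : ℝ) / m - β ^ 2) * √(m : ℝ)) F (𝓝 z₁))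
    (h₂ : Tendsto (fun m : ℕ => ((t m : ℝ) / (m * l) - (d - 1) * β ^ 2) * √(m : ℝ)) F (𝓝 z₂)) :
    Tendsto (fun m => m * overlapWeight d l m (n m) (k m) (r m) (t m)) F
      (𝓝 (1 / (2 * Real.pi * β ^ 2 * (1 - β * d) * √(l * ((d : ℝ) - 1))) *
        Real.exp (-(overlapHessian d l β z₁ z₂ / 2)))) := by
  have hd' : (2 : ℝ) ≤ d := by exact_mod_cast hd
  have hl1 : (1 : ℝ) ≤ l := by exact_mod_cast hl
  have hl' : (0 : ℝ) < l := by linarith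
  have hd0 : (0 : ℝ) < d := by linarith
  have hd1 : (0 : ℝ) < (d : ℝ) - 1 := by linarith
  have hβd' : 0 < 1 - β * d := by linarith
  have hβ1 : β < 1 / 2 := by nlinarith
  have hβ1' : 0 < 1 - β := by linarith
  have hq : 0 < 1 / (d : ℝ) - β := by rw [sub_pos, lt_div_iff₀ hd0]; linarith
  have hm : Tendsto (fun m : ℕ => (m : ℝ)) F atTop := tendsto_natCast_atTop_atTop.mono_left hF
  have hm0 : ∀ᶠ m : ℕ in F, 0 < m := hF (eventually_gt_atTop 0)
  have hsq : Tendsto (fun m : ℕ => (√(m : ℝ))⁻¹) F (𝓝 0) :=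
    (Real.tendsto_sqrt_atTop.comp hm).inv_tendsto_atTop
  have hx : Tendsto (fun m : ℕ => (r m : ℝ) / m - β ^ 2) F (𝓝 0) := by
    have := h₁.mul hsq
    rw [mul_zero] at this
    refine this.congr' ?_
    filter_upwards [hm0] with m h
    have : 0 < √(m : ℝ) := Real.sqrt_pos.2 (by exact_mod_cast h)
    field_simp
  have hy : Tendsto (fun m : ℕ => (t m : ℝ) / (m * l) - (d - 1) * β ^ 2) F (𝓝 0) := by
    have := h₂.mul hsq
    rw [mul_zero] at this
    refine this.congr' ?_
    filter_upwards [hm0] with m h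
    have : 0 < √(m : ℝ) := Real.sqrt_pos.2 (by exact_mod_cast h)
    field_simp
  have hrm : ∀ m : ℕ, 0 < m → (r m : ℝ) = m * ((r m : ℝ) / m) := fun m h => by
    have h' : (0 : ℝ) < m := by exact_mod_cast h
    field_simp
  have htm : ∀ m : ℕ, 0 < m → (t m : ℝ) = m * l * ((t m : ℝ) / (m * l)) := fun m h => by
    have h' : (0 : ℝ) < m := by exact_mod_cast h
    field_simp
  have hcasts := (hm0.and hev).mono fun m hh => And.intro hh.1 (overlapIndex_casts hd hl hh.1
    hβd hh.2.1 hh.2.2.1 hh.2.2.2 (hrm m hh.1) (htm m hh.1))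
  have hscale : ∀ (j : ℕ → ℕ) (g : ℕ → ℝ) (a : ℝ), 0 < a →
      (∀ᶠ m in F, 0 < m ∧ (j m : ℝ) = m * g m) → Tendsto g F (𝓝 a) →
      Tendsto (fun m => scaledStirling m (j m)) F (𝓝 √(2 * Real.pi * a)) := by
    intro j g a ha hj hg
    refine tendsto_scaledStirling hF j a ha (hg.congr' ?_)
    filter_upwards [hj] with m ⟨h, hjm⟩
    have h' : (0 : ℝ) < m := by exact_mod_cast h
    rw [hjm]; field_simp
  have s1 := hscale (fun m => k m) (fun _ => β) β hβ
    (by filter_upwards [hm0, hev] with m h h'; exact ⟨h, h'.2.1⟩) tendsto_const_nhds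
  have s2 := hscale (fun m => m - k m) (fun _ => 1 - β) (1 - β) hβ1'
    (by filter_upwards [hcasts] with m ⟨h, h1, h2, h3, h4, _⟩; exact ⟨h, h4⟩) tendsto_const_nhds
  have s3 := hscale (fun m => n m - k m * l) (fun _ => l * (1 / (d : ℝ) - β))
    (l * (1 / (d : ℝ) - β)) (by positivity)
    (by filter_upwards [hcasts] with m ⟨h, h1, h2, h3, h4, h5, _⟩
        exact ⟨h, by rw [h5, mul_assoc]⟩) tendsto_const_nhds
  have s4 := hscale (fun m => m * l) (fun _ => (l : ℝ)) l hl'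
    (by filter_upwards [hm0] with m h; exact ⟨h, by push_cast; rfl⟩) tendsto_const_nhds
  have s5 := hscale (fun m => m) (fun _ => (1 : ℝ)) 1 one_pos
    (by filter_upwards [hm0] with m h; exact ⟨h, (mul_one _).symm⟩) tendsto_const_nhds
  have s6 := hscale (fun m => n m) (fun _ => l * (1 / (d : ℝ))) (l * (1 / (d : ℝ)))
    (by positivity) (by filter_upwards [hcasts] with m ⟨h, h1, _⟩
                        exact ⟨h, by rw [h1, mul_assoc]⟩) tendsto_const_nhds
  have s7 := hscale (fun m => m * l - k m * l) (fun _ => l * (1 - β)) (l * (1 - β))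
    (by positivity)
    (by filter_upwards [hcasts] with m ⟨h, h1, h2, h3, h4, h5, h6, h7, _⟩
        exact ⟨h, by rw [h7, mul_assoc]⟩) tendsto_const_nhds
  have tB : Tendsto (fun m : ℕ => β - (r m : ℝ) / m) F (𝓝 (β * (1 - β))) := by
    have := hx.const_sub (β * (1 - β))
    rw [sub_zero] at this
    exact this.congr fun m => by ring
  have tC : Tendsto (fun m : ℕ => 1 - 2 * β + (r m : ℝ) / m) F (𝓝 ((1 - β) ^ 2)) := by
    have := hx.const_add ((1 - β) ^ 2)
    rw [add_zero] at this
    exact this.congr fun m => by ring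
  have tA : Tendsto (fun m : ℕ => (r m : ℝ) / m) F (𝓝 (β ^ 2)) := by
    have := hx.const_add (β ^ 2)
    rw [add_zero] at this
    exact this.congr fun m => by ring
  have tD : Tendsto (fun m : ℕ => (t m : ℝ) / (m * l)) F (𝓝 ((d - 1) * β ^ 2)) := by
    have := hy.const_add ((d - 1) * β ^ 2)
    rw [add_zero] at this
    exact this.congr fun m => by ring
  have tE : Tendsto (fun m : ℕ => β - (r m : ℝ) / m - (t m : ℝ) / (m * l)) F
      (𝓝 (β * (1 - β * d))) := by
    have := tB.sub tD
    have e : β * (1 - β) - (d - 1) * β ^ 2 = β * (1 - β * d) := by ring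
    rwa [e] at this
  have tF : Tendsto (fun m : ℕ => 1 / (d : ℝ) - 2 * β + (r m : ℝ) / m + (t m : ℝ) / (m * l)) F
      (𝓝 ((1 - β * d) ^ 2 / d)) := by
    have := (tA.const_add (1 / (d : ℝ) - 2 * β)).add tD
    have e : 1 / (d : ℝ) - 2 * β + β ^ 2 + (d - 1) * β ^ 2 = (1 - β * d) ^ 2 / d := by
      field_simp; ring
    rwa [e] at this
  have v1 := hscale (fun m => m * l - (k m * l + (k m - r m) * l)) _ (l * (1 - β) ^ 2)
    (by positivity)
    (by filter_upwards [hcasts] with m ⟨h, h1, h2, h3, h4, h5, h6, h7, h8, h9, h10, h11, _⟩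
        exact ⟨h, by rw [h11, mul_assoc]⟩) (tC.const_mul (l : ℝ))
  have v2 := hscale (fun m => (k m - r m) * l) _ (l * (β * (1 - β))) (by positivity)
    (by filter_upwards [hcasts] with m ⟨h, h1, h2, h3, h4, h5, h6, h7, h8, h9, _⟩
        exact ⟨h, by rw [h9, mul_assoc]⟩) (tB.const_mul (l : ℝ))
  have v3 := hscale (fun m => r m) _ (β ^ 2) (by positivity)
    (by filter_upwards [hm0] with m h
        have h' : (0 : ℝ) < m := by exact_mod_cast h
        exact ⟨h, by field_simp⟩) tA
  have v4 := hscale (fun m => k m - r m) _ (β * (1 - β)) (by positivity)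
    (by filter_upwards [hcasts] with m ⟨h, h1, h2, h3, h4, h5, h6, h7, h8, _⟩
        exact ⟨h, h8⟩) tB
  have v5 := hscale (fun m => m - k m - (k m - r m)) _ ((1 - β) ^ 2) (by positivity)
    (by filter_upwards [hcasts] with m ⟨h, h1, h2, h3, h4, h5, h6, h7, h8, h9, h10, _⟩
        exact ⟨h, h10⟩) tC
  have v6 := hscale (fun m => t m) _ (l * ((d - 1) * β ^ 2)) (by positivity)
    (by filter_upwards [hm0] with m h
        have h' : (0 : ℝ) < m := by exact_mod_cast h
        exact ⟨h, by field_simp⟩) (tD.const_mul (l : ℝ))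
  have v7 := hscale (fun m => (k m - r m) * l - t m) _ (l * (β * (1 - β * d))) (by positivity)
    (by filter_upwards [hcasts] with m ⟨h, h1, h2, h3, h4, h5, h6, h7, h8, h9, h10, h11, h12, h13⟩
        exact ⟨h, by rw [h12, mul_assoc]⟩) (tE.const_mul (l : ℝ))
  have v8 := hscale (fun m => n m - k m * l - ((k m - r m) * l - t m)) _
    (l * ((1 - β * d) ^ 2 / d)) (by positivity)
    (by filter_upwards [hcasts] with m ⟨h, h1, h2, h3, h4, h5, h6, h7, h8, h9, h10, h11, h12, h13⟩
        exact ⟨h, by rw [h13, mul_assoc]⟩) (tF.const_mul (l : ℝ))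
  have hpre : Tendsto (fun m => overlapPrefactor l m (n m) (k m) (r m) (t m)) F
      (𝓝 (1 / (2 * Real.pi * β ^ 2 * (1 - β * d) * √(l * ((d : ℝ) - 1))))) := by
    rw [← prefactor_limit_eq d l β hd' hl1 hβ hβd]
    have hπ := Real.pi_pos
    exact (((((s1.pow 2).mul (s2.pow 2)).mul (s3.pow 2)).mul s4).div
      ((s5.mul s6).mul (s7.pow 2)) (by positivity)).mul
      ((v1.mul (v2.pow 2)).div (((((v3.mul (v4.pow 2)).mul v5).mul v6).mul (v7.pow 2)).mul v8)
        (by positivity))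
  have hexponent : Tendsto (fun m : ℕ => (m : ℝ) * (overlapRate d l β ((r m : ℝ) / m)
      ((t m : ℝ) / (m * l)) - overlapRate d l β (β ^ 2) ((d - 1) * β ^ 2))) F
      (𝓝 (-(overlapHessian d l β z₁ z₂ / 2))) := by
    obtain ⟨K, hK, ε, hε, hT⟩ := abs_overlapRate_sub_le d l β hd' hl1 hβ hβd
    have hcH : Continuous fun p : ℝ × ℝ => overlapHessian d l β p.1 p.2 := by
      unfold overlapHessian; fun_prop
    have hH := (hcH.tendsto (z₁, z₂)).comp (h₁.prodMk_nhds h₂)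
    -- The cubic Taylor error times m, written in rescaled deviations, is bounded by a convergent
    -- quantity over √m.
    have herr : Tendsto (fun m : ℕ => K * (|((r m : ℝ) / m - β ^ 2) * √(m : ℝ)| +
        |((t m : ℝ) / (m * l) - (d - 1) * β ^ 2) * √(m : ℝ)|) ^ 3 * (√(m : ℝ))⁻¹) F (𝓝 0) := by
      have := (((h₁.abs.add h₂.abs).pow 3).const_mul K).mul hsq
      rwa [mul_zero] at this
    have hsmall : ∀ᶠ m : ℕ in F, |(r m : ℝ) / m - β ^ 2| +
        |(t m : ℝ) / (m * l) - (d - 1) * β ^ 2| ≤ ε := by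
      have := hx.abs.add hy.abs
      rw [abs_zero, add_zero] at this
      exact (this.eventually (eventually_lt_nhds hε)).mono fun m h => h.le
    have hdiff : Tendsto (fun m : ℕ => (m : ℝ) * (overlapRate d l β ((r m : ℝ) / m)
        ((t m : ℝ) / (m * l)) - overlapRate d l β (β ^ 2) ((d - 1) * β ^ 2)) +
        overlapHessian d l β (((r m : ℝ) / m - β ^ 2) * √(m : ℝ))
          (((t m : ℝ) / (m * l) - (d - 1) * β ^ 2) * √(m : ℝ)) / 2) F (𝓝 0) := by
      refine squeeze_zero_norm' ?_ herr
      filter_upwards [hm0, hsmall] with m h hs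
      have h' : (0 : ℝ) < m := by exact_mod_cast h
      have hb := hT _ _ hs
      simp only [add_sub_cancel] at hb
      generalize (r m : ℝ) / m - β ^ 2 = x at *
      generalize (t m : ℝ) / (m * l) - (d - 1) * β ^ 2 = y at *
      obtain ⟨s, hs⟩ : ∃ s, s = √(m : ℝ) := ⟨_, rfl⟩
      have hs0 : 0 < s := by rw [hs]; exact Real.sqrt_pos.2 h'
      have hms : (m : ℝ) = s ^ 2 := by rw [hs, Real.sq_sqrt h'.le]
      rw [← hs]
      have e1 : overlapHessian d l β (x * s) (y * s) = m * overlapHessian d l β x y := by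
        rw [hms]; unfold overlapHessian; ring
      rw [e1, mul_div_assoc, ← mul_add, norm_mul, Real.norm_eq_abs, Real.norm_eq_abs,
        abs_of_pos h', abs_mul, abs_mul, abs_of_pos hs0]
      calc (m : ℝ) * _ ≤ m * (K * (|x| + |y|) ^ 3) := by gcongr
        _ = _ := by rw [hms]; field_simp
    have := hdiff.sub (hH.div_const 2)
    rw [zero_sub] at this
    refine this.congr fun m => ?_
    simp only [Function.comp_apply]
    ring
  have hfin := hpre.mul ((Real.continuous_exp.tendsto _).comp hexponent)
  refine hfin.congr' ?_
  filter_upwards [hm0, hev] with m h ⟨hn, hk, hp⟩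
  rw [overlapWeight_eq d l m (n m) (k m) (r m) (t m) β hd hl h hβ hβd hn hk hp]
  rfl

end LocalLimit

/-! ### Lattice sums and the Gaussian integral. -/

section LatticeSum

open MeasureTheory

theorem integrable_exp_neg_mul_sq_add_sq (a : ℝ) (ha : 0 < a) :
    Integrable fun z : ℝ × ℝ => Real.exp (-(a * (z.1 ^ 2 + z.2 ^ 2))) := by
  have h := (integrable_exp_neg_mul_sq ha).mul_prod (integrable_exp_neg_mul_sq ha)
  refine h.congr (Eventually.of_forall fun z => ?_)
  simp only
  rw [← Real.exp_add]
  congr 1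
  ring

theorem integral_exp_neg_quadratic (a b κ : ℝ)
    (hint : Integrable fun z : ℝ × ℝ => Real.exp (-(a * z.1 ^ 2 + b * (z.2 + κ * z.1) ^ 2))) :
    ∫ z : ℝ × ℝ, Real.exp (-(a * z.1 ^ 2 + b * (z.2 + κ * z.1) ^ 2)) =
      √(Real.pi / a) * √(Real.pi / b) := by
  rw [Measure.volume_eq_prod] at hint ⊢
  rw [integral_prod _ hint]
  have h1 : ∀ x : ℝ, ∫ y : ℝ, Real.exp (-(a * x ^ 2 + b * (y + κ * x) ^ 2)) =
      Real.exp (-a * x ^ 2) * √(Real.pi / b) := by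
    intro x
    have h2 : ∀ y : ℝ, Real.exp (-(a * x ^ 2 + b * (y + κ * x) ^ 2)) =
        Real.exp (-a * x ^ 2) * Real.exp (-b * (y + κ * x) ^ 2) := fun y => by
      rw [← Real.exp_add]; congr 1; ring
    simp only [h2]
    rw [integral_const_mul, integral_add_right_eq_self (fun y : ℝ => Real.exp (-b * y ^ 2)),
      integral_gaussian]
  simp only [h1]
  rw [integral_mul_const, integral_gaussian]

/-- The set of points that are rounded down to a given lattice point. -/
theorem mem_cell_iff (c s z : ℝ) (hs : 0 < s) (j : ℕ) :
    z ∈ Set.Ico ((j - c) / s) ((j + 1 - c) / s) ↔ 0 ≤ c + s * z ∧ ⌊c + s * z⌋₊ = j := by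
  rw [Set.mem_Ico, div_le_iff₀ hs, lt_div_iff₀ hs]
  constructor
  · rintro ⟨h1, h2⟩
    have h0 : 0 ≤ c + s * z := by
      have : (0 : ℝ) ≤ j := Nat.cast_nonneg j
      linarith
    exact ⟨h0, (Nat.floor_eq_iff h0).2 ⟨by linarith, by linarith⟩⟩
  · rintro ⟨h0, h⟩
    obtain ⟨h1, h2⟩ := (Nat.floor_eq_iff h0).1 h
    exact ⟨by linarith, by linarith⟩

/-- Each lattice point owns a cell of area 1/s² on which the floor pair is constant. The
nonnegativity conditions exclude points that the natural floor would truncate to 0. -/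
theorem sum_eq_integral_floor (S : Finset (ℕ × ℕ)) (f : ℕ × ℕ → ℝ) (c₁ c₂ s : ℝ) (hs : 0 < s) :
    (Measurable fun z : ℝ × ℝ =>
      if 0 ≤ c₁ + s * z.1 ∧ 0 ≤ c₂ + s * z.2 ∧ (⌊c₁ + s * z.1⌋₊, ⌊c₂ + s * z.2⌋₊) ∈ S then
        s ^ 2 * f (⌊c₁ + s * z.1⌋₊, ⌊c₂ + s * z.2⌋₊) else 0) ∧
    ∑ p ∈ S, f p = ∫ z : ℝ × ℝ,
      if 0 ≤ c₁ + s * z.1 ∧ 0 ≤ c₂ + s * z.2 ∧ (⌊c₁ + s * z.1⌋₊, ⌊c₂ + s * z.2⌋₊) ∈ S then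
        s ^ 2 * f (⌊c₁ + s * z.1⌋₊, ⌊c₂ + s * z.2⌋₊) else 0 := by
  let cell : ℕ × ℕ → Set (ℝ × ℝ) := fun p =>
    Set.Ico ((p.1 - c₁) / s) ((p.1 + 1 - c₁) / s) ×ˢ Set.Ico ((p.2 - c₂) / s) ((p.2 + 1 - c₂) / s)
  have hcell : ∀ p z, z ∈ cell p ↔ (0 ≤ c₁ + s * z.1 ∧ 0 ≤ c₂ + s * z.2) ∧
      (⌊c₁ + s * z.1⌋₊, ⌊c₂ + s * z.2⌋₊) = p := by
    intro p z
    rw [Set.mem_prod, mem_cell_iff _ _ _ hs, mem_cell_iff _ _ _ hs, Prod.ext_iff]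
    tauto
  have hmeas : ∀ p, MeasurableSet (cell p) := fun p => measurableSet_Ico.prod measurableSet_Ico
  have hvol : ∀ p, volume.real (cell p) = 1 / s ^ 2 := by
    intro p
    have e : ∀ (c : ℝ) (j : ℕ), volume.real (Set.Ico ((j - c) / s) ((j + 1 - c) / s)) = 1 / s := by
      intro c j
      have hle : ((j : ℝ) - c) / s ≤ (j + 1 - c) / s := by gcongr; linarith
      rw [Real.volume_real_Ico_of_le hle]
      field_simp
      ring
    rw [Measure.volume_eq_prod, measureReal_prod_prod, e, e]
    field_simp
  have hfin : ∀ p, volume (cell p) ≠ ⊤ := by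
    intro p
    rw [Measure.volume_eq_prod, Measure.prod_prod]
    exact ENNReal.mul_ne_top (by simp) (by simp)
  have hfun : (fun z : ℝ × ℝ =>
      if 0 ≤ c₁ + s * z.1 ∧ 0 ≤ c₂ + s * z.2 ∧ (⌊c₁ + s * z.1⌋₊, ⌊c₂ + s * z.2⌋₊) ∈ S then
        s ^ 2 * f (⌊c₁ + s * z.1⌋₊, ⌊c₂ + s * z.2⌋₊) else 0) =
      fun z => ∑ p ∈ S, (cell p).indicator (fun _ => s ^ 2 * f p) z := by
    funext z
    simp only [Set.indicator_apply, hcell]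
    by_cases h0 : 0 ≤ c₁ + s * z.1 ∧ 0 ≤ c₂ + s * z.2
    · simp only [h0, true_and]
      rw [Finset.sum_ite_eq]
    · rw [if_neg fun h => h0 ⟨h.1, h.2.1⟩]
      simp [h0]
  rw [hfun]
  constructor
  · exact Finset.measurable_sum _ fun p _ => measurable_const.indicator (hmeas p)
  · rw [integral_finsetSum]
    · refine Finset.sum_congr rfl fun p _ => ?_
      rw [integral_indicator_const _ (hmeas p), hvol, smul_eq_mul]
      field_simp
    · intro p _
      exact (integrable_indicator_iff (hmeas p)).2 (integrableOn_const (hfin p))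

/-- Rounding moves z by at most 1/s ≤ 1. A Gaussian bound at lattice points thus transfers to whole
cells, at the cost of half the exponent and a constant factor. -/
theorem sq_div_two_sub_one_le (c s z : ℝ) (hs : 1 ≤ s) (h0 : 0 ≤ c + s * z) :
    z ^ 2 / 2 - 1 ≤ ((⌊c + s * z⌋₊ - c) / s) ^ 2 := by
  have h1 := Nat.floor_le h0
  have h2 := Nat.lt_floor_add_one (c + s * z)
  have hs0 : 0 < s := by linarith
  obtain ⟨w, hw⟩ : ∃ w, w = ((⌊c + s * z⌋₊ : ℝ) - c) / s := ⟨_, rfl⟩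
  rw [← hw]
  have hw1 : w ≤ z := by rw [hw, div_le_iff₀ hs0]; linarith
  have hw2 : z - 1 ≤ w := by rw [hw, le_div_iff₀ hs0]; nlinarith
  nlinarith [sq_nonneg (2 * w - z)]

/-- Sums over planar lattices with Gaussian domination converge to integrals. -/
theorem tendsto_lattice_sum {F : Filter ℕ} [F.IsCountablyGenerated] (S : ℕ → Finset (ℕ × ℕ))
    (f : ℕ → ℕ × ℕ → ℝ) (c₁ c₂ s : ℕ → ℝ) (g : ℝ × ℝ → ℝ) (C a : ℝ) (hC : 0 ≤ C) (ha : 0 < a)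
    (hs : ∀ᶠ i in F, 1 ≤ s i)
    (hbound : ∀ᶠ i in F, ∀ p ∈ S i, |s i ^ 2 * f i p| ≤
      C * Real.exp (-(a * (((p.1 - c₁ i) / s i) ^ 2 + ((p.2 - c₂ i) / s i) ^ 2))))
    (hmem : ∀ z : ℝ × ℝ, ∀ᶠ i in F, 0 ≤ c₁ i + s i * z.1 ∧ 0 ≤ c₂ i + s i * z.2 ∧
      (⌊c₁ i + s i * z.1⌋₊, ⌊c₂ i + s i * z.2⌋₊) ∈ S i)
    (hlim : ∀ z : ℝ × ℝ, Tendsto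
      (fun i => s i ^ 2 * f i (⌊c₁ i + s i * z.1⌋₊, ⌊c₂ i + s i * z.2⌋₊)) F (𝓝 (g z))) :
    Tendsto (fun i => ∑ p ∈ S i, f i p) F (𝓝 (∫ z, g z)) := by
  have hdom := tendsto_integral_filter_of_dominated_convergence (μ := (volume : Measure (ℝ × ℝ)))
    (l := F) (F := fun i z =>
      if 0 ≤ c₁ i + s i * z.1 ∧ 0 ≤ c₂ i + s i * z.2 ∧
          (⌊c₁ i + s i * z.1⌋₊, ⌊c₂ i + s i * z.2⌋₊) ∈ S i then
        s i ^ 2 * f i (⌊c₁ i + s i * z.1⌋₊, ⌊c₂ i + s i * z.2⌋₊) else 0) (f := g)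
    (fun z => C * Real.exp (2 * a) * Real.exp (-(a / 2 * (z.1 ^ 2 + z.2 ^ 2)))) ?_ ?_ ?_ ?_
  · refine hdom.congr' ?_
    filter_upwards [hs] with i hi
    exact (sum_eq_integral_floor (S i) (f i) (c₁ i) (c₂ i) (s i) (by linarith)).2.symm
  · filter_upwards [hs] with i hi
    exact (sum_eq_integral_floor (S i) (f i) (c₁ i) (c₂ i) (s i)
      (by linarith)).1.aestronglyMeasurable
  · filter_upwards [hs, hbound] with i hi hb
    refine Eventually.of_forall fun z => ?_
    split_ifs with h
    · obtain ⟨h1, h2, h3⟩ := h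
      rw [Real.norm_eq_abs]
      refine (hb _ h3).trans ?_
      rw [mul_assoc, ← Real.exp_add]
      refine mul_le_mul_of_nonneg_left (Real.exp_le_exp.2 ?_) hC
      have q1 := sq_div_two_sub_one_le (c₁ i) (s i) z.1 hi h1
      have q2 := sq_div_two_sub_one_le (c₂ i) (s i) z.2 hi h2
      nlinarith
    · rw [norm_zero]; positivity
  · exact (integrable_exp_neg_mul_sq_add_sq (a / 2) (by positivity)).const_mul _
  · refine Eventually.of_forall fun z => (hlim z).congr' ?_
    filter_upwards [hmem z] with i hi
    rw [if_pos hi]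

/-- The second variable is divided by l because t, not τ·m, is what runs over the integer lattice.
Completing the square reduces the integral to the determinant in `overlapHessian_det`. -/
theorem integral_overlapHessian (d l β : ℝ) (hd : 2 ≤ d) (hl : 1 ≤ l) (hβ : 0 < β)
    (hβd : β * d < 1) (hβl : β * ((d - 1) * (l - 1) + 1) ≤ 1) :
    ∫ z : ℝ × ℝ, 1 / (2 * Real.pi * β ^ 2 * (1 - β * d) * √(l * (d - 1))) *
        Real.exp (-(overlapHessian d l β z.1 (z.2 / l) / 2)) =
      (1 - β) / √(β ^ 2 * (d + l - d * l) - 2 * β + 1) := by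
  have hd1 : 0 < d - 1 := by linarith
  have hd0 : 0 < d := by linarith
  have hl0 : 0 < l := by linarith
  have hβd' : 0 < 1 - β * d := by linarith
  have hβ1 : β < 1 / 2 := by nlinarith
  have hβ1' : 0 < 1 - β := by linarith
  have hv := variance_factor_pos d l β hd hβ hβd hβl
  obtain ⟨v, hvdef⟩ : ∃ v, v = β ^ 2 * (d + l - d * l) - 2 * β + 1 := ⟨_, rfl⟩
  rw [← hvdef] at hv ⊢
  obtain ⟨P, hP⟩ : ∃ P, P = 1 / β ^ 2 - 2 * (l - 1) / (β * (1 - β)) - (l - 1) / (1 - β) ^ 2 :=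
    ⟨_, rfl⟩
  obtain ⟨R, hR⟩ : ∃ R, R = l / ((d - 1) * β ^ 2) := ⟨_, rfl⟩
  obtain ⟨S, hS⟩ : ∃ S, S = 2 * l / (β * (1 - β * d)) + l * d / (1 - β * d) ^ 2 := ⟨_, rfl⟩
  obtain ⟨D, hD⟩ : ∃ D, D = P * R + (P + R) * S := ⟨_, rfl⟩
  have hR0 : 0 < R := by rw [hR]; positivity
  have hS0 : 0 < S := by rw [hS]; positivity
  have hDval : D = l * v / (β ^ 4 * (1 - β * d) ^ 2 * (d - 1) * (1 - β) ^ 2) := by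
    have := overlapHessian_det d l β hd hl hβ hβd
    rw [← hP, ← hR, ← hS, ← hD] at this
    rw [this, hvdef]
  have hD0 : 0 < D := by rw [hDval]; positivity
  have hA0 : 0 < R + S := by positivity
  have hsq : ∀ z : ℝ × ℝ, overlapHessian d l β z.1 (z.2 / l) / 2 =
      D / (2 * (R + S)) * z.1 ^ 2 +
        (R + S) / (2 * l ^ 2) * (z.2 + l * (S / (R + S)) * z.1) ^ 2 := by
    intro z
    rw [overlapHessian_complete_square d l β _ _ P R S D hP hR hS hD hA0.ne']
    field_simp
  obtain ⟨c, hc, hlow⟩ := overlapHessian_lower d l β hd hl hβ hβd hβl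
  have hint : Integrable fun z : ℝ × ℝ =>
      Real.exp (-(overlapHessian d l β z.1 (z.2 / l) / 2)) := by
    refine (integrable_exp_neg_mul_sq_add_sq (c / 2 / l ^ 2) (by positivity)).mono' ?_ ?_
    · refine Continuous.aestronglyMeasurable ?_
      unfold overlapHessian
      fun_prop
    · refine Eventually.of_forall fun z => ?_
      rw [Real.norm_eq_abs, abs_of_pos (Real.exp_pos _)]
      apply Real.exp_le_exp.2
      have h1 := hlow z.1 (z.2 / l)
      have h2 : c / 2 / l ^ 2 * (z.1 ^ 2 + z.2 ^ 2) ≤ c / 2 * (z.1 ^ 2 + (z.2 / l) ^ 2) := by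
        have e : c / 2 * (z.1 ^ 2 + (z.2 / l) ^ 2) =
          c / 2 / l ^ 2 * (l ^ 2 * z.1 ^ 2 + z.2 ^ 2) := by field_simp
        rw [e]
        have : z.1 ^ 2 ≤ l ^ 2 * z.1 ^ 2 := le_mul_of_one_le_left (sq_nonneg _) (by nlinarith)
        gcongr
      linarith
  simp only [hsq] at hint ⊢
  rw [integral_const_mul, integral_exp_neg_quadratic _ _ _ hint,
    ← Real.sqrt_mul (by positivity)]
  have hprod : Real.pi / (D / (2 * (R + S))) * (Real.pi / ((R + S) / (2 * l ^ 2))) =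
      (2 * Real.pi * β ^ 2 * (1 - β * d) * (1 - β)) ^ 2 * (l * (d - 1)) / v := by
    rw [hDval]
    field_simp
  rw [hprod, Real.sqrt_div' _ hv.le,
    Real.sqrt_mul (sq_nonneg (2 * Real.pi * β ^ 2 * (1 - β * d) * (1 - β))),
    Real.sqrt_sq (by positivity)]
  have hπ := Real.pi_pos
  have hr : 0 < √(l * (d - 1)) := Real.sqrt_pos.2 (by positivity)
  have hrv : 0 < √v := Real.sqrt_pos.2 hv
  field_simp

end LatticeSum

/-! ### Assembly of the limit. -/

section SecondMoment

theorem tendsto_floor_rescaled {F : Filter ℕ} (hF : F ≤ atTop) (c z : ℝ) (hc : 0 < c) :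
    (∀ᶠ m : ℕ in F, 0 ≤ c * m + √(m : ℝ) * z) ∧
    Tendsto (fun m : ℕ => ((⌊c * m + √(m : ℝ) * z⌋₊ : ℝ) / m - c) * √(m : ℝ)) F (𝓝 z) ∧
    Tendsto (fun m : ℕ => (⌊c * m + √(m : ℝ) * z⌋₊ : ℝ) / m) F (𝓝 c) := by
  have hsq : Tendsto (fun m : ℕ => √(m : ℝ)) F atTop :=
    Real.tendsto_sqrt_atTop.comp (tendsto_natCast_atTop_atTop.mono_left hF)
  have hm0 : ∀ᶠ m : ℕ in F, 0 < m := hF (eventually_gt_atTop 0)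
  have hnonneg : ∀ᶠ m : ℕ in F, 0 ≤ c * m + √(m : ℝ) * z := by
    filter_upwards [hsq.eventually_ge_atTop (-z / c)] with m hm
    rw [div_le_iff₀ hc] at hm
    have h : c * m + √(m : ℝ) * z = √(m : ℝ) * (√(m : ℝ) * c + z) := by
      linear_combination -c * Real.mul_self_sqrt (Nat.cast_nonneg (α := ℝ) m)
    rw [h]
    exact mul_nonneg (Real.sqrt_nonneg _) (by linarith)
  have hdev : Tendsto (fun m : ℕ => ((⌊c * m + √(m : ℝ) * z⌋₊ : ℝ) / m - c) * √(m : ℝ)) F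
      (𝓝 z) := by
    rw [tendsto_iff_norm_sub_tendsto_zero]
    refine squeeze_zero' (Eventually.of_forall fun _ => norm_nonneg _) ?_
      hsq.inv_tendsto_atTop
    filter_upwards [hnonneg, hm0] with m h0 hm
    have hm' : (0 : ℝ) < m := by exact_mod_cast hm
    have hs : 0 < √(m : ℝ) := Real.sqrt_pos.2 hm'
    have hss : √(m : ℝ) * √(m : ℝ) = m := Real.mul_self_sqrt hm'.le
    have h1 := Nat.floor_le h0
    have h2 := Nat.lt_floor_add_one (c * m + √(m : ℝ) * z)
    obtain ⟨X, hX⟩ : ∃ X : ℝ, X = ⌊c * m + √(m : ℝ) * z⌋₊ := ⟨_, rfl⟩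
    rw [← hX] at h1 h2 ⊢
    have e : (X / m - c) * √(m : ℝ) - z = (X - (c * m + √(m : ℝ) * z)) * (√(m : ℝ))⁻¹ := by
      obtain ⟨q, hq⟩ : ∃ q, q = √(m : ℝ) := ⟨_, rfl⟩
      rw [← hq] at hs hss ⊢
      rw [← hss]
      field_simp
      ring
    rw [e, norm_mul, Real.norm_eq_abs, Real.norm_eq_abs, abs_of_pos (inv_pos.2 hs), Pi.inv_apply]
    refine mul_le_of_le_one_left (inv_pos.2 hs).le ?_
    rw [abs_le]
    constructor <;> linarith
  refine ⟨hnonneg, hdev, ?_⟩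
  have h := (hdev.mul hsq.inv_tendsto_atTop).add_const c
  rw [mul_zero, zero_add] at h
  refine h.congr' ?_
  filter_upwards [hm0] with m hm
  have hs : √(m : ℝ) ≠ 0 := (Real.sqrt_pos.2 (by exact_mod_cast hm)).ne'
  rw [Pi.inv_apply, mul_assoc, mul_inv_cancel₀ hs]
  ring

/-- At the centre the constraints reduce to β² < β, β(1−βd) > 0 and (1−βd)²/d > 0. All are strict,
so they persist near the limit. -/
theorem eventually_mem_overlapIndex (d l : ℕ) (β : ℝ) (hd : 2 ≤ d) (hl : 1 ≤ l) (hβ : 0 < β)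
    (hβd : β * d < 1) {F : Filter ℕ} (hF : F ≤ atTop) (n k r t : ℕ → ℕ)
    (hev : ∀ᶠ m in F, n m * d = m * l ∧ (k m : ℝ) = m * β)
    (hr : Tendsto (fun m : ℕ => (r m : ℝ) / m) F (𝓝 (β ^ 2)))
    (ht : Tendsto (fun m : ℕ => (t m : ℝ) / m) F (𝓝 (l * (d - 1) * β ^ 2))) :
    ∀ᶠ m in F, (r m, t m) ∈ overlapIndex l (n m) (k m) := by
  have hd' : (2 : ℝ) ≤ d := by exact_mod_cast hd
  have hl' : (0 : ℝ) < l := by exact_mod_cast hl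
  have hd0 : (0 : ℝ) < d := by linarith
  have hβ1 : β < 1 := by nlinarith
  have hβd' : 0 < 1 - β * d := by linarith
  have e1 : ∀ᶠ m in F, (r m : ℝ) / m < β := hr.eventually_lt_const (by nlinarith)
  have e2 : ∀ᶠ m in F, (t m : ℝ) / m + r m / m * l < β * l := by
    refine (ht.add (hr.mul_const (l : ℝ))).eventually_lt_const ?_
    have : 0 < β * l * (1 - β * d) := by positivity
    linarith
  have e3 : ∀ᶠ m in F, l * (2 * β - 1 / d) < (t m : ℝ) / m + r m / m * l := by
    refine (ht.add (hr.mul_const (l : ℝ))).eventually_const_lt ?_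
    have h : 0 < l * (1 - β * d) ^ 2 / d := by positivity
    have e : (l : ℝ) * (1 - β * d) ^ 2 / d =
      l * (d - 1) * β ^ 2 + β ^ 2 * l - l * (2 * β - 1 / d) := by field_simp; ring
    linarith
  filter_upwards [e1, e2, e3, hev, hF (eventually_gt_atTop 0)] with m h1 h2 h3 ⟨hn, hk⟩ hm
  have hm' : (0 : ℝ) < m := by exact_mod_cast hm
  have hn' : (n m : ℝ) = m * l / d := by
    rw [eq_div_iff hd0.ne']; exact_mod_cast hn
  rw [div_lt_iff₀ hm'] at h1
  have h4 : (t m : ℝ) / m + r m / m * l = (t m + r m * l) / m := by ring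
  rw [h4, div_lt_iff₀ hm'] at h2
  rw [h4, lt_div_iff₀ hm'] at h3
  have hrk : r m ≤ k m := by
    have : (r m : ℝ) ≤ k m := by rw [hk]; linarith
    exact_mod_cast this
  have hcast : (((k m - r m) * l : ℕ) : ℝ) = (k m - r m) * l := by
    rw [Nat.cast_mul, Nat.cast_sub hrk]
  refine mem_overlapIndex.2 ⟨hrk, ?_, ?_⟩
  · have : (t m : ℝ) ≤ ((k m - r m) * l : ℕ) := by rw [hcast, hk]; linarith
    exact_mod_cast this
  · have : (k m - r m) * l + k m * l ≤ n m + t m := by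
      have : (((k m - r m) * l : ℕ) : ℝ) + k m * l ≤ n m + t m := by
        rw [hcast, hk, hn']
        have e : (l : ℝ) * (2 * β - 1 / d) * m = 2 * (m * β * l) - m * l / d := by ring
        linarith
      exact_mod_cast this
    simp only
    omega

theorem lemmal08 (d l : ℕ) (hd : 2 ≤ d) (hl : 2 ≤ l) (β : ℝ) (hβ0 : 0 < β)
    (hβd : β < 1 / (d : ℝ))
    (hcase : l = 2 ∨ (3 ≤ l ∧ β ≤ 1 / ((d : ℝ) * l - d - l + 2)))
    (hΨ : 0 < matchingPsi d l β (β ^ 2) (l * (d - 1) * β ^ 2)) :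
    Tendsto
      (fun m : ℕ =>
        RegHypergraph.expectation d l m (fun G => (G.numMatchings ⌊m * β⌋₊ : ℝ) ^ 2) /
          (RegHypergraph.expectation d l m (fun G => (G.numMatchings ⌊m * β⌋₊ : ℝ))) ^ 2)
      (admissibleAtTop d l β)
      (𝓝 ((1 - β) / Real.sqrt (β ^ 2 * (d + l - d * l) - 2 * β + 1))) := by
  have hd' : (2 : ℝ) ≤ d := by exact_mod_cast hd
  have hl2 : (2 : ℝ) ≤ l := by exact_mod_cast hl
  have hd0 : (0 : ℝ) < d := by linarith
  have hl0 : (0 : ℝ) < l := by linarith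
  have hd1 : (0 : ℝ) < (d : ℝ) - 1 := by linarith
  have hβd1 : β * d < 1 := (lt_div_iff₀ hd0).1 hβd
  -- For l = 2 this is βd ≤ 1; for l ≥ 3 the assumed denominator equals (d−1)(l−1)+1.
  have hβl : β * (((d : ℝ) - 1) * (l - 1) + 1) ≤ 1 := by
    rcases hcase with rfl | ⟨-, h⟩
    · push_cast
      linarith
    · have hpos : (0 : ℝ) < d * l - d - l + 2 := by nlinarith
      rw [le_div_iff₀ hpos] at h
      linarith
  have hF : admissibleAtTop d l β ≤ atTop := inf_le_left
  have : (admissibleAtTop d l β).IsCountablyGenerated := by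
    unfold admissibleAtTop; infer_instance
  -- Along the admissible m neither the natural division nor the floor rounds anything.
  have hadm : ∀ᶠ m : ℕ in admissibleAtTop d l β,
      l * m / d * d = m * l ∧ (⌊m * β⌋₊ : ℝ) = m * β := by
    refine (eventually_inf_principal.2 (Eventually.of_forall ?_))
    rintro m ⟨hdvd, k, hk⟩
    refine ⟨by rw [Nat.div_mul_cancel hdvd, mul_comm], ?_⟩
    rw [← hk, Nat.floor_natCast]
  have hm0 : ∀ᶠ m : ℕ in admissibleAtTop d l β, 0 < m := hF (eventually_gt_atTop 0)
  obtain ⟨C, c, hC, hc, hgauss⟩ := overlapWeight_le_gaussian d (l - 1) β hd (by omega) hβ0 hβd1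
    (by rw [Nat.cast_sub (by omega)]; exact_mod_cast hβl)
  have hl1 : l - 1 + 1 = l := by omega
  have hl1' : ((l - 1 : ℕ) : ℝ) + 1 = l := by exact_mod_cast hl1
  rw [hl1, hl1'] at hgauss
  have hc2 : 0 < l * ((d : ℝ) - 1) * β ^ 2 := by positivity
  have hmem : ∀ z : ℝ × ℝ, ∀ᶠ m : ℕ in admissibleAtTop d l β,
      0 ≤ β ^ 2 * m + √(m : ℝ) * z.1 ∧ 0 ≤ l * ((d : ℝ) - 1) * β ^ 2 * m + √(m : ℝ) * z.2 ∧
      (⌊β ^ 2 * m + √(m : ℝ) * z.1⌋₊, ⌊l * ((d : ℝ) - 1) * β ^ 2 * m + √(m : ℝ) * z.2⌋₊) ∈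
        overlapIndex l (l * m / d) ⌊m * β⌋₊ := by
    intro z
    obtain ⟨p1, -, q1⟩ := tendsto_floor_rescaled hF (β ^ 2) z.1 (by positivity)
    obtain ⟨p2, -, q2⟩ := tendsto_floor_rescaled hF _ z.2 hc2
    exact p1.and (p2.and (eventually_mem_overlapIndex d l β hd (by omega) hβ0 hβd1 hF
      (fun m => l * m / d) (fun m => ⌊m * β⌋₊) _ _ hadm q1 q2))
  have hsum := tendsto_lattice_sum (F := admissibleAtTop d l β)
    (fun m => overlapIndex l (l * m / d) ⌊m * β⌋₊)
    (fun m p => overlapWeight d l m (l * m / d) ⌊m * β⌋₊ p.1 p.2)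
    (fun m => β ^ 2 * m) (fun m => l * ((d : ℝ) - 1) * β ^ 2 * m) (fun m => √(m : ℝ))
    (fun z => 1 / (2 * Real.pi * β ^ 2 * (1 - β * d) * √(l * ((d : ℝ) - 1))) *
        Real.exp (-(overlapHessian d l β z.1 (z.2 / l) / 2)))
    -- The factor l² converts deviations of τ = t/(lm) into deviations of t/m; in the first
    -- coordinate it only weakens the bound.
    C (c / l ^ 2) hC.le (by positivity) ?_ ?_ hmem ?_
  · rw [integral_overlapHessian d l β hd' (by linarith) hβ0 hβd1 hβl] at hsum
    refine hsum.congr' ?_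
    filter_upwards [hadm, hm0] with m ⟨hn, hk⟩ hm
    have hm' : (0 : ℝ) < m := by exact_mod_cast hm
    symm
    refine second_moment_ratio_eq_sum d l m _ _ (by omega) hn ?_ ?_
    · have h : (⌊m * β⌋₊ * l * d : ℝ) ≤ (l * m / d : ℕ) * d := by
        have : ((l * m / d : ℕ) : ℝ) * d = m * l := by exact_mod_cast hn
        rw [this, hk]
        have := mul_le_mul_of_nonneg_left hβd1.le (mul_pos hm' hl0).le
        linarith
      have h' : ⌊m * β⌋₊ * l * d ≤ l * m / d * d := by exact_mod_cast h
      exact Nat.le_of_mul_le_mul_right h' (by omega)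
    · have h : (2 * ⌊m * β⌋₊ : ℝ) ≤ m := by
        rw [hk]
        nlinarith
      exact_mod_cast h
  · filter_upwards [hm0] with m hm
    rw [Real.one_le_sqrt]
    exact_mod_cast hm
  · filter_upwards [hadm, hm0] with m ⟨hn, hk⟩ hm
    rintro ⟨r, t⟩ hp
    have hm' : (0 : ℝ) < m := by exact_mod_cast hm
    have hs : 0 < √(m : ℝ) := Real.sqrt_pos.2 hm'
    have hss : √(m : ℝ) ^ 2 = m := Real.sq_sqrt hm'.le
    simp only
    rw [hss]
    refine (hgauss m _ _ r t hm hn hk hp).trans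
      (mul_le_mul_of_nonneg_left (Real.exp_le_exp.2 (neg_le_neg ?_)) hC.le)
    rw [div_pow, div_pow, hss]
    have e : c * m * (((r : ℝ) / m - β ^ 2) ^ 2 + ((t : ℝ) / (m * l) - (d - 1) * β ^ 2) ^ 2) =
        c / l ^ 2 * (l ^ 2 * ((r - β ^ 2 * m) ^ 2 / m) +
          (t - l * (d - 1) * β ^ 2 * m) ^ 2 / m) := by
      field_simp
    rw [e]
    have h1 : ((r : ℝ) - β ^ 2 * m) ^ 2 / m ≤ l ^ 2 * ((r - β ^ 2 * m) ^ 2 / m) :=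
      le_mul_of_one_le_left (by positivity) (by nlinarith)
    gcongr
  · intro z
    obtain ⟨-, q1, -⟩ := tendsto_floor_rescaled hF (β ^ 2) z.1 (by positivity)
    obtain ⟨-, q2, -⟩ := tendsto_floor_rescaled hF _ z.2 hc2
    have h := tendsto_overlapWeight d l β hd (by omega) hβ0 hβd1 hF
      (fun m => l * m / d) (fun m => ⌊m * β⌋₊) _ _ ((hadm.and (hmem z)).mono fun m h =>
        ⟨h.1.1, h.1.2, h.2.2.2⟩) z.1 (z.2 / l) q1 ((q2.div_const (l : ℝ)).congr fun m => by
          field_simp)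
    refine h.congr fun m => ?_
    simp only
    rw [Real.sq_sqrt (Nat.cast_nonneg m)]

end SecondMoment
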